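/- **Theorem 7.8.** Let $n\ge 0$ and let $\mathfrak C_n$ be the set of crossingless $n$-matchings (Temperley–Lieb $(0,2n)$-tangles); for $\alpha,\beta\in\mathfrak C_n$ let $c_{\alpha\beta}$ be the number of circles in $\alpha^\diamond\circ\beta$, where $\alpha^\diamond$ is the reflected $(2n,0)$-tangle. Let $k$ be an integral domain (for example $\mathbb Z$ or $\mathbb Q$). *The projector.* For a ring $R$ let $\mathrm{TL}^{\rm spl}_{2n}(R)$ be the free $R$-module with basis the split Temperley–Lieb $(2n,2n)$-tangles $\langle\beta\circ\alpha^\diamond\rangle$, $\alpha,\beta\in\mathfrak C_n$. Elements of $\mathrm{TL}^{\rm spl}_{2n}(\mathbb Q(q))$ act on the $\mathbb Q(q)$-vector space with basis $\langle\gamma\rangle$, $\gamma\in\mathfrak C_n$, by composition, every circle being replaced by $-(q+q^{-1})$: $\langle\beta\circ\alpha^\diamond\rangle\circ\langle\gamma\rangle=(-q-q^{-1})^{c_{\alpha\gamma}}\langle\beta\rangle$. There is a unique $P_{2n,0}\in \mathrm{TL}^{\rm spl}_{2n}(\mathbb Q(q))$ such that $P_{2n,0}\circ\langle\gamma\rangle=\langle\gamma\rangle$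 for all $\gamma\in\mathfrak C_n$. *The resolution.* For $\alpha,\beta\in\mathfrak C_n$ let $\mathrm{Hom}(\alpha,\beta)$ be the tensor product of copies of the Frobenius algebra $k[x]/(x^2)$ over the circles of $\alpha^\diamond\circ\beta$; a tensor product of $1$'s and $s$ copies of $x$ has $q$-degree $n-c_{\alpha\beta}+2s$, and its $\mathbb Z/2$-degree is the $q$-degree mod $2$. Khovanov's arc algebra is $H_n=\bigoplus_{\alpha,\beta}\mathrm{Hom}(\alpha,\beta)$, with the product $\mathrm{Hom}(\alpha,\beta)\otimes\mathrm{Hom}(\beta,\gamma)\to\mathrm{Hom}(\alpha,\gamma)$ given by the minimal saddle cobordism. Let $\check{\mathrm{TL}}^{\rm spl}_{2n}$ be the additive category generated by the split tangles $\langle\langle\beta\circ\alpha^\diamond\rangle\rangle$ with shifts $[0,j,\mu]$, $j\in\mathbb Z$, $\mu\in\mathbb Z/2$, where the morphisms $\langle\langle\beta_1\circ\alpha_1^\diamond\rangle\rangle\to\langle\langle\beta_2\circ\alpha_2^\diamond\rangle\rangle$ form $\mathrm{Hom}(\beta_1,\beta_2)\otimes\mathrm{Hom}(\alpha_2,\alpha_1)$,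 and let $\mathcal F_K$ be the functor which sends $\langle\langle\beta\circ\alpha^\diamond\rangle\rangle$ to the projective graded $H_n$-bimodule $\bigoplus_{\beta',\alpha'}\mathrm{Hom}(\beta',\beta)\otimes\mathrm{Hom}(\alpha,\alpha')$ with both degrees shifted by $-n$. Let $\mathrm{TL}^{{\rm spl},- /+}_{2n}$ be the homotopy category of those bounded from above complexes over $\check{\mathrm{TL}}^{\rm spl}_{2n}$, with differentials of degree $0$, which are $q^+$-bounded: the least $q$-shift of a summand in homological degree $-i$ tends to $+\infty$ as $i\to\infty$. For such a complex $\mathbf A$, with $m^{\beta\alpha}_{i,j,\mu}$ summands $\langle\langle\beta\circ\alpha^\diamond\rangle\rangle[0,j,\mu]$ in homological degree $i$, put $$K_0^+(\mathbf A)=\sum_{\alpha,\beta}\sum_{i,j,\mu}(-1)^{i+\mu}\,m^{\beta\alpha}_{i,j,\mu}\,q^j\,\langle\beta\circ\alpha^\diamond\rangle\ \in\ \mathrm{TL}^{\rm spl}_{2n}(\mathbb Q((q))).$$ There is a complex $\mathbf P_n$ in $\mathrm{TL}^{{\rm spl},- /+}_{2n}$ (the universal projective resolution) such that the complex of graded bimodules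 $\mathcal F_K(\mathbf P_n)$ is quasi-isomorphic to $H_n$ placed in homological degree $0$, and every such complex satisfies $$K_0^+(\mathbf P_n)=P_{2n,0},$$ where the coefficients of $P_{2n,0}$ are expanded as Laurent series at $q=0$. -/

import Mathlib

open scoped TensorProduct

noncomputable section

namespace ArcTL

/-! ### Crossingless matchings and circles -/

/-- Crossingless `n`-matchings, i.e. Temperley-Lieb `(0, 2n)`-tangles: fixed point free involutions
of the `2n` end-points such that no two arcs cross. -/
def Matching (n : ℕ) : Type :=
  {σ : Fin (2 * n) → Fin (2 * n) //
    (∀ p, σ (σ p) = p) ∧ (∀ p, σ p ≠ p) ∧ ∀ p q, ¬ (p < q ∧ q < σ p ∧ σ p < σ q)}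

instance (n : ℕ) : CoeFun (Matching n) (fun _ => Fin (2 * n) → Fin (2 * n)) := ⟨Subtype.val⟩

instance (n : ℕ) : DecidableEq (Matching n) :=
  inferInstanceAs (DecidableEq (Subtype _))

instance (n : ℕ) : Fintype (Matching n) :=
  inferInstanceAs (Fintype (Subtype _))

variable {n : ℕ}

/-- Two end-points are equivalent if they lie on the same circle of the closed `1`-manifold obtained
by gluing `α` and `β` along their end-points. -/
def circleRel (α β : Matching n) : Setoid (Fin (2 * n)) :=
  Relation.EqvGen.setoid (fun p q => q = α p ∨ q = β p)

/-- The set of circles of the closed `1`-manifold `α^⋄ ∘ β`. -/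
abbrev Circles (α β : Matching n) : Type := Quotient (circleRel α β)

/-- The circle through the end-point `p`. -/
def circleAt (α β : Matching n) (p : Fin (2 * n)) : Circles α β := Quotient.mk _ p

/-- The number of circles of `α^⋄ ∘ β`. -/
def numCircles (α β : Matching n) : ℕ := Nat.card (Circles α β)

/-! ### The Frobenius algebra and the spaces of cobordisms -/

/-- The tensor product, over a set `C` of circles, of copies of the Frobenius algebra
`k[x] / (x²)`. -/
abbrev CircleAlg (k : Type*) [CommRing k] (C : Type) : Type _ :=
  MvPolynomial C k ⧸ Ideal.span (Set.range fun c : C => (MvPolynomial.X c : MvPolynomial C k) ^ 2)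

section
variable (k : Type*) [CommRing k]

/-- The element `x` placed on the circle `c`. -/
def dot {C : Type} (c : C) : CircleAlg k C := Ideal.Quotient.mk _ (MvPolynomial.X c)

lemma dot_sq {C : Type} (c : C) : dot k c ^ 2 = 0 := by
  unfold dot
  rw [← map_pow]
  exact Ideal.Quotient.eq_zero_iff_mem.mpr (Ideal.subset_span ⟨c, rfl⟩)

/-- The algebra homomorphism which moves `x` from each circle `c` to the circle `φ c`. -/
def push {C D : Type} (φ : C → D) : CircleAlg k C →ₐ[k] CircleAlg k D :=
  Ideal.Quotient.liftₐ _ (MvPolynomial.aeval fun c => dot k (φ c)) (by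
    intro a ha
    have h : Ideal.span (Set.range fun c : C => (MvPolynomial.X c : MvPolynomial C k) ^ 2) ≤
        RingHom.ker (MvPolynomial.aeval (R := k) fun c => dot k (φ c)) := by
      rw [Ideal.span_le]
      rintro _ ⟨c, rfl⟩
      simp [RingHom.mem_ker, dot_sq]
    exact h ha)

/-- The space of morphisms from `⟨⟨α⟩⟩` to `⟨⟨β⟩⟩`: freely generated by the reduced planar
cobordisms, each of which chooses `1` (a disk) or `x` for every circle. The direct sum of these
spaces over all pairs `α`, `β` is the arc algebra `H_n`, and `Hom k α β` is its component
`e_α H_n e_β`. -/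
abbrev Hom (α β : Matching n) : Type _ := CircleAlg k (Circles α β)

/-- The part of `Hom k α β` of `q`-degree `d`. A reduced cobordism with `x` on the set `S` of circles
has `q`-degree `n - (number of circles) + 2 |S|`. Its `ℤ/2`-degree is the reduction of its
`q`-degree modulo `2`. -/
def Hom.deg (α β : Matching n) (d : ℤ) : Submodule k (Hom k α β) :=
  Submodule.span k
    {f | ∃ S : Finset (Circles α β),
      (n : ℤ) - numCircles α β + 2 * S.card = d ∧ f = ∏ c ∈ S, dot k c}

end

/-! ### Composition of cobordisms, i.e. the product of the arc algebra

The product `Hom α β × Hom β γ → Hom α γ` is induced by the minimal cobordism from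
`α^⋄ ∘ β ⊔ β^⋄ ∘ γ` to `α^⋄ ∘ γ`, which is a composition of `n` saddles, one for each arc of `β`; they
are performed in the order of the left ends of the arcs. -/

/-- The circles of the intermediate closed `1`-manifold in which the saddles have already been
performed at those arcs of `β` whose left end precedes `p`. There are two copies of the `2n` points.
The copy `false` carries the arcs of `α`, the copy `true` carries the arcs of `γ`. At an arc of `β`
the two copies of this arc are present before its saddle, and two vertical segments which join the two
copies of each of its two ends are present after it. -/
def midRel (α β γ : Matching n) (p : Fin (2 * n)) : Setoid (Fin (2 * n) × Bool) :=
  Relation.EqvGen.setoid (fun u v =>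
    (u.2 = false ∧ v = (α u.1, false)) ∨
    (u.2 = true ∧ v = (γ u.1, true)) ∨
    (min u.1 (β u.1) < p ∧ v = (u.1, !u.2)) ∨
    (¬ min u.1 (β u.1) < p ∧ v = (β u.1, u.2)))

/-- The point `p` is the left end of an arc of `β` at which the saddle splits one circle into two. At
the other arcs of `β` the saddle merges two circles. -/
def SplitsAt (α β γ : Matching n) (p : Fin (2 * n)) : Prop :=
  p < β p ∧ midRel α β γ p (p, false) (p, true)

section
variable (k : Type*) [CommRing k]

open Classical in
/-- The image of `1 ⊗ 1` under the composition of all saddle maps. A merging saddle is the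
multiplication of `k[x] / (x²)`, a splitting saddle is the comultiplication
`1 ↦ x ⊗ 1 + 1 ⊗ x`, `x ↦ x ⊗ x`, i.e. multiplication of (any lift of) the argument by the sum of the
`x`'s of the two new circles. -/
def saddleFactor (α β γ : Matching n) : Hom k α γ :=
  ∏ p : Fin (2 * n),
    if SplitsAt α β γ p then
      dot k (circleAt α γ p) + dot k (circleAt α γ (β p))
    else 1

/-- The composition of morphisms `⟨⟨α⟩⟩ → ⟨⟨β⟩⟩ → ⟨⟨γ⟩⟩`. All saddle maps are linear over multiplication
by `x` at the end-points, so the composition is determined by its value `saddleFactor` at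
`1 ⊗ 1`; the choice of the end-point `c.out` on each circle `c` is irrelevant. -/
def mul (α β γ : Matching n) : Hom k α β →ₗ[k] Hom k β γ →ₗ[k] Hom k α γ :=
  ((LinearMap.mul k (Hom k α γ)).compl₁₂
    (push k fun c : Circles α β => circleAt α γ c.out).toLinearMap
    (push k fun c : Circles β γ => circleAt α γ c.out).toLinearMap).compr₂
    (LinearMap.mulRight k (saddleFactor k α β γ))

end

/-! ### The category of split tangles -/

/-- A split Temperley-Lieb `(2n, 2n)`-tangle `out ∘ inn^⋄` with a shift `q` of the `q`-degree and a
shift `par` of the `ℤ/2`-degree: the object `⟨⟨out ∘ inn^⋄⟩⟩ [0, q, par]`. -/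
structure ShiftedSplit (n : ℕ) where
  out : Matching n
  inn : Matching n
  q : ℤ
  par : ZMod 2

section
variable (k : Type*) [CommRing k]

/-- Morphisms (of all degrees) `⟨⟨β₁ ∘ α₁^⋄⟩⟩ → ⟨⟨β₂ ∘ α₂^⋄⟩⟩` of split tangles: a tensor product of a
morphism `⟨⟨β₁⟩⟩ → ⟨⟨β₂⟩⟩` and a morphism `⟨⟨α₁^⋄⟩⟩ → ⟨⟨α₂^⋄⟩⟩`, the latter being the same as
a morphism `⟨⟨α₂⟩⟩ → ⟨⟨α₁⟩⟩`. -/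
abbrev SHom (β₁ α₁ β₂ α₂ : Matching n) : Type _ := Hom k β₁ β₂ ⊗[k] Hom k α₂ α₁

/-- Composition of morphisms of split tangles: `f ⊗ g` followed by `f' ⊗ g'` is
`(f f') ⊗ (g' g)`. -/
def SHom.comp (β₁ α₁ β₂ α₂ β₃ α₃ : Matching n) :
    SHom k β₁ α₁ β₂ α₂ →ₗ[k] SHom k β₂ α₂ β₃ α₃ →ₗ[k] SHom k β₁ α₁ β₃ α₃ :=
  TensorProduct.map₂ (mul k β₁ β₂ β₃) (mul k α₃ α₂ α₁).flip

/-- Morphisms of split tangles of `q`-degree `d` and of `ℤ/2`-degree `e`. -/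
def SHom.deg (β₁ α₁ β₂ α₂ : Matching n) (d : ℤ) (e : ZMod 2) :
    Submodule k (SHom k β₁ α₁ β₂ α₂) :=
  Submodule.span k
    {h | ∃ (d₁ d₂ : ℤ) (f : Hom k β₁ β₂) (g : Hom k α₂ α₁),
      f ∈ Hom.deg k β₁ β₂ d₁ ∧ g ∈ Hom.deg k α₂ α₁ d₂ ∧
      d₁ + d₂ = d ∧ (d : ZMod 2) = e ∧ h = f ⊗ₜ[k] g}

/-- A `q⁺`-bounded complex of split tangles, i.e. an object of the homotopy category of
bounded from above, `q⁺`-bounded complexes over the additive category of split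
`(2n, 2n)`-tangles. The chain object in the homological degree `i` is the direct sum of the
`obj i s`, `s : Fin (size i)`, and `d i j` is the matrix of the differential if `j = i + 1`. -/
structure SplitComplex (n : ℕ) where
  size : ℤ → ℕ
  obj : ∀ i, Fin (size i) → ShiftedSplit n
  d : ∀ (i j : ℤ) (s : Fin (size i)) (t : Fin (size j)),
    SHom k (obj i s).out (obj i s).inn (obj j t).out (obj j t).inn
  /-- The differential has degree zero with respect to both shifted gradings. -/
  d_mem : ∀ i j, i + 1 = j → ∀ s t, d i j s t ∈
    SHom.deg k (obj i s).out (obj i s).inn (obj j t).out (obj j t).inn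
      ((obj i s).q - (obj j t).q) ((obj i s).par - (obj j t).par)
  d_comp_d : ∀ i j l, i + 1 = j → j + 1 = l → ∀ s u,
    ∑ t, SHom.comp k _ _ _ _ _ _ (d i j s t) (d j l t u) = 0
  bounded_above : ∃ N : ℤ, ∀ i, N < i → size i = 0
  /-- The minimal `q`-shift in the homological degree `-i` tends to `+∞` as `i → ∞`. -/
  q_bounded : ∀ J : ℤ, ∃ N : ℤ, ∀ i, i < N → ∀ s, J ≤ (obj i s).q

end

/-! ### The complex of bimodules of a complex of split tangles -/

namespace SplitComplex

variable {k : Type*} [CommRing k]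

/-- The component `e_β ℱ(P)_i e_α` of the `i`-th chain bimodule of the complex of
`H_n ⊗ H_n^op`-modules which corresponds to `P`: the direct sum of the components
`Hom(β, out) ⊗ Hom(inn, α)` of the projective bimodules of the split tangles in the
homological degree `i`. -/
abbrev FK (P : SplitComplex k n) (i : ℤ) (β α : Matching n) : Type _ :=
  ∀ s : Fin (P.size i), SHom k β α (P.obj i s).out (P.obj i s).inn

/-- The differential of the complex of bimodules. -/
def FKd (P : SplitComplex k n) (i j : ℤ) (β α : Matching n) :
    P.FK i β α →ₗ[k] P.FK j β α :=
  LinearMap.pi fun t => ∑ s : Fin (P.size i),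
    ((SHom.comp k β α _ _ _ _).flip (P.d i j s t)).comp (LinearMap.proj s)

/-- The left action of `f ∈ Hom(β', β) ⊆ H_n`. -/
def lact (P : SplitComplex k n) (i : ℤ) {β' β : Matching n} (α : Matching n)
    (f : Hom k β' β) : P.FK i β α →ₗ[k] P.FK i β' α :=
  LinearMap.pi fun s => (LinearMap.rTensor _ (mul k β' β _ f)).comp (LinearMap.proj s)

/-- The right action of `g ∈ Hom(α, α') ⊆ H_n`. -/
def ract (P : SplitComplex k n) (i : ℤ) (β : Matching n) {α α' : Matching n}
    (g : Hom k α α') : P.FK i β α →ₗ[k] P.FK i β α' :=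
  LinearMap.pi fun s => (LinearMap.lTensor _ ((mul k _ α α').flip g)).comp (LinearMap.proj s)

/-- Elements of the `i`-th chain bimodule of `q`-degree `d` and of `ℤ/2`-degree `e`. The bimodule
of the unshifted split tangle is the projective bimodule `H_n e_out ⊗ e_inn H_n` with both degrees
shifted by `-n`. -/
def FKdeg (P : SplitComplex k n) (i : ℤ) (β α : Matching n) (d : ℤ) (e : ZMod 2) :
    Submodule k (P.FK i β α) :=
  Submodule.pi Set.univ fun s => SHom.deg k β α (P.obj i s).out (P.obj i s).inn
    (d - (P.obj i s).q + n) (e - (P.obj i s).par + n)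

/-- An augmentation: a homomorphism of `H_n`-bimodules, of degree zero with respect to both
gradings, from the chain bimodule in the homological degree `0` to `H_n`, which vanishes on the
boundaries. It is the same as a chain map from the complex of bimodules to `H_n`. -/
structure Augmentation (P : SplitComplex k n) where
  map : ∀ β α : Matching n, P.FK 0 β α →ₗ[k] Hom k β α
  map_lact : ∀ (β' β α : Matching n) (f : Hom k β' β) (y : P.FK 0 β α),
    map β' α (P.lact 0 α f y) = mul k β' β α f (map β α y)
  map_ract : ∀ (β α α' : Matching n) (g : Hom k α α') (y : P.FK 0 β α),
    map β α' (P.ract 0 β g y) = mul k β α α' (map β α y) g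
  map_deg : ∀ (β α : Matching n) (d : ℤ) (e : ZMod 2) (y : P.FK 0 β α),
    y ∈ P.FKdeg 0 β α d e →
      map β α y ∈ Hom.deg k β α d ∧ ((d : ZMod 2) ≠ e → map β α y = 0)
  map_boundary : ∀ (β α : Matching n) (y : P.FK (-1) β α),
    map β α (P.FKd (-1) 0 β α y) = 0

/-- `P` represents the universal projective resolution: its complex of projective `H_n`-bimodules is
quasi-isomorphic to the bimodule `H_n` placed in the homological degree `0`. Since the complex is
bounded from above and consists of projective bimodules, the quasi-isomorphism is given by an
augmentation. -/
def IsUniversalResolution (P : SplitComplex k n) : Prop :=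
  ∃ ε : P.Augmentation, ∀ β α : Matching n,
    (∀ i j l : ℤ, i + 1 = j → j + 1 = l → j ≠ 0 →
      Function.Exact (P.FKd i j β α) (P.FKd j l β α)) ∧
    (∀ y : P.FK 0 β α, P.FKd 0 1 β α y = 0 → ε.map β α y = 0 →
      ∃ z : P.FK (-1) β α, P.FKd (-1) 0 β α z = y) ∧
    (∀ h : Hom k β α, ∃ y : P.FK 0 β α, P.FKd 0 1 β α y = 0 ∧ ε.map β α y = h)

end SplitComplex

/-! ### The split part of the Temperley-Lieb algebra -/

/-- The free `R`-module generated by the split Temperley-Lieb `(2n, 2n)`-tangles;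
`p β α` is the coefficient of `⟨β ∘ α^⋄⟩`. -/
abbrev SplitTL (n : ℕ) (R : Type*) : Type _ := Matching n → Matching n → R

/-- The value `-(q + q⁻¹)` of a circle. -/
def loopValue : RatFunc ℚ := -(RatFunc.X + RatFunc.X⁻¹)

/-- The product `p ∘ v` of a split element with an element of the free module generated by
crossingless matchings: `⟨β ∘ α^⋄⟩ ∘ ⟨γ⟩` is `⟨β⟩` times a factor `-(q + q⁻¹)` for every
circle of `α^⋄ ∘ γ`. -/
def SplitTL.act (p : SplitTL n (RatFunc ℚ)) (v : Matching n → RatFunc ℚ) :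
    Matching n → RatFunc ℚ :=
  fun β => ∑ α, ∑ γ, p β α * loopValue ^ numCircles α γ * v γ

/-- The split element `p` acts as the identity on all crossingless matchings. -/
def IsProjector (p : SplitTL n (RatFunc ℚ)) : Prop :=
  ∀ γ : Matching n, p.act (Pi.single γ 1) = Pi.single γ 1

open scoped RatFunc in
/-- The Laurent expansion at `q = 0` of a rational function. -/
def laurentExpansion (F : Type*) [Field F] : RatFunc F →+* LaurentSeries F :=
  algebraMap (RatFunc F) (LaurentSeries F)

/-- The Laurent expansion at `q = 0` of the coefficients. -/
def SplitTL.expand (p : SplitTL n (RatFunc ℚ)) : SplitTL n (LaurentSeries ℚ) :=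
  fun β α => laurentExpansion ℚ (p β α)

/-! ### The Grothendieck class of a complex -/

namespace SplitComplex

variable {k : Type*} [CommRing k]

open Classical in
/-- The contribution of the homological degree `i` to the coefficient of `q ^ j ⟨β ∘ α^⋄⟩`: the number
of summands `⟨⟨β ∘ α^⋄⟩⟩ [0, j, μ]`, counted with the sign `(-1) ^ (i + μ)`. -/
def chainCoeff (P : SplitComplex k n) (β α : Matching n) (j i : ℤ) : ℚ :=
  ∑ s : Fin (P.size i),
    if (P.obj i s).out = β ∧ (P.obj i s).inn = α ∧ (P.obj i s).q = j then
      (-1) ^ i * (-1) ^ (P.obj i s).par.val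
    else 0

lemma exists_lower_bound (P : SplitComplex k n) :
    ∃ J : ℤ, ∀ i s, J ≤ (P.obj i s).q := by
  obtain ⟨N, hN⟩ := P.bounded_above
  obtain ⟨M, hM⟩ := P.q_bounded 0
  have hfin : (⋃ i ∈ Set.Icc M N, Set.range fun s => (P.obj i s).q).Finite :=
    (Set.finite_Icc M N).biUnion fun i _ => Set.finite_range _
  obtain ⟨J, hJ⟩ := hfin.bddBelow
  refine ⟨min J 0, fun i s => ?_⟩
  by_cases h1 : i < M
  · exact (min_le_right _ _).trans (hM i h1 s)
  · by_cases h2 : N < i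
    · have := hN i h2
      exact absurd s.2 (by omega)
    · exact (min_le_left _ _).trans
        (hJ (Set.mem_biUnion (x := i) ⟨not_lt.mp h1, not_lt.mp h2⟩ ⟨s, rfl⟩))

/-- For given `j` only finitely many homological degrees contribute. -/
lemma chainCoeff_finite (P : SplitComplex k n) (β α : Matching n) (j : ℤ) :
    (Function.support (P.chainCoeff β α j)).Finite := by
  obtain ⟨N, hN⟩ := P.bounded_above
  obtain ⟨M, hM⟩ := P.q_bounded (j + 1)
  refine (Set.finite_Icc M N).subset fun i hi => ?_
  by_contra h
  apply hi
  refine Finset.sum_eq_zero fun s _ => if_neg ?_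
  rintro ⟨-, -, hq⟩
  rw [Set.mem_Icc, not_and_or, not_le, not_le] at h
  rcases h with h | h
  · have := hM i h s
    omega
  · have := hN i h
    exact absurd s.2 (by omega)

lemma coeff_bddBelow (P : SplitComplex k n) (β α : Matching n) :
    BddBelow (Function.support fun j => ∑ᶠ i, P.chainCoeff β α j i) := by
  obtain ⟨J, hJ⟩ := P.exists_lower_bound
  refine ⟨J, fun j hj => ?_⟩
  by_contra h
  apply hj
  refine finsum_eq_zero_of_forall_eq_zero fun i => Finset.sum_eq_zero fun s _ => if_neg ?_
  rintro ⟨-, -, hq⟩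
  have := hJ i s
  omega

/-- The class of the complex in the free module generated by the split tangles over formal Laurent
series: every summand `⟨⟨β ∘ α^⋄⟩⟩ [0, j, μ]` in the homological degree `i` contributes
`(-1) ^ (i + μ) q ^ j ⟨β ∘ α^⋄⟩`. -/
def K0plus (P : SplitComplex k n) : SplitTL n (LaurentSeries ℚ) :=
  fun β α => HahnSeries.ofSuppBddBelow (fun j => ∑ᶠ i, P.chainCoeff β α j i)
    (P.coeff_bddBelow β α)

end SplitComplex

end ArcTL

end

/-!
The three assertions are tied together by Khovanov's arc algebra `H_n`, which must first be known to
be an associative, unital and graded algebra.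

*Associativity.* A product of dots on circles is a squarefree monomial, and a homogeneous integral
polynomial in the dots which vanishes at all sign vectors `±1` is zero in `⨂ k[x] / (x²)`
(`toAlg_eq_zero_of_eval_signs`): replacing `x² = 0` by `x² = 1` makes the algebra semisimple without
losing homogeneous identities. Evaluated at a sign vector, a product of the factors `x_p + x_{β p}`
over the splitting saddles is `0`, unless the signs agree along the arcs of `β`, and a power of two
times a product of signs otherwise. For signs `w` which are constant along all arcs, the weighted
number of splitting saddles is an Euler characteristic: a saddle changes the number of circles by `±1`
(`classSum_saddle`), so that it depends on the circle numbers only (`euler_weighted`). Both ways of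
composing three morphisms therefore have the same evaluations, which gives `mul_assoc'`.

*Existence.* `H_n` is non-negatively graded, and its part of degree zero is spanned by idempotents
(`one_le_monoQ`). This gives the normalised bar resolution relative to the idempotents. It is
built recursively: if a bimodule `T` is a direct sum of projectives as a right module (`Twisted`), then
so is the kernel of the action map `H_n ⊗ T → T` (`Twisted.next`), with the usual contracting
homotopy (`diff_homotopy_add`). Each step raises the `q`-degree by at least one, which makes the
complex `q⁺`-bounded (`barComplex_isUniversalResolution`).

*The projector.* An element `p` is a projector if and only if it is inverse to the Gram matrix `G` with
entries `(-q - q⁻¹) ^ c(α, γ)`. Since `c(α, γ) ≤ n`, with equality only for `α = γ`, the matrix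
`(-q) ^ n G` is the identity at `q = 0`, so that `G` is invertible (`gramMatrix_det_ne_zero`).

*The class.* For every resolution, ranks over the domain `k` are additive in every bidegree, so that
the graded Euler characteristic of the component at `β`, `α` of the complex equals the graded rank of
`Hom k β α` (`sum_card_bidegree`). The graded rank of `Hom k β α` is, up to a sign and a
shift, the entry of `G` at `β`, `α`, and a summand `⟨⟨β' ∘ α'^⋄⟩⟩` contributes the product of the
entries at `β`, `β'` and `α'`, `α`. With `K` the class of the resolution, this reads `G K G = G`
over Laurent series (`gram_mul_K0plus_mul_gram`), hence `K = G⁻¹`.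
-/

noncomputable section

namespace ArcTL

/-! ### Squarefree monomials and sign vectors -/

section CircleAlgebra

variable (k : Type*) [CommRing k] {C D E : Type}

/-- The squarefree monomial `∏ c ∈ S, x_c` in the algebra of a set of circles. -/
def mono (S : Finset C) : CircleAlg k C := ∏ c ∈ S, dot k c

@[simp] lemma mono_empty : mono k (∅ : Finset C) = 1 := Finset.prod_empty

lemma mem_circleIdeal_iff (P : MvPolynomial C k) :
    P ∈ Ideal.span (Set.range fun c : C => (MvPolynomial.X c : MvPolynomial C k) ^ 2) ↔
      ∀ m ∈ P.support, ∃ c, 2 ≤ m c := by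
  have h : (Set.range fun c : C => (MvPolynomial.X c : MvPolynomial C k) ^ 2) =
      (fun s => MvPolynomial.monomial s (1 : k)) '' Set.range fun c : C => Finsupp.single c 2 := by
    rw [← Set.range_comp]
    congr 1
    funext c
    simp [MvPolynomial.X_pow_eq_monomial]
  rw [h, MvPolynomial.mem_ideal_span_monomial_image]
  simp [Finsupp.single_le_iff]

/-- The coefficient of a squarefree monomial, which is well defined modulo the squares. -/
def monoCoeff (S : Finset C) : CircleAlg k C →ₗ[k] k :=
  Submodule.liftQ
    ((Ideal.span (Set.range fun c : C => (MvPolynomial.X c : MvPolynomial C k) ^ 2)).restrictScalars k)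
    (MvPolynomial.lcoeff k (Finsupp.indicator S fun _ _ => 1)) (by
      classical
      intro P hP
      rw [LinearMap.mem_ker, MvPolynomial.lcoeff_apply]
      by_contra h
      obtain ⟨c, hc⟩ := (mem_circleIdeal_iff k P).1 hP _ (MvPolynomial.mem_support_iff.2 h)
      rw [Finsupp.indicator_apply] at hc
      split_ifs at hc <;> omega)

lemma mk_monomial_indicator (S : Finset C) :
    (Ideal.Quotient.mk _ (MvPolynomial.monomial (Finsupp.indicator S fun _ _ => 1) 1) :
      CircleAlg k C) = mono k S := by
  classical
  rw [MvPolynomial.monomial_eq, map_one, one_mul, Finsupp.prod, map_prod, mono]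
  have h : (Finsupp.indicator S fun _ _ => 1 : C →₀ ℕ).support = S := by
    ext c
    simp [Finsupp.indicator_apply]
  rw [h]
  refine Finset.prod_congr rfl fun c hc => ?_
  rw [Finsupp.indicator_of_mem hc, pow_one]
  rfl

open Classical in
lemma monoCoeff_mono (S T : Finset C) : monoCoeff k S (mono k T) = if S = T then 1 else 0 := by
  rw [← mk_monomial_indicator]
  refine (Submodule.liftQ_apply _ _ _).trans ?_
  rw [MvPolynomial.lcoeff_apply, MvPolynomial.coeff_monomial]
  refine if_congr ⟨fun h => ?_, fun h => by rw [h]⟩ rfl rfl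
  ext c
  have := DFunLike.congr_fun h c
  simp only [Finsupp.indicator_apply] at this
  by_cases h1 : c ∈ S <;> by_cases h2 : c ∈ T <;> simp_all

lemma mk_monomial_eq (m : C →₀ ℕ) (a : k) :
    (Ideal.Quotient.mk _ (MvPolynomial.monomial m a) : CircleAlg k C) = 0 ∨
      (Ideal.Quotient.mk _ (MvPolynomial.monomial m a) : CircleAlg k C) = a • mono k m.support := by
  classical
  by_cases h : ∃ c, 2 ≤ m c
  · left
    rw [Ideal.Quotient.eq_zero_iff_mem, mem_circleIdeal_iff]
    intro m' hm'
    rw [Finset.mem_singleton.1 (MvPolynomial.support_monomial_subset hm')]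
    exact h
  · right
    push Not at h
    have hm : m = Finsupp.indicator m.support fun _ _ => 1 := by
      ext c
      rw [Finsupp.indicator_apply]
      have := h c
      split_ifs with h1
      · have := Finsupp.mem_support_iff.1 h1
        omega
      · exact Finsupp.notMem_support_iff.1 h1
    have : MvPolynomial.monomial m a =
        MvPolynomial.C a * MvPolynomial.monomial (Finsupp.indicator m.support fun _ _ => 1) 1 := by
      rw [MvPolynomial.C_mul_monomial, mul_one, ← hm]
    rw [this, map_mul, mk_monomial_indicator]
    exact (Algebra.smul_def a (mono k m.support)).symm

/-- The squarefree monomials form a basis of the algebra of a set of circles. -/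
def monoBasis (C : Type) : Module.Basis (Finset C) k (CircleAlg k C) :=
  Module.Basis.mk (v := mono k) (by
    classical
    rw [linearIndependent_iff']
    intro s g hg T hT
    have := congrArg (monoCoeff k T) hg
    simpa [monoCoeff_mono, hT] using this) (by
    rintro x -
    obtain ⟨P, rfl⟩ := Ideal.Quotient.mk_surjective x
    rw [P.as_sum, map_sum]
    refine Submodule.sum_mem _ fun m _ => ?_
    rcases mk_monomial_eq k m (P.coeff m) with h | h <;> rw [h]
    · exact Submodule.zero_mem _
    · exact Submodule.smul_mem _ _ (Submodule.subset_span ⟨_, rfl⟩))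

@[simp] lemma monoBasis_apply (S : Finset C) : monoBasis k C S = mono k S :=
  Module.Basis.mk_apply _ _ _

lemma monoBasis_coord (S : Finset C) : (monoBasis k C).coord S = monoCoeff k S := by
  classical
  refine (monoBasis k C).ext fun T => ?_
  rw [Module.Basis.coord_apply, Module.Basis.repr_self, monoBasis_apply, monoCoeff_mono,
    Finsupp.single_apply]
  exact if_congr eq_comm rfl rfl

lemma sum_monoCoeff [Fintype (Finset C)] (f : CircleAlg k C) :
    ∑ S, monoCoeff k S f • mono k S = f := by
  conv_rhs => rw [← (monoBasis k C).sum_repr f]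
  refine Finset.sum_congr rfl fun S _ => ?_
  rw [← monoBasis_coord, monoBasis_apply, Module.Basis.coord_apply]

@[simp] lemma push_dot (φ : C → D) (c : C) : push k φ (dot k c) = dot k (φ c) := by
  refine (Ideal.Quotient.liftₐ_apply _ _ _ _).trans ?_
  exact (Ideal.Quotient.lift_mk _ _ _).trans (by simp)

lemma circleAlg_induction {p : CircleAlg k C → Prop} (hC : ∀ a : k, p (algebraMap k _ a))
    (hadd : ∀ f g, p f → p g → p (f + g)) (hdot : ∀ f c, p f → p (f * dot k c)) (f) : p f := by
  obtain ⟨P, rfl⟩ := Ideal.Quotient.mk_surjective f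
  induction P using MvPolynomial.induction_on with
  | C a => exact hC a
  | add P Q hP hQ => rw [map_add]; exact hadd _ _ hP hQ
  | mul_X P c hP => rw [map_mul]; exact hdot _ c hP

/-- Circles may be exchanged for one another in front of an element which does not distinguish
between their dots. -/
lemma push_mul_congr {φ ψ : C → D} {F : CircleAlg k D}
    (h : ∀ c, dot k (φ c) * F = dot k (ψ c) * F) (f : CircleAlg k C) :
    push k φ f * F = push k ψ f * F := by
  induction f using circleAlg_induction with
  | hC a => rw [AlgHom.commutes, AlgHom.commutes]
  | hadd f g hf hg => rw [map_add, map_add, add_mul, add_mul, hf, hg]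
  | hdot f c hf =>
    rw [map_mul, map_mul, push_dot, push_dot, mul_assoc, h c, mul_left_comm, hf]
    ring

lemma push_push (φ : C → D) (ψ : D → E) (f : CircleAlg k C) :
    push k ψ (push k φ f) = push k (ψ ∘ φ) f := by
  induction f using circleAlg_induction with
  | hC a => simp only [AlgHom.commutes]
  | hadd f g hf hg => simp only [map_add, hf, hg]
  | hdot f c hf => simp only [map_mul, hf, push_dot, Function.comp]

lemma push_id (f : CircleAlg k C) : push k (fun c : C => c) f = f := by
  induction f using circleAlg_induction with
  | hC a => simp only [AlgHom.commutes]
  | hadd f g hf hg => simp only [map_add, hf, hg]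
  | hdot f c hf => simp only [map_mul, hf, push_dot]

/-- The span of the squarefree monomials of degree `m`. -/
def monoDeg (C : Type) (m : ℕ) : Submodule k (CircleAlg k C) :=
  Submodule.span k {f | ∃ S : Finset C, S.card = m ∧ f = mono k S}

lemma mono_mem_monoDeg (S : Finset C) : mono k S ∈ monoDeg k C S.card :=
  Submodule.subset_span ⟨S, rfl, rfl⟩

lemma one_mem_monoDeg : (1 : CircleAlg k C) ∈ monoDeg k C 0 := by
  simpa using mono_mem_monoDeg k (∅ : Finset C)

lemma dot_mem_monoDeg (c : C) : dot k c ∈ monoDeg k C 1 :=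
  Submodule.subset_span ⟨{c}, by simp, by simp [mono]⟩

lemma mul_mem_monoDeg {l m : ℕ} {f g : CircleAlg k C} (hf : f ∈ monoDeg k C l)
    (hg : g ∈ monoDeg k C m) : f * g ∈ monoDeg k C (l + m) := by
  classical
  induction hf, hg using Submodule.span_induction₂ with
  | mem_mem f g hf hg =>
    obtain ⟨S, rfl, rfl⟩ := hf
    obtain ⟨T, rfl, rfl⟩ := hg
    by_cases h : Disjoint S T
    · rw [mono, mono, ← Finset.prod_union h, ← Finset.card_union_of_disjoint h]
      exact mono_mem_monoDeg k _
    · obtain ⟨c, hS, hT⟩ := Finset.not_disjoint_iff.1 h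
      have : mono k S * mono k T = 0 := by
        rw [mono, mono, ← Finset.mul_prod_erase S _ hS, ← Finset.mul_prod_erase T _ hT,
          mul_mul_mul_comm, ← sq, dot_sq, zero_mul]
      rw [this]
      exact Submodule.zero_mem _
  | zero_left => rw [zero_mul]; exact Submodule.zero_mem _
  | zero_right => rw [mul_zero]; exact Submodule.zero_mem _
  | add_left _ _ _ _ _ _ h1 h2 => rw [add_mul]; exact Submodule.add_mem _ h1 h2
  | add_right _ _ _ _ _ _ h1 h2 => rw [mul_add]; exact Submodule.add_mem _ h1 h2
  | smul_left r _ _ _ _ h => rw [smul_mul_assoc]; exact Submodule.smul_mem _ _ h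
  | smul_right r _ _ _ _ h => rw [mul_smul_comm]; exact Submodule.smul_mem _ _ h

lemma prod_mem_monoDeg {ι : Type*} (s : Finset ι) (f : ι → CircleAlg k C) (m : ι → ℕ)
    (h : ∀ i ∈ s, f i ∈ monoDeg k C (m i)) : ∏ i ∈ s, f i ∈ monoDeg k C (∑ i ∈ s, m i) := by
  classical
  induction s using Finset.induction_on with
  | empty => simpa using one_mem_monoDeg k
  | insert i s hi ih =>
    rw [Finset.prod_insert hi, Finset.sum_insert hi]
    exact mul_mem_monoDeg k (h i (Finset.mem_insert_self _ _))
      (ih fun j hj => h j (Finset.mem_insert_of_mem hj))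

lemma push_mem_monoDeg (φ : C → D) {m : ℕ} {f : CircleAlg k C} (hf : f ∈ monoDeg k C m) :
    push k φ f ∈ monoDeg k D m := by
  induction hf using Submodule.span_induction with
  | mem f hf =>
    obtain ⟨S, rfl, rfl⟩ := hf
    rw [mono, map_prod, Finset.card_eq_sum_ones]
    refine prod_mem_monoDeg k _ _ _ fun c _ => ?_
    rw [push_dot]
    exact dot_mem_monoDeg k _
  | zero => rw [map_zero]; exact Submodule.zero_mem _
  | add _ _ _ _ h1 h2 => rw [map_add]; exact Submodule.add_mem _ h1 h2
  | smul r _ _ h => rw [map_smul]; exact Submodule.smul_mem _ _ h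

/-- The class in the algebra of a set of circles of a polynomial with integer coefficients. -/
def toAlg (C : Type) : MvPolynomial C ℤ →+* CircleAlg k C :=
  MvPolynomial.eval₂Hom (Int.castRingHom _) (dot k)

@[simp] lemma toAlg_X (c : C) : toAlg k C (MvPolynomial.X c) = dot k c :=
  MvPolynomial.eval₂Hom_X' _ _ _

lemma toAlg_rename (φ : C → D) (P : MvPolynomial C ℤ) :
    toAlg k D (MvPolynomial.rename φ P) = push k φ (toAlg k C P) := by
  induction P using MvPolynomial.induction_on with
  | C a => simp [toAlg]
  | add P Q hP hQ => simp only [map_add, hP, hQ]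
  | mul_X P c hP => simp only [map_mul, hP, MvPolynomial.rename_X, toAlg_X, push_dot]

/-- Sum of a monomial over all sign vectors. -/
lemma sum_signs_prod_pow [Fintype C] [DecidableEq C] (m : C → ℕ) :
    ∑ ε ∈ Fintype.piFinset fun _ : C => ({1, -1} : Finset ℤ), ∏ c, ε c ^ m c =
      ∏ c, (1 + (-1) ^ m c) := by
  refine (Finset.prod_univ_sum (fun _ : C => ({1, -1} : Finset ℤ)) fun c e => e ^ m c).symm.trans ?_
  refine Finset.prod_congr rfl fun c _ => ?_
  rw [Finset.sum_pair (by decide), one_pow]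

/-- A homogeneous polynomial with integer coefficients which vanishes at all sign vectors has no
squarefree monomials. Hence identities between homogeneous elements of the algebra of
a set of circles may be checked in the semisimple deformation `x² = 1`, where they become
identities between functions on the set of sign vectors. -/
theorem toAlg_eq_zero_of_eval_signs [Finite C] {P : MvPolynomial C ℤ} {d : ℕ}
    (hP : P.IsHomogeneous d)
    (h : ∀ ε : C → ℤ, (∀ c, ε c = 1 ∨ ε c = -1) → MvPolynomial.eval ε P = 0) :
    toAlg k C P = 0 := by
  classical
  have := Fintype.ofFinite C
  rw [toAlg, MvPolynomial.coe_eval₂Hom, MvPolynomial.eval₂_eq]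
  refine Finset.sum_eq_zero fun m hm => ?_
  by_cases hsq : ∃ c, 2 ≤ m c
  · obtain ⟨c, hc⟩ := hsq
    rw [Finset.prod_eq_zero (i := c), mul_zero]
    · rw [Finsupp.mem_support_iff]; omega
    · rw [← Nat.add_sub_cancel' hc, pow_add, dot_sq, zero_mul]
  · exfalso
    push Not at hsq
    -- The sum over all `ε` of `ε ^ m * P(ε)` picks out the coefficient of `m`.
    have key : ∑ ε ∈ Fintype.piFinset fun _ : C => ({1, -1} : Finset ℤ),
        (∏ c, ε c ^ m c) * MvPolynomial.eval ε P = 0 := by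
      refine Finset.sum_eq_zero fun ε hε => ?_
      rw [h ε, mul_zero]
      intro c
      simpa using Fintype.mem_piFinset.1 hε c
    simp_rw [MvPolynomial.eval_eq', Finset.mul_sum] at key
    rw [Finset.sum_comm, Finset.sum_eq_single_of_mem m hm] at key
    · have h2 : ∀ ε ∈ Fintype.piFinset fun _ : C => ({1, -1} : Finset ℤ),
          (∏ c, ε c ^ m c) * (MvPolynomial.coeff m P * ∏ c, ε c ^ m c) =
            MvPolynomial.coeff m P := by
        intro ε hε
        have : (∏ c, ε c ^ m c) * ∏ c, ε c ^ m c = 1 := by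
          rw [← Finset.prod_mul_distrib]
          refine Finset.prod_eq_one fun c _ => ?_
          have : ε c = 1 ∨ ε c = -1 := by simpa using Fintype.mem_piFinset.1 hε c
          rw [← mul_pow]
          rcases this with h | h <;> rw [h] <;> norm_num
        rw [mul_left_comm, this, mul_one]
      rw [Finset.sum_congr rfl h2, Finset.sum_const, smul_eq_zero] at key
      rcases key with key | key
      · rw [Fintype.card_piFinset, Finset.prod_eq_zero_iff] at key
        obtain ⟨c, -, hc⟩ := key
        revert hc
        decide
      · exact MvPolynomial.mem_support_iff.1 hm key
    · intro m' hm' hne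
      have h2 : ∀ ε : C → ℤ, (∏ c, ε c ^ m c) * (MvPolynomial.coeff m' P * ∏ c, ε c ^ m' c) =
          MvPolynomial.coeff m' P * ∏ c, ε c ^ (m c + m' c) := by
        intro ε
        rw [mul_left_comm, ← Finset.prod_mul_distrib]
        simp_rw [pow_add]
      simp_rw [h2]
      rw [← Finset.mul_sum, sum_signs_prod_pow]
      -- Equal parities and degrees force `m' = m`, since `m` is squarefree.
      have : ∃ c, Odd (m c + m' c) := by
        by_contra hcon
        push Not at hcon
        have hle : ∀ c, m c ≤ m' c := fun c => by
          have h3 := hsq c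
          have h4 := hcon c
          rw [Nat.not_odd_iff_even, Nat.even_iff] at h4
          omega
        have hd := hP (MvPolynomial.mem_support_iff.1 hm)
        have hd' := hP (MvPolynomial.mem_support_iff.1 hm')
        simp only [Finsupp.weight_apply, Pi.one_apply, smul_eq_mul, mul_one,
          Finsupp.sum_fintype, implies_true] at hd hd'
        refine hne (Finsupp.ext fun c => ?_)
        have := (Finset.sum_eq_sum_iff_of_le fun c _ => hle c).1 (hd.trans hd'.symm) c
          (Finset.mem_univ c)
        exact this.symm
      obtain ⟨c, hc⟩ := this
      rw [Finset.prod_eq_zero (Finset.mem_univ c), mul_zero]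
      rw [hc.neg_one_pow]
      norm_num

end CircleAlgebra

/-! ### Classes generated by two involutions -/

section Involutions

variable {X Y : Type*}

/-- The equivalence relation generated by `u ∼ a u` and `u ∼ b u`. -/
def invRel (a b : X → X) : Setoid X := Relation.EqvGen.setoid fun u v => v = a u ∨ v = b u

lemma invRel_left (a b : X → X) (u : X) : invRel a b u (a u) :=
  Relation.EqvGen.rel _ _ (Or.inl rfl)

lemma invRel_right (a b : X → X) (u : X) : invRel a b u (b u) :=
  Relation.EqvGen.rel _ _ (Or.inr rfl)

lemma invRel_le {a b : X → X} {s : Setoid X} (ha : ∀ u, s u (a u)) (hb : ∀ u, s u (b u)) :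
    invRel a b ≤ s := by
  refine Setoid.eqvGen_le ?_
  rintro u v (rfl | rfl)
  exacts [ha u, hb u]

lemma eq_of_invRel {a b : X → X} {f : X → Y} (ha : ∀ u, f (a u) = f u) (hb : ∀ u, f (b u) = f u)
    {u v : X} (h : invRel a b u v) : f u = f v :=
  (invRel_le (s := Setoid.ker f) (fun u => (ha u).symm) (fun u => (hb u).symm)) h

/-- The sum of the values of a weight over the classes of an equivalence relation. -/
def classSum (r : Setoid X) (w : X → ℤ) : ℤ := ∑ᶠ c : Quotient r, w c.out

lemma classSum_congr_of_map {r : Setoid X} {s : Setoid Y} (f : X → Y)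
    (hf : ∀ u v, r u v ↔ s (f u) (f v)) (hsurj : ∀ y, ∃ u, s (f u) y) {w : Y → ℤ}
    (hw : ∀ u v, s u v → w u = w v) : classSum r (w ∘ f) = classSum s w := by
  refine finsum_eq_of_bijective
    (Quotient.map f (sa := r) (sb := s) fun u v h => (hf u v).1 h) ⟨?_, ?_⟩ ?_
  · rintro ⟨u⟩ ⟨v⟩ h
    exact Quotient.sound ((hf u v).2 (Quotient.exact h))
  · rintro ⟨y⟩
    obtain ⟨u, hu⟩ := hsurj y
    exact ⟨Quotient.mk _ u, Quotient.sound hu⟩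
  · intro c
    refine hw _ _ ?_
    have h : Quotient.map f (sa := r) (sb := s) (fun u v h => (hf u v).1 h) c =
        Quotient.mk s (f c.out) := by
      conv_lhs => rw [← Quotient.out_eq c]
      rfl
    rw [h]
    exact s.symm (Quotient.mk_out (f c.out))

/-- Joining two different classes of an equivalence relation. -/
lemma classSum_join [Finite X] {r s : Setoid X} {x y : X} {w : X → ℤ} (hxy : ¬ r x y)
    (hs : ∀ u v, s u v ↔ r u v ∨ (r u x ∧ r y v) ∨ (r u y ∧ r x v))
    (hw : ∀ u v, s u v → w u = w v) : classSum s w = classSum r w - w x := by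
  classical
  have := Fintype.ofFinite (Quotient r)
  have := Fintype.ofFinite (Quotient s)
  rw [classSum, classSum, finsum_eq_sum_of_fintype, finsum_eq_sum_of_fintype,
    ← Finset.add_sum_erase Finset.univ _ (Finset.mem_univ (Quotient.mk r y))]
  have hrs : ∀ u v, r u v → s u v := fun u v h => (hs u v).2 (Or.inl h)
  have h1 : w (Quotient.mk r y).out = w x :=
    hw _ _ (s.trans (hrs _ _ (Quotient.mk_out y))
      ((hs _ _).2 (Or.inr (Or.inr ⟨r.refl _, r.refl _⟩))))
  rw [h1, add_sub_cancel_left]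
  symm
  refine Finset.sum_bij (fun c _ => Quotient.mk s c.out) (fun _ _ => Finset.mem_univ _) ?_ ?_ ?_
  · intro c hc d hd h
    have hc' : ¬ r c.out y := fun h => (Finset.mem_erase.1 hc).1 (by
      rw [← Quotient.out_eq c]; exact Quotient.sound h)
    have hd' : ¬ r y d.out := fun h => (Finset.mem_erase.1 hd).1 (by
      rw [← Quotient.out_eq d]; exact Quotient.sound (r.symm h))
    rcases (hs _ _).1 (Quotient.exact h) with h | h | h
    · rw [← Quotient.out_eq c, ← Quotient.out_eq d]
      exact Quotient.sound h
    · exact absurd h.2 hd'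
    · exact absurd h.1 hc'
  · rintro ⟨u⟩ -
    by_cases hu : r u y
    · refine ⟨Quotient.mk r x, Finset.mem_erase.2 ⟨fun h => hxy (Quotient.exact h),
        Finset.mem_univ _⟩, Quotient.sound ?_⟩
      exact (hs _ _).2 (Or.inr (Or.inl ⟨Quotient.mk_out x, r.symm hu⟩))
    · exact ⟨Quotient.mk r u, Finset.mem_erase.2 ⟨fun h => hu (Quotient.exact h),
        Finset.mem_univ _⟩, Quotient.sound (hrs _ _ (Quotient.mk_out u))⟩
  · intro c _
    exact hw _ _ (s.symm (Quotient.mk_out c.out))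

/-- A class of the relation generated by two involutions, one of which fixes three points of the
class, is too long for a path. -/
lemma eq_of_three_fixed {a b : X → X} (ha : Function.Involutive a) (hb : Function.Involutive b)
    {x y z : X} (hx : b x = x) (hy : b y = y) (hz : b z = z)
    (hxy : invRel a b x y) (hxz : invRel a b x z) : x = y ∨ x = z ∨ y = z := by
  -- The class of `x` is the orbit of `x` under `σ = a ∘ b`, on which `b` acts by `σ ^ i x ↦ σ ^ (-i) x`.
  let σ : Equiv.Perm X := hb.toPerm.trans ha.toPerm
  have hσ : ∀ u, σ u = a (b u) := fun u => rfl
  have hσi : ∀ u, σ⁻¹ u = b (a u) := fun u => rfl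
  have hbσ : ∀ (i : ℤ) u, b ((σ ^ i) u) = (σ ^ (-i)) (b u) := by
    intro i
    induction i using Int.induction_on with
    | zero => intro u; simp
    | succ i ih =>
      intro u
      rw [zpow_add_one, Equiv.Perm.mul_apply, ih, neg_add, zpow_add, zpow_neg_one,
        Equiv.Perm.mul_apply, hσ, hσi]
    | pred i ih =>
      intro u
      rw [zpow_sub_one, Equiv.Perm.mul_apply, ih, neg_neg, show -(-(i : ℤ) - 1) = i + 1 by ring,
        zpow_add_one, Equiv.Perm.mul_apply, hσi, hσ, hb, hb]
  have horb : ∀ v, invRel a b x v → ∃ i : ℤ, (σ ^ i) x = v := by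
    have hclosed : ∀ (i : ℤ), b ((σ ^ i) x) = (σ ^ (-i)) x := fun i => by rw [hbσ, hx]
    have hcloseda : ∀ (i : ℤ), a ((σ ^ i) x) = (σ ^ (1 - i)) x := fun i => by
      rw [sub_eq_add_neg, zpow_add, Equiv.Perm.mul_apply, ← hclosed, zpow_one, hσ, hb]
    let S : X → Prop := fun v => ∃ i : ℤ, (σ ^ i) x = v
    have hSa : ∀ u, S u → S (a u) := by
      rintro _ ⟨i, rfl⟩; exact ⟨1 - i, (hcloseda i).symm⟩
    have hSb : ∀ u, S u → S (b u) := by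
      rintro _ ⟨i, rfl⟩; exact ⟨-i, (hclosed i).symm⟩
    intro v hv
    have : S x = S v := eq_of_invRel (f := S)
      (fun u => propext ⟨fun h => by simpa only [ha u] using hSa _ h, hSa u⟩)
      (fun u => propext ⟨fun h => by simpa only [hb u] using hSb _ h, hSb u⟩) hv
    exact this.mp ⟨0, by simp⟩
  obtain ⟨i, hi⟩ := horb y hxy
  obtain ⟨j, hj⟩ := horb z hxz
  have hper : ∀ (i : ℤ) v, (σ ^ i) x = v → b v = v → (σ ^ (i + i)) x = x := by
    rintro i _ rfl h
    rw [hbσ, hx] at h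
    rw [zpow_add, Equiv.Perm.mul_apply, ← h, ← Equiv.Perm.mul_apply, ← zpow_add, add_neg_cancel,
      zpow_zero, Equiv.Perm.one_apply]
  let H : AddSubgroup ℤ :=
    { carrier := {m | (σ ^ m) x = x}
      zero_mem' := by simp
      add_mem' := fun {l m} (hl : (σ ^ l) x = x) (hm : (σ ^ m) x = x) => by
        change (σ ^ (l + m)) x = x
        rw [zpow_add, Equiv.Perm.mul_apply, hm, hl]
      neg_mem' := fun {m} (hm : (σ ^ m) x = x) => by
        change (σ ^ (-m)) x = x
        rw [zpow_neg, Equiv.Perm.inv_eq_iff_eq, hm] }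
  obtain ⟨N, hN⟩ := Int.subgroup_cyclic H
  have hmem : ∀ m, (σ ^ m) x = x ↔ ∃ l : ℤ, l * N = m := fun m => by
    have : (σ ^ m) x = x ↔ m ∈ H := Iff.rfl
    rw [this, hN, AddSubgroup.mem_closure_singleton]
    simp
  obtain ⟨l, hl⟩ := (hmem _).1 (hper i y hi hy)
  obtain ⟨m, hm⟩ := (hmem _).1 (hper j z hj hz)
  rcases Int.even_or_odd' l with ⟨l', rfl | rfl⟩
  · left
    rw [← hi]
    exact ((hmem i).2 ⟨l', by linarith⟩).symm
  rcases Int.even_or_odd' m with ⟨m', rfl | rfl⟩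
  · right; left
    rw [← hj]
    exact ((hmem j).2 ⟨m', by linarith⟩).symm
  · right; right
    have : (σ ^ (i - j)) x = x := (hmem _).2 ⟨l' - m', by linarith⟩
    rw [← hi, ← hj, ← sub_add_cancel i j, add_comm, zpow_add, Equiv.Perm.mul_apply, this]

/-- Four ends of two paths, which are coloured such that every step changes the colour, are
connected in one of two ways. -/
lemma path_pairing [Finite X] {a b : X → X} (ha : Function.Involutive a)
    (hb : Function.Involutive b) {χ : X → Bool} (hχa : ∀ u, χ (a u) = !χ u)
    (hχb : ∀ u, b u = u ∨ χ (b u) = !χ u) {P Q P' Q' : X} (hPQ : P ≠ Q) (hPP' : P ≠ P')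
    (hPQ' : P ≠ Q') (hQP' : Q ≠ P') (hQQ' : Q ≠ Q') (hPQ'' : P' ≠ Q')
    (hfix : ∀ u, b u = u ↔ u = P ∨ u = Q ∨ u = P' ∨ u = Q')
    (hQ : χ Q = !χ P) (hP' : χ P' = !χ P) (hQ' : χ Q' = χ P) :
    (invRel a b P Q ∧ invRel a b P' Q' ∧ ¬ invRel a b P P') ∨
      (invRel a b P P' ∧ invRel a b Q Q' ∧ ¬ invRel a b P Q) := by
  classical
  have := Fintype.ofFinite X
  -- In every class there are as many ends of one colour as of the other.
  have hsum : ∀ K, ((if invRel a b K P then 1 else 0) + (if invRel a b K Q' then 1 else 0) : ℤ) =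
      (if invRel a b K Q then 1 else 0) + (if invRel a b K P' then 1 else 0) := by
    intro K
    let f : X → ℤ := fun u => if invRel a b K u then (if χ u then 1 else -1) else 0
    have hRa : ∀ u, invRel a b K (a u) ↔ invRel a b K u := fun u =>
      ⟨fun h => (invRel a b).trans h ((invRel a b).symm (invRel_left a b u)),
        fun h => (invRel a b).trans h (invRel_left a b u)⟩
    have hRb : ∀ u, invRel a b K (b u) ↔ invRel a b K u := fun u =>
      ⟨fun h => (invRel a b).trans h ((invRel a b).symm (invRel_right a b u)),
        fun h => (invRel a b).trans h (invRel_right a b u)⟩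
    have hfa : ∀ u, f (a u) = -f u := fun u => by
      simp only [f, hRa, hχa]
      cases χ u <;> split_ifs <;> simp_all
    have hfb : ∀ u, f (b u) + f u = (if u = P then 2 * f P else 0) + (if u = Q then 2 * f Q else 0)
        + (if u = P' then 2 * f P' else 0) + (if u = Q' then 2 * f Q' else 0) := fun u => by
      by_cases h : b u = u
      · rw [h]
        rcases (hfix u).1 h with rfl | rfl | rfl | rfl
        · simp [hPQ, hPP', hPQ', two_mul]
        · simp [hPQ.symm, hQP', hQQ', two_mul]
        · simp [hPP'.symm, hQP'.symm, hPQ'', two_mul]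
        · simp [hPQ'.symm, hQQ'.symm, hPQ''.symm, two_mul]
      · have h2 := (hχb u).resolve_left h
        rw [hfix] at h
        push Not at h
        rw [if_neg h.1, if_neg h.2.1, if_neg h.2.2.1, if_neg h.2.2.2]
        simp only [f, hRb, h2]
        cases χ u <;> split_ifs <;> simp_all
    have h1 : ∑ u, f u = 0 := by
      have : ∑ u, f (a u) = ∑ u, f u := Equiv.sum_comp ha.toPerm f
      simp only [hfa, Finset.sum_neg_distrib] at this
      linarith
    have h2 : ∑ u, f (b u) = ∑ u, f u := Equiv.sum_comp hb.toPerm f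
    have h3 : ∑ u, (f (b u) + f u) = 0 := by
      rw [Finset.sum_add_distrib, h2, h1, add_zero]
    simp only [hfb, Finset.sum_add_distrib, Finset.sum_ite_eq', Finset.mem_univ, if_true] at h3
    simp only [f, hQ, hP', hQ'] at h3
    cases h : χ P <;> simp only [h] at h3 <;> split_ifs at h3 ⊢ <;> simp_all
  have fP := (hfix P).2 (by simp)
  have fQ := (hfix Q).2 (by simp)
  have fP' := (hfix P').2 (by simp)
  have fQ' := (hfix Q').2 (by simp)
  have h1 : ¬ (invRel a b P Q ∧ invRel a b P P') := fun h => by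
    rcases eq_of_three_fixed ha hb fP fQ fP' h.1 h.2 with h | h | h <;> contradiction
  have h2 : ¬ (invRel a b Q' Q ∧ invRel a b Q' P') := fun h => by
    rcases eq_of_three_fixed ha hb fQ' fQ fP' h.1 h.2 with h | h | h <;> simp_all
  have h3 : ¬ (invRel a b P Q ∧ invRel a b P Q') := fun h => by
    rcases eq_of_three_fixed ha hb fP fQ fQ' h.1 h.2 with h | h | h <;> contradiction
  have h4 : ¬ (invRel a b P P' ∧ invRel a b P Q') := fun h => by
    rcases eq_of_three_fixed ha hb fP fP' fQ' h.1 h.2 with h | h | h <;> contradiction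
  have s1 := hsum P
  have s2 := hsum Q'
  rw [if_pos ((invRel a b).refl P)] at s1
  rw [if_pos ((invRel a b).refl Q')] at s2
  have hsym : ∀ u v, invRel a b u v → invRel a b v u := fun _ _ h => (invRel a b).symm h
  have htr : ∀ u v z, invRel a b u v → invRel a b v z → invRel a b u z :=
    fun _ _ _ h h' => (invRel a b).trans h h'
  by_cases hA : invRel a b P Q
  · left
    have hn : ¬ invRel a b P P' := fun h => h1 ⟨hA, h⟩
    refine ⟨hA, ?_, hn⟩
    by_contra hB
    have : ¬ invRel a b Q' P' := fun h => hB (hsym _ _ h)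
    have h5 : ¬ invRel a b Q' Q := fun h => h3 ⟨hA, htr _ _ _ hA (hsym _ _ h)⟩
    rw [if_neg this, if_neg h5] at s2
    split_ifs at s2 <;> omega
  · right
    rw [if_neg hA] at s1
    have hB : invRel a b P P' := by
      by_contra hB
      rw [if_neg hB] at s1
      split_ifs at s1 <;> omega
    refine ⟨hB, ?_, hA⟩
    by_contra hC
    have h5 : ¬ invRel a b Q' Q := fun h => hC (hsym _ _ h)
    have h6 : ¬ invRel a b Q' P' := fun h => h4 ⟨hB, htr _ _ _ hB (hsym _ _ h)⟩
    rw [if_neg h5, if_neg h6] at s2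
    split_ifs at s2 <;> omega

end Involutions

/-! ### The effect of a saddle on class sums -/

section Saddle

variable {X : Type*}

/-- The equivalence relation obtained by joining the classes of `x` and `y`. -/
def joinRel (r : Setoid X) (x y : X) : Setoid X where
  r u v := r u v ∨ (r u x ∧ r y v) ∨ (r u y ∧ r x v)
  iseqv :=
    { refl := fun u => Or.inl (r.refl u)
      symm := fun {u v} h => by
        rcases h with h | h | h
        · exact Or.inl (r.symm h)
        · exact Or.inr (Or.inr ⟨r.symm h.2, r.symm h.1⟩)
        · exact Or.inr (Or.inl ⟨r.symm h.2, r.symm h.1⟩)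
      trans := fun {u v z} h h' => by
        rcases h with h | h | h <;> rcases h' with h' | h' | h'
        · exact Or.inl (r.trans h h')
        · exact Or.inr (Or.inl ⟨r.trans h h'.1, h'.2⟩)
        · exact Or.inr (Or.inr ⟨r.trans h h'.1, h'.2⟩)
        · exact Or.inr (Or.inl ⟨h.1, r.trans h.2 h'⟩)
        · exact Or.inr (Or.inl ⟨h.1, h'.2⟩)
        · exact Or.inl (r.trans h.1 h'.2)
        · exact Or.inr (Or.inr ⟨h.1, r.trans h.2 h'⟩)
        · exact Or.inl (r.trans h.1 h'.2)
        · exact Or.inr (Or.inr ⟨h.1, h'.2⟩) }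

/-- If two paths, with ends `P`, `Q` and `P'`, `Q'`, are closed up by `b`, and are connected with one
another by `b'`, then `b'` gives one class less. -/
lemma classSum_saddle_aux [Finite X] {a b b' b₀ : X → X} {P Q P' Q' : X} {w : X → ℤ}
    (hb₀ : ∀ u, b₀ u = u ∨ b₀ u = b u) (hb₀' : ∀ u, b₀ u = u ∨ b₀ u = b' u)
    (hb : ∀ u, b u = b₀ u ∨ (u = P ∧ b u = Q) ∨ (u = Q ∧ b u = P) ∨
      (u = P' ∧ b u = Q') ∨ (u = Q' ∧ b u = P'))
    (hb' : ∀ u, b' u = b₀ u ∨ (u = P ∧ b' u = P') ∨ (u = P' ∧ b' u = P) ∨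
      (u = Q ∧ b' u = Q') ∨ (u = Q' ∧ b' u = Q))
    (hP : b' P = P')
    (hPQ : invRel a b₀ P Q) (hPQ' : invRel a b₀ P' Q') (hPP' : ¬ invRel a b₀ P P')
    (hwa : ∀ u, w (a u) = w u) (hwb : ∀ u, w (b' u) = w u) :
    ¬ invRel a b P P' ∧ invRel a b' P Q ∧
      classSum (invRel a b') w = classSum (invRel a b) w - w P := by
  have hr : invRel a b = invRel a b₀ := by
    refine le_antisymm (invRel_le (invRel_left _ _) fun u => ?_)
      (invRel_le (invRel_left _ _) fun u => ?_)
    · rcases hb u with h | ⟨rfl, h⟩ | ⟨rfl, h⟩ | ⟨rfl, h⟩ | ⟨rfl, h⟩ <;> rw [h]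
      exacts [invRel_right _ _ u, hPQ, (invRel a b₀).symm hPQ, hPQ', (invRel a b₀).symm hPQ']
    · rcases hb₀ u with h | h <;> rw [h]
      exact invRel_right _ _ u
  have hle : invRel a b₀ ≤ invRel a b' := invRel_le (invRel_left _ _) fun u => by
    rcases hb₀' u with h | h <;> rw [h]
    exact invRel_right _ _ u
  have hs : ∀ u v, invRel a b' u v ↔ joinRel (invRel a b₀) P P' u v := by
    have h1 : invRel a b' ≤ joinRel (invRel a b₀) P P' := by
      have rf := (invRel a b₀).refl
      refine invRel_le (fun u => Or.inl (invRel_left _ _ u)) fun u => ?_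
      rcases hb' u with h | ⟨rfl, h⟩ | ⟨rfl, h⟩ | ⟨rfl, h⟩ | ⟨rfl, h⟩ <;> rw [h]
      · exact Or.inl (invRel_right _ _ u)
      · exact Or.inr (Or.inl ⟨rf _, rf _⟩)
      · exact Or.inr (Or.inr ⟨rf _, rf _⟩)
      · exact Or.inr (Or.inl ⟨(invRel a b₀).symm hPQ, hPQ'⟩)
      · exact Or.inr (Or.inr ⟨(invRel a b₀).symm hPQ', hPQ⟩)
    have h2 : invRel a b' P P' := by
      have := invRel_right a b' P
      rwa [hP] at this
    refine fun u v => ⟨fun h => h1 h, ?_⟩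
    rintro (h | h | h)
    · exact hle h
    · exact (invRel a b').trans (hle h.1) ((invRel a b').trans h2 (hle h.2))
    · exact (invRel a b').trans (hle h.1)
        ((invRel a b').trans ((invRel a b').symm h2) (hle h.2))
  refine ⟨by rwa [hr], hle hPQ, ?_⟩
  rw [hr]
  exact classSum_join hPP' hs fun u v h => eq_of_invRel hwa hwb h

/-- A saddle replaces the arcs `P Q` and `P' Q'` by the arcs `P P'` and `Q Q'`. In the presence of an
orientation it either splits a circle into two or merges two circles. -/
lemma classSum_saddle [Finite X] {a b b' : X → X} (ha : Function.Involutive a)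
    (hb : Function.Involutive b) {χ : X → Bool} (hχa : ∀ u, χ (a u) = !χ u)
    (hχb : ∀ u, χ (b u) = !χ u) {P Q P' Q' : X} (hPP' : P ≠ P') (hPQ' : P ≠ Q')
    (hP' : χ P' = !χ P) (bP : b P = Q) (bP' : b P' = Q') (bP2 : b' P = P') (bP2' : b' P' = P)
    (bQ2 : b' Q = Q') (bQ2' : b' Q' = Q)
    (hbb' : ∀ u, u = P ∨ u = Q ∨ u = P' ∨ u = Q' ∨ b u = b' u)
    {w : X → ℤ} (hwa : ∀ u, w (a u) = w u) (hwb : ∀ u, w (b u) = w u)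
    (hwb' : ∀ u, w (b' u) = w u) :
    (invRel a b P P' ∧ ¬ invRel a b' P Q ∧
      classSum (invRel a b') w = classSum (invRel a b) w + w P) ∨
    (¬ invRel a b P P' ∧ invRel a b' P Q ∧
      classSum (invRel a b') w = classSum (invRel a b) w - w P) := by
  classical
  have bQ : b Q = P := by rw [← bP, hb]
  have bQ' : b Q' = P' := by rw [← bP', hb]
  have hQ : χ Q = !χ P := by rw [← bP, hχb]
  have hQ' : χ Q' = χ P := by rw [← bP', hχb, hP', Bool.not_not]
  have hne : ∀ {u v : X}, χ u = !χ v → v ≠ u := by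
    rintro u v h rfl
    cases h' : χ v <;> simp [h'] at h
  have hPQ : P ≠ Q := hne hQ
  have hP'Q' : P' ≠ Q' := hne (by rw [hQ', hP', Bool.not_not])
  have hQQ' : Q ≠ Q' := hne (by rw [hQ', hQ, Bool.not_not])
  have hQP' : Q ≠ P' := by
    rintro rfl
    exact hPQ' (bQ.symm.trans bP')
  let b₀ : X → X := fun u => if u = P ∨ u = Q ∨ u = P' ∨ u = Q' then u else b u
  have h0 : ∀ u, (u = P ∨ u = Q ∨ u = P' ∨ u = Q') → b₀ u = u := fun u h => if_pos h
  have h1 : ∀ u, ¬ (u = P ∨ u = Q ∨ u = P' ∨ u = Q') → b₀ u = b u := fun u h => if_neg h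
  have hinv : ∀ u, (u = P ∨ u = Q ∨ u = P' ∨ u = Q') → (b u = P ∨ b u = Q ∨ b u = P' ∨ b u = Q') := by
    rintro u (rfl | rfl | rfl | rfl) <;> simp [*]
  have hb₀ : Function.Involutive b₀ := fun u => by
    by_cases h : u = P ∨ u = Q ∨ u = P' ∨ u = Q'
    · rw [h0 u h, h0 u h]
    · rw [h1 u h, h1, hb]
      intro h'
      have := hinv _ h'
      rw [hb] at this
      exact h this
  have hfix : ∀ u, b₀ u = u ↔ u = P ∨ u = Q ∨ u = P' ∨ u = Q' := fun u => by
    refine ⟨fun h => ?_, h0 u⟩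
    by_contra h2
    rw [h1 u h2] at h
    have := hχb u
    rw [h] at this
    cases h' : χ u <;> simp [h'] at this
  have hχ0 : ∀ u, b₀ u = u ∨ χ (b₀ u) = !χ u := fun u => by
    by_cases h : u = P ∨ u = Q ∨ u = P' ∨ u = Q'
    · exact Or.inl (h0 u h)
    · right; rw [h1 u h, hχb]
  have e1 : ∀ u, b₀ u = u ∨ b₀ u = b u := fun u => by
    by_cases h : u = P ∨ u = Q ∨ u = P' ∨ u = Q'
    · exact Or.inl (h0 u h)
    · exact Or.inr (h1 u h)
  have e2 : ∀ u, b₀ u = u ∨ b₀ u = b' u := fun u => by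
    by_cases h : u = P ∨ u = Q ∨ u = P' ∨ u = Q'
    · exact Or.inl (h0 u h)
    · right
      rw [h1 u h]
      have := hbb' u
      tauto
  have e3 : ∀ u, b u = b₀ u ∨ (u = P ∧ b u = Q) ∨ (u = Q ∧ b u = P) ∨
      (u = P' ∧ b u = Q') ∨ (u = Q' ∧ b u = P') := fun u => by
    by_cases h : u = P ∨ u = Q ∨ u = P' ∨ u = Q'
    · rcases h with rfl | rfl | rfl | rfl <;> simp [*]
    · exact Or.inl (h1 u h).symm
  have e4 : ∀ u, b' u = b₀ u ∨ (u = P ∧ b' u = P') ∨ (u = P' ∧ b' u = P) ∨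
      (u = Q ∧ b' u = Q') ∨ (u = Q' ∧ b' u = Q) := fun u => by
    by_cases h : u = P ∨ u = Q ∨ u = P' ∨ u = Q'
    · rcases h with rfl | rfl | rfl | rfl <;> simp [*]
    · left
      rw [h1 u h]
      have := hbb' u
      tauto
  rcases path_pairing ha hb₀ hχa hχ0 hPQ hPP' hPQ' hQP' hQQ' hP'Q' hfix hQ hP' hQ' with h | h
  · right
    exact classSum_saddle_aux e1 e2 e3 e4 bP2 h.1 h.2.1 h.2.2 hwa hwb'
  · left
    obtain ⟨h1, h2, h3⟩ := classSum_saddle_aux (P := P) (Q := P') (P' := Q) (Q' := Q')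
      e2 e1 e4 e3 bP h.1 h.2.1 h.2.2 hwa hwb
    exact ⟨h2, h1, by rw [h3]; ring⟩

end Saddle

/-! ### Circles of pairs of matchings -/

section Matchings

variable {n : ℕ}

lemma Matching.involutive (α : Matching n) : Function.Involutive α := α.2.1

lemma Matching.ne (α : Matching n) (p : Fin (2 * n)) : α p ≠ p := α.2.2.1 p

/-- The points below an arc are matched with one another, so that the ends of an arc have different
parities. -/
lemma Matching.parity (α : Matching n) (p : Fin (2 * n)) :
    ((α p : ℕ) % 2 = 0) ↔ ¬ ((p : ℕ) % 2 = 0) := by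
  have key : ∀ p : Fin (2 * n), p < α p → ((α p : ℕ) % 2 = 0 ↔ ¬ ((p : ℕ) % 2 = 0)) := by
    intro p hp
    have hmaps : ∀ q ∈ Finset.Ioo p (α p), α q ∈ Finset.Ioo p (α p) := by
      intro q hq
      rw [Finset.mem_Ioo] at hq ⊢
      have h1 := α.2.2.2 p q
      have h2 := α.2.2.2 (α q) p
      rw [α.involutive] at h2
      have h3 : α q ≠ p := fun h => hq.2.ne (by rw [← h, α.involutive])
      have h4 : α q ≠ α p := fun h => hq.1.ne (α.involutive.injective h).symm
      refine ⟨?_, ?_⟩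
      · by_contra h
        exact h2 ⟨lt_of_le_of_ne (not_lt.1 h) h3, hq⟩
      · by_contra h
        exact h1 ⟨hq.1, hq.2, lt_of_le_of_ne (not_lt.1 h) h4.symm⟩
    have hs : ∑ q ∈ Finset.Ioo p (α p), (1 : ZMod 2) = 0 :=
      Finset.sum_involution (fun q _ => α q) (fun _ _ => by decide)
        (fun q _ _ => α.ne q) hmaps (fun q _ => α.involutive q)
    rw [Finset.sum_const, nsmul_one, ZMod.natCast_eq_zero_iff, Fin.card_Ioo] at hs
    have : (p : ℕ) < α p := hp
    omega
  rcases lt_or_gt_of_ne (α.ne p) with h | h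
  · have := key (α p)
    rw [α.involutive] at this
    have := this h
    tauto
  · exact key p h

lemma numCircles_eq_classSum (α β : Matching n) :
    (numCircles α β : ℤ) = classSum (circleRel α β) fun _ => 1 := by
  have := Fintype.ofFinite (Circles α β)
  rw [numCircles, classSum, finsum_eq_sum_of_fintype, Nat.card_eq_fintype_card]
  simp

lemma circleAt_left (α β : Matching n) (p : Fin (2 * n)) :
    circleAt α β (α p) = circleAt α β p :=
  (Quotient.sound (s := circleRel α β) (invRel_left α β p)).symm

lemma circleAt_right (α β : Matching n) (p : Fin (2 * n)) :
    circleAt α β (β p) = circleAt α β p :=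
  (Quotient.sound (s := circleRel α β) (invRel_right α β p)).symm

lemma circleAt_out {α β : Matching n} (c : Circles α β) : circleAt α β c.out = c :=
  Quotient.out_eq c

lemma circleAt_surjective (α β : Matching n) : Function.Surjective (circleAt α β) :=
  Quotient.mk_surjective

open Classical in
lemma two_le_card_circle (α β : Matching n) (c : Circles α β) :
    2 ≤ (Finset.univ.filter fun p => circleAt α β p = c).card := by
  obtain ⟨p, rfl⟩ := circleAt_surjective α β c
  refine (Finset.card_pair (α.ne p)).ge.trans (Finset.card_le_card ?_)
  intro q hq
  rw [Finset.mem_insert, Finset.mem_singleton] at hq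
  rcases hq with rfl | rfl <;> simp [circleAt_left]

open Classical in
lemma sum_card_circle (α β : Matching n) [Fintype (Circles α β)] :
    ∑ c : Circles α β, (Finset.univ.filter fun p => circleAt α β p = c).card = 2 * n := by
  rw [← Finset.card_eq_sum_card_fiberwise (f := circleAt α β) (t := Finset.univ)
    (fun _ _ => Finset.mem_univ _)]
  simp

lemma numCircles_le (α β : Matching n) : numCircles α β ≤ n := by
  classical
  have := Fintype.ofFinite (Circles α β)
  have h : ∑ _c : Circles α β, 2 ≤ _ := Finset.sum_le_sum fun c _ => two_le_card_circle α β c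
  rw [sum_card_circle] at h
  rw [numCircles, Nat.card_eq_fintype_card]
  simp at h
  omega

lemma numCircles_self (α : Matching n) : numCircles α α = n := by
  classical
  have := Fintype.ofFinite (Circles α α)
  have h : ∑ c : Circles α α, (Finset.univ.filter fun p => circleAt α α p = c).card =
      ∑ _c : Circles α α, 2 := by
    refine Finset.sum_congr rfl fun c _ => le_antisymm ?_ (two_le_card_circle α α c)
    obtain ⟨p, rfl⟩ := circleAt_surjective α α c
    refine (Finset.card_le_card fun q hq => ?_).trans (Finset.card_pair (α.ne p)).le
    have hq : circleRel α α q p := Quotient.exact (Finset.mem_filter.1 hq).2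
    have hinv : ∀ u, (α u = p ∨ α u = α p) = (u = p ∨ u = α p) := fun u => propext <| by
      rw [α.involutive.injective.eq_iff, α.involutive.eq_iff, or_comm, eq_comm]
    have := eq_of_invRel (a := α) (b := α) (f := fun u => (u = p ∨ u = α p)) hinv hinv hq
    rw [Finset.mem_insert, Finset.mem_singleton, or_comm]
    exact this.mpr (Or.inl rfl)
  rw [sum_card_circle] at h
  rw [numCircles, Nat.card_eq_fintype_card]
  simp at h
  omega

lemma eq_of_numCircles_eq {α β : Matching n} (h : numCircles α β = n) : α = β := by
  classical
  have := Fintype.ofFinite (Circles α β)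
  have h1 : ∑ _c : Circles α β, 2 =
      ∑ c : Circles α β, (Finset.univ.filter fun p => circleAt α β p = c).card := by
    rw [sum_card_circle]
    rw [numCircles, Nat.card_eq_fintype_card] at h
    simp [h, mul_comm]
  rw [Finset.sum_eq_sum_iff_of_le fun c _ => two_le_card_circle α β c] at h1
  refine Subtype.ext (funext fun p => ?_)
  have h2 := h1 (circleAt α β p) (Finset.mem_univ _)
  have h3 : ({α p, p} : Finset (Fin (2 * n))) =
      Finset.univ.filter fun q => circleAt α β q = circleAt α β p := by
    refine Finset.eq_of_subset_of_card_le ?_ ?_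
    · intro q hq
      rw [Finset.mem_insert, Finset.mem_singleton] at hq
      rcases hq with rfl | rfl <;> simp [circleAt_left]
    · rw [← h2, Finset.card_pair (α.ne p)]
  have h4 : β p ∈ ({α p, p} : Finset (Fin (2 * n))) := by
    rw [h3]
    simp [circleAt_right]
  rw [Finset.mem_insert, Finset.mem_singleton] at h4
  exact (h4.resolve_right (β.ne p)).symm

end Matchings

/-! ### The Euler characteristic of the minimal cobordism -/

section Euler

variable {n : ℕ}

/-- The arcs of `α` on the copy `false` and of `γ` on the copy `true` of the end-points. -/
def outerArc (α γ : Matching n) (u : Fin (2 * n) × Bool) : Fin (2 * n) × Bool :=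
  (if u.2 then γ u.1 else α u.1, u.2)

/-- The arcs of the two copies of `β`, after the saddles at the arcs whose left end precedes `t`. -/
def innerArc (β : Matching n) (t : ℕ) (u : Fin (2 * n) × Bool) : Fin (2 * n) × Bool :=
  if (min u.1 (β u.1) : Fin (2 * n)).val < t then (u.1, !u.2) else (β u.1, u.2)

lemma midRel_eq (α β γ : Matching n) (p : Fin (2 * n)) :
    midRel α β γ p = invRel (outerArc α γ) (innerArc β p) := by
  unfold midRel invRel
  congr 1
  funext u v
  obtain ⟨u, b⟩ := u
  simp only [outerArc, innerArc, ← Fin.lt_def, eq_iff_iff]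
  by_cases h : min u (β u) < p <;> simp only [h] <;> cases b <;> simp

lemma outerArc_involutive (α γ : Matching n) : Function.Involutive (outerArc α γ) := by
  rintro ⟨u, b⟩
  cases b
  · simp [outerArc, α.involutive u]
  · simp [outerArc, γ.involutive u]

lemma innerArc_involutive (β : Matching n) (t : ℕ) : Function.Involutive (innerArc β t) := by
  rintro ⟨u, b⟩
  by_cases h : ((min u (β u) : Fin (2 * n)) : ℕ) < t
  · simp only [innerArc, h, if_true, Bool.not_not]
  · have h' : ¬ ((min (β u) u : Fin (2 * n)) : ℕ) < t := by rwa [min_comm]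
    simp only [innerArc, h, if_false, β.involutive u, h']

/-- An orientation: the colour changes along every arc and along every vertical segment. -/
def colour (u : Fin (2 * n) × Bool) : Bool := xor (decide ((u.1 : ℕ) % 2 = 0)) u.2

lemma colour_arc (α : Matching n) (p : Fin (2 * n)) (b : Bool) :
    colour (α p, b) = !colour (p, b) := by
  unfold colour
  simp only [α.parity p]
  by_cases h : (p : ℕ) % 2 = 0 <;> cases b <;> simp [h]

lemma colour_not (p : Fin (2 * n)) (b : Bool) : colour (p, !b) = !colour (p, b) := by
  unfold colour
  cases b <;> simp

lemma colour_outerArc (α γ : Matching n) (u : Fin (2 * n) × Bool) :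
    colour (outerArc α γ u) = !colour u := by
  obtain ⟨u, b⟩ := u
  cases b
  · exact colour_arc α u false
  · exact colour_arc γ u true

lemma colour_innerArc (β : Matching n) (t : ℕ) (u : Fin (2 * n) × Bool) :
    colour (innerArc β t u) = !colour u := by
  unfold innerArc
  split_ifs
  · exact colour_not u.1 u.2
  · exact colour_arc β u.1 u.2

/-- A weight on the end-points is constant along the arcs of `α`. -/
def Inv {Y : Type*} (α : Matching n) (w : Fin (2 * n) → Y) : Prop := ∀ p, w (α p) = w p

lemma weight_outerArc {Y : Type*} {α γ : Matching n} {w : Fin (2 * n) → Y} (hα : Inv α w)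
    (hγ : Inv γ w) (u : Fin (2 * n) × Bool) : w (outerArc α γ u).1 = w u.1 := by
  obtain ⟨u, b⟩ := u
  cases b
  · exact hα u
  · exact hγ u

lemma weight_innerArc {Y : Type*} {β : Matching n} {w : Fin (2 * n) → Y} (hβ : Inv β w) (t : ℕ)
    (u : Fin (2 * n) × Bool) : w (innerArc β t u).1 = w u.1 := by
  unfold innerArc
  split_ifs
  exacts [rfl, hβ _]

/-- The total weight of the circles of the intermediate closed `1`-manifold. -/
def midSum (α β γ : Matching n) (w : Fin (2 * n) → ℤ) (t : ℕ) : ℤ :=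
  classSum (invRel (outerArc α γ) (innerArc β t)) fun u => w u.1

/-- The effect of the saddle at the arc with left end `p`. -/
lemma saddle_step (α β γ : Matching n) {p : Fin (2 * n)} (hp : p < β p)
    {w : Fin (2 * n) → ℤ} (hα : Inv α w) (hβ : Inv β w) (hγ : Inv γ w) :
    (SplitsAt α β γ p ∧ midSum α β γ w (p + 1) = midSum α β γ w p + w p) ∨
    (¬ SplitsAt α β γ p ∧
      invRel (outerArc α γ) (innerArc β (p + 1)) (p, false) (β p, false) ∧
      midSum α β γ w (p + 1) = midSum α β γ w p - w p) := by
  have hp' : (p : ℕ) < β p := hp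
  have m1 : min p (β p) = p := min_eq_left hp.le
  have m2 : min (β p) (β (β p)) = p := by rw [β.involutive, min_eq_right hp.le]
  have key := classSum_saddle (a := outerArc α γ) (b := innerArc β p) (b' := innerArc β (p + 1))
    (outerArc_involutive α γ) (innerArc_involutive β p) (colour_outerArc α γ) (colour_innerArc β p)
    (P := (p, false)) (Q := (β p, false)) (P' := (p, true)) (Q' := (β p, true))
    (by simp) (by simp) (colour_not p false)
    (by simp [innerArc, m1]) (by simp [innerArc, m1]) (by simp [innerArc, m1])
    (by simp [innerArc, m1]) (by simp only [innerArc, m2]; simp) (by simp only [innerArc, m2]; simp)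
    (by
      rintro ⟨u, b⟩
      by_cases hu : ((min u (β u) : Fin (2 * n)) : ℕ) = p
      · have : u = p ∨ u = β p := by
          rcases min_choice u (β u) with h | h <;> rw [h] at hu
          · exact Or.inl (Fin.ext hu)
          · exact Or.inr ((β.involutive.eq_iff).1 (Fin.ext hu : β u = p))
        rcases this with rfl | rfl <;> cases b <;> simp
      · right; right; right; right
        unfold innerArc
        refine if_congr ?_ rfl rfl
        change ((min u (β u) : Fin (2 * n)) : ℕ) < p ↔ ((min u (β u) : Fin (2 * n)) : ℕ) < p + 1
        omega)
    (w := fun u => w u.1) (weight_outerArc hα hγ) (weight_innerArc hβ _) (weight_innerArc hβ _)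
  have hs : SplitsAt α β γ p ↔
      invRel (outerArc α γ) (innerArc β p) (p, false) (p, true) := by
    rw [SplitsAt, midRel_eq]
    exact and_iff_right hp
  rw [hs]
  rcases key with h | h
  · exact Or.inl ⟨h.1, h.2.2⟩
  · exact Or.inr ⟨h.1, h.2.1, h.2.2⟩

lemma innerArc_succ_of_not (β : Matching n) {p : Fin (2 * n)} (hp : ¬ p < β p) :
    innerArc β (p + 1) = innerArc β p := by
  funext u
  unfold innerArc
  refine if_congr ?_ rfl rfl
  have : ((min u.1 (β u.1) : Fin (2 * n)) : ℕ) ≠ p := by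
    intro h
    have h := Fin.ext h
    rcases min_choice u.1 (β u.1) with h' | h' <;> rw [h'] at h
    · rw [h] at h'
      exact hp (lt_of_le_of_ne (min_eq_left_iff.1 h') (β.ne p).symm)
    · have h2 := min_eq_right_iff.1 h'
      rw [h, (β.involutive.eq_iff).1 h] at h2
      exact hp (lt_of_le_of_ne h2 (β.ne p).symm)
  omega

open Classical in
lemma midSum_succ (α β γ : Matching n) (p : Fin (2 * n)) {w : Fin (2 * n) → ℤ} (hα : Inv α w)
    (hβ : Inv β w) (hγ : Inv γ w) :
    midSum α β γ w (p + 1) - midSum α β γ w p =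
      2 * (if SplitsAt α β γ p then w p else 0) - if p < β p then w p else 0 := by
  by_cases hp : p < β p
  · rw [if_pos hp]
    rcases saddle_step α β γ hp hα hβ hγ with h | h
    · rw [if_pos h.1, h.2]; ring
    · rw [if_neg h.1, h.2.2]; ring
  · have : ¬ SplitsAt α β γ p := fun h => hp h.1
    rw [if_neg hp, if_neg this, midSum, midSum, innerArc_succ_of_not β hp]
    ring

lemma midSum_end (α β γ : Matching n) {w : Fin (2 * n) → ℤ} (hα : Inv α w) (hγ : Inv γ w) :
    midSum α β γ w (2 * n) = classSum (circleRel α γ) w := by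
  have hin : ∀ u : Fin (2 * n) × Bool, innerArc β (2 * n) u = (u.1, !u.2) := fun u =>
    if_pos (Fin.is_lt _)
  have hr : ∀ (p : Fin (2 * n)) (b b' : Bool),
      invRel (outerArc α γ) (innerArc β (2 * n)) (p, b) (p, b') := by
    intro p b b'
    have := invRel_right (outerArc α γ) (innerArc β (2 * n)) (p, b)
    rw [hin] at this
    by_cases h : b' = b
    · rw [h]
    · have h : b' = !b := by cases b <;> cases b' <;> simp_all
      rw [h]
      exact this
  refine classSum_congr_of_map Prod.fst ?_ (fun y => ⟨(y, false), (circleRel α γ).refl _⟩)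
    (fun u v h => eq_of_invRel (a := α) (b := γ) hα hγ h)
  rintro ⟨u, b⟩ ⟨v, b'⟩
  constructor
  · refine fun h => (invRel_le (s := (circleRel α γ).comap Prod.fst) ?_ ?_) h
    · rintro ⟨u, b⟩
      cases b
      · exact invRel_left α γ u
      · exact invRel_right α γ u
    · intro u
      rw [hin]
      exact (circleRel α γ).refl _
  · intro h
    have : (circleRel α γ) ≤ (invRel (outerArc α γ) (innerArc β (2 * n))).comap
        fun p => (p, false) := by
      refine invRel_le (a := α) (b := γ) (fun u => invRel_left _ _ (u, false)) fun u => ?_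
      exact (invRel _ _).trans (hr u false true)
        ((invRel _ _).trans (invRel_left _ _ (u, true)) (hr (γ u) true false))
    exact (invRel _ _).trans (hr u b false) ((invRel _ _).trans (this h) (hr v false b'))

lemma midSum_start (α β γ : Matching n) {w : Fin (2 * n) → ℤ} (hα : Inv α w) (hβ : Inv β w)
    (hγ : Inv γ w) :
    midSum α β γ w 0 = classSum (circleRel α β) w + classSum (circleRel β γ) w := by
  let r := invRel (outerArc α γ) (innerArc β 0)
  have hin : ∀ u : Fin (2 * n) × Bool, innerArc β 0 u = (β u.1, u.2) := fun u =>
    if_neg (Nat.not_lt_zero _)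
  let g : Fin (2 * n) × Bool → Circles α β ⊕ Circles β γ := fun u =>
    if u.2 then Sum.inr (circleAt β γ u.1) else Sum.inl (circleAt α β u.1)
  have hg : ∀ u v, r u v → g u = g v := fun u v h => by
    refine eq_of_invRel ?_ ?_ h
    · rintro ⟨u, b⟩
      cases b
      · exact congrArg Sum.inl (circleAt_left α β u)
      · exact congrArg Sum.inr (circleAt_right β γ u)
    · rintro ⟨u, b⟩
      rw [hin]
      cases b
      · exact congrArg Sum.inl (circleAt_right α β u)
      · exact congrArg Sum.inr (circleAt_left β γ u)
  have h1 : circleRel α β ≤ r.comap fun p => (p, false) :=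
    invRel_le (a := α) (b := β) (fun u => invRel_left _ _ (u, false)) fun u => by
      have := invRel_right (outerArc α γ) (innerArc β 0) (u, false)
      rwa [hin] at this
  have h2 : circleRel β γ ≤ r.comap fun p => (p, true) :=
    invRel_le (a := β) (b := γ) (fun u => by
      have := invRel_right (outerArc α γ) (innerArc β 0) (u, true)
      rwa [hin] at this) (fun u => invRel_left _ _ (u, true))
  let e : Quotient r ≃ Circles α β ⊕ Circles β γ :=
    { toFun := Quotient.lift g hg
      invFun := Sum.elim (Quotient.map _ h1) (Quotient.map _ h2)
      left_inv := by
        rintro ⟨u, b⟩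
        cases b <;> rfl
      right_inv := by
        rintro (c | c) <;> induction c using Quotient.inductionOn <;> rfl }
  have := Fintype.ofFinite (Circles α β)
  have := Fintype.ofFinite (Circles β γ)
  rw [midSum, classSum, classSum, classSum]
  rw [finsum_eq_of_bijective (g := Sum.elim (fun c : Circles α β => w c.out)
    fun c : Circles β γ => w c.out) e e.bijective, finsum_eq_sum_of_fintype, Fintype.sum_sum_type,
    finsum_eq_sum_of_fintype, finsum_eq_sum_of_fintype]
  · rfl
  · intro c
    have hc : e c = g c.out := by
      conv_lhs => rw [← Quotient.out_eq c]
      rfl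
    rw [hc]
    obtain ⟨⟨u, b⟩, hu⟩ : ∃ u, u = Quotient.out c := ⟨_, rfl⟩
    rw [← hu]
    cases b
    · exact (eq_of_invRel (a := α) (b := β) hα hβ (Quotient.mk_out (s := circleRel α β) u)).symm
    · exact (eq_of_invRel (a := β) (b := γ) hβ hγ (Quotient.mk_out (s := circleRel β γ) u)).symm

open Classical in
/-- The Euler characteristic of the minimal cobordism, weighted by a function which is constant
on its connected components. -/
theorem euler_weighted (α β γ : Matching n) {w : Fin (2 * n) → ℤ} (hα : Inv α w) (hβ : Inv β w)
    (hγ : Inv γ w) :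
    4 * ∑ p, (if SplitsAt α β γ p then w p else 0) = ∑ p, w p +
      2 * (classSum (circleRel α γ) w - classSum (circleRel α β) w
        - classSum (circleRel β γ) w) := by
  have h1 : ∑ p : Fin (2 * n), (midSum α β γ w (p + 1) - midSum α β γ w p) =
      midSum α β γ w (2 * n) - midSum α β γ w 0 := by
    rw [Fin.sum_univ_eq_sum_range (fun i => midSum α β γ w (i + 1) - midSum α β γ w i),
      Finset.sum_range_sub]
  simp_rw [midSum_succ α β γ _ hα hβ hγ] at h1
  rw [midSum_end α β γ hα hγ, midSum_start α β γ hα hβ hγ, Finset.sum_sub_distrib,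
    ← Finset.mul_sum] at h1
  have h2 : ∑ p, (if p < β p then w p else 0) = ∑ p, (if β p < p then w p else 0) := by
    rw [← Equiv.sum_comp β.involutive.toPerm]
    refine Finset.sum_congr rfl fun p _ => ?_
    simp only [Function.Involutive.coe_toPerm, β.involutive p, hβ p]
  have h3 : ∑ p, w p = ∑ p, (if p < β p then w p else 0) + ∑ p, (if β p < p then w p else 0) := by
    rw [← Finset.sum_add_distrib]
    refine Finset.sum_congr rfl fun p _ => ?_
    rcases lt_or_gt_of_ne (β.ne p) with h | h
    · rw [if_pos h, if_neg h.not_gt, zero_add]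
    · rw [if_pos h, if_neg h.not_gt, add_zero]
  linarith

/-- If a function on the circles takes the same values on both sides of every splitting saddle, then
it is constant on the components of the whole cobordism. -/
lemma inv_of_splits {Y : Type*} {α β γ : Matching n} {w : Fin (2 * n) → Y} (hα : Inv α w)
    (hγ : Inv γ w) (h : ∀ p, SplitsAt α β γ p → w (β p) = w p) : Inv β w := by
  have key : ∀ s t : ℕ, t + s = 2 * n → ∀ u, w (innerArc β t u).1 = w u.1 := by
    intro s
    induction s with
    | zero =>
      rintro t ht u
      rw [innerArc, if_pos]
      have := Fin.is_lt (min u.1 (β u.1))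
      omega
    | succ s ih =>
      intro t ht u
      have ih := ih (t + 1) (by omega)
      obtain ⟨p, rfl⟩ : ∃ p : Fin (2 * n), t = p := ⟨⟨t, by omega⟩, rfl⟩
      by_cases hp : p < β p
      · have hw : w (β p) = w p := by
          rcases saddle_step α β γ hp (w := fun _ => 1) (fun _ => rfl) (fun _ => rfl)
            (fun _ => rfl) with h' | h'
          · exact h p h'.1
          · exact (eq_of_invRel (f := fun u => w u.1) (weight_outerArc hα hγ) ih h'.2.1).symm
        by_cases hu : min u.1 (β u.1) = p
        · have h1 : w (β u.1) = w u.1 := by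
            rcases min_choice u.1 (β u.1) with h' | h' <;> rw [h'] at hu
            · rw [hu, hw]
            · have : u.1 = β p := (β.involutive.eq_iff).1 hu
              rw [this, β.involutive, hw]
          rw [innerArc]
          split_ifs
          exacts [rfl, h1]
        · rw [← ih u]
          have h2 : innerArc β p u = innerArc β (p + 1) u := by
            unfold innerArc
            refine if_congr ?_ rfl rfl
            have : ((min u.1 (β u.1) : Fin (2 * n)) : ℕ) ≠ p := fun h => hu (Fin.ext h)
            omega
          rw [h2]
      · rw [← innerArc_succ_of_not β hp]
        exact ih u
  intro p
  have := key (2 * n) 0 (by omega) (p, false)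
  rwa [innerArc, if_neg (Nat.not_lt_zero _)] at this

/-! ### The image of `1 ⊗ 1` under the minimal cobordism -/

open Classical in
/-- The lift of `saddleFactor` to a polynomial with integer coefficients. -/
def splitPoly (α β γ : Matching n) : MvPolynomial (Circles α γ) ℤ :=
  ∏ p : Fin (2 * n), if SplitsAt α β γ p then
    MvPolynomial.X (circleAt α γ p) + MvPolynomial.X (circleAt α γ (β p)) else 1

lemma toAlg_splitPoly (k : Type*) [CommRing k] (α β γ : Matching n) :
    toAlg k _ (splitPoly α β γ) = saddleFactor k α β γ := by
  rw [splitPoly, saddleFactor, map_prod]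
  refine Finset.prod_congr rfl fun p _ => ?_
  split_ifs <;> simp

open Classical in
/-- The number of splitting saddles at end-points with the property `Q`. -/
def splitCount (α β γ : Matching n) (Q : Fin (2 * n) → Prop) : ℕ :=
  (Finset.univ.filter fun p => SplitsAt α β γ p ∧ Q p).card

open Classical in
lemma splitCount_eq (α β γ : Matching n) {Q : Fin (2 * n) → Prop} (hα : Inv α Q) (hβ : Inv β Q)
    (hγ : Inv γ Q) :
    4 * (splitCount α β γ Q : ℤ) = ∑ p, (if Q p then 1 else 0) +
      2 * (classSum (circleRel α γ) (fun p => if Q p then 1 else 0)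
        - classSum (circleRel α β) (fun p => if Q p then 1 else 0)
        - classSum (circleRel β γ) (fun p => if Q p then 1 else 0)) := by
  rw [← euler_weighted (w := fun p => if Q p then 1 else 0) α β γ
    (fun p => by simp only [hα p]) (fun p => by simp only [hβ p]) (fun p => by simp only [hγ p]),
    splitCount, Finset.card_filter]
  push_cast
  congr 1
  refine Finset.sum_congr rfl fun p _ => ?_
  split_ifs <;> tauto

/-- The number of splits does not depend on the order in which four matchings are composed. -/
lemma splitCount_assoc (α β γ δ : Matching n) {Q : Fin (2 * n) → Prop} (hα : Inv α Q) (hβ : Inv β Q)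
    (hγ : Inv γ Q) (hδ : Inv δ Q) :
    splitCount α β γ Q + splitCount α γ δ Q = splitCount β γ δ Q + splitCount α β δ Q := by
  have h1 := splitCount_eq α β γ hα hβ hγ
  have h2 := splitCount_eq α γ δ hα hγ hδ
  have h3 := splitCount_eq β γ δ hβ hγ hδ
  have h4 := splitCount_eq α β δ hα hβ hδ
  omega

lemma two_mul_splitCount (α β γ : Matching n) :
    2 * splitCount α β γ (fun _ => True) + numCircles α β + numCircles β γ =
      n + numCircles α γ := by
  have := splitCount_eq α β γ (Q := fun _ => True) (fun _ => rfl) (fun _ => rfl) (fun _ => rfl)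
  simp only [if_true, ← numCircles_eq_classSum, Finset.sum_const, Finset.card_univ,
    Fintype.card_fin, nsmul_eq_mul, mul_one] at this
  push_cast at this
  omega

lemma splitPoly_isHomogeneous (α β γ : Matching n) :
    (splitPoly α β γ).IsHomogeneous (splitCount α β γ fun _ => True) := by
  classical
  rw [splitCount, Finset.card_filter, splitPoly]
  refine MvPolynomial.IsHomogeneous.prod _ _ _ fun p _ => ?_
  by_cases h : SplitsAt α β γ p
  · simp only [h, and_self, if_true]
    exact (MvPolynomial.isHomogeneous_X _ _).add (MvPolynomial.isHomogeneous_X _ _)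
  · simp only [h, false_and, if_false]
    exact MvPolynomial.isHomogeneous_one _ _

/-- The image of a circle in another pair of matchings, through its chosen end-point. -/
abbrev reCircle {α β : Matching n} (α' β' : Matching n) (c : Circles α β) : Circles α' β' :=
  circleAt α' β' c.out

lemma apply_out {Y : Type*} {α β : Matching n} {w : Fin (2 * n) → Y} (hα : Inv α w) (hβ : Inv β w)
    (p : Fin (2 * n)) : w (circleAt α β p).out = w p :=
  eq_of_invRel (a := α) (b := β) hα hβ (Quotient.mk_out (s := circleRel α β) p)

lemma inv_circleAt_left {Y : Type*} {α β : Matching n} (ε : Circles α β → Y) :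
    Inv α fun p => ε (circleAt α β p) := fun p => congrArg ε (circleAt_left α β p)

lemma inv_circleAt_right {Y : Type*} {α β : Matching n} (ε : Circles α β → Y) :
    Inv β fun p => ε (circleAt α β p) := fun p => congrArg ε (circleAt_right α β p)

lemma inv_of_eval_splitPoly_ne_zero {α β γ : Matching n} {ε : Circles α γ → ℤ}
    (hε : ∀ c, ε c = 1 ∨ ε c = -1) (h : MvPolynomial.eval ε (splitPoly α β γ) ≠ 0) :
    Inv β fun p => ε (circleAt α γ p) := by
  refine inv_of_splits (α := α) (γ := γ) (inv_circleAt_left ε) (inv_circleAt_right ε) fun p hp => ?_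
  rw [splitPoly, map_prod, Finset.prod_ne_zero_iff] at h
  have := h p (Finset.mem_univ p)
  rw [if_pos hp, map_add, MvPolynomial.eval_X, MvPolynomial.eval_X] at this
  change ε (circleAt α γ (β p)) = ε (circleAt α γ p)
  rcases hε (circleAt α γ p) with h1 | h1 <;> rcases hε (circleAt α γ (β p)) with h2 | h2 <;>
    rw [h1, h2] at this ⊢ <;> exact absurd rfl this

lemma eval_splitPoly_of_inv {α β γ : Matching n} {ε : Circles α γ → ℤ}
    (hε : ∀ c, ε c = 1 ∨ ε c = -1) {w : Fin (2 * n) → ℤ} (hw : ∀ p, ε (circleAt α γ p) = w p)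
    (hβ : Inv β w) : MvPolynomial.eval ε (splitPoly α β γ) =
      2 ^ splitCount α β γ (fun p => w p = 1) * (-2) ^ splitCount α β γ (fun p => w p = -1) := by
  classical
  have h : ∀ (z : ℤ) (Q : Fin (2 * n) → Prop), z ^ splitCount α β γ Q =
      ∏ p, if SplitsAt α β γ p ∧ Q p then z else 1 := fun z Q => by
    rw [Finset.prod_ite, Finset.prod_const, Finset.prod_const_one, mul_one, splitCount]
  rw [splitPoly, map_prod, h, h, ← Finset.prod_mul_distrib]
  refine Finset.prod_congr rfl fun p _ => ?_
  by_cases hp : SplitsAt α β γ p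
  · simp only [hp, true_and, if_true, map_add, MvPolynomial.eval_X, hw, hβ p]
    rcases hε (circleAt α γ p) with h | h <;> rw [hw] at h <;> rw [h] <;> norm_num
  · simp [hp]

/-- Composition of two minimal cobordisms with polynomial coefficients. -/
lemma eval_splitPoly_comp {α β γ α' γ' : Matching n} {ε : Circles α' γ' → ℤ}
    (hε : ∀ c, ε c = 1 ∨ ε c = -1) (h : Inv α fun p => ε (circleAt α' γ' p))
    (h' : Inv γ fun p => ε (circleAt α' γ' p)) :
    (MvPolynomial.eval ε (MvPolynomial.rename (reCircle α' γ') (splitPoly α β γ)) ≠ 0 →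
      Inv β fun p => ε (circleAt α' γ' p)) ∧
    ((Inv β fun p => ε (circleAt α' γ' p)) →
      MvPolynomial.eval ε (MvPolynomial.rename (reCircle α' γ') (splitPoly α β γ)) =
      2 ^ splitCount α β γ (fun p => ε (circleAt α' γ' p) = 1) *
        (-2) ^ splitCount α β γ (fun p => ε (circleAt α' γ' p) = -1)) := by
  rw [MvPolynomial.eval_rename]
  have hw : ∀ p, (ε ∘ reCircle α' γ') (circleAt α γ p) = ε (circleAt α' γ' p) :=
    fun p => apply_out h h' p
  refine ⟨fun hne => ?_, fun hβ => eval_splitPoly_of_inv (fun c => hε _) hw hβ⟩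
  have := inv_of_eval_splitPoly_ne_zero (fun c => hε _) hne
  exact fun p => ((hw (β p)).symm.trans (this p)).trans (hw p)

end Euler

/-! ### The arc algebra is associative, unital and graded -/

section ArcAlgebra

variable {n : ℕ} (k : Type*) [CommRing k]

lemma mul_apply (α β γ : Matching n) (f : Hom k α β) (g : Hom k β γ) :
    mul k α β γ f g =
      push k (reCircle α γ) f * push k (reCircle α γ) g * saddleFactor k α β γ := rfl

/-- A polynomial on the circles of `α^⋄ ∘ δ` which is supported on those sign vectors which
are constant along `β` does not distinguish between dots at the two ends of an arc of `β`. -/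
lemma inv_dot_mul_of_eval {α δ β : Matching n} {P : MvPolynomial (Circles α δ) ℤ} {d : ℕ}
    (hP : P.IsHomogeneous d) (h : ∀ ε : Circles α δ → ℤ, (∀ c, ε c = 1 ∨ ε c = -1) →
      MvPolynomial.eval ε P ≠ 0 → Inv β fun p => ε (circleAt α δ p)) :
    Inv β fun p => dot k (circleAt α δ p) * toAlg k _ P := by
  intro p
  change dot k (circleAt α δ (β p)) * toAlg k _ P = dot k (circleAt α δ p) * toAlg k _ P
  rw [← sub_eq_zero, ← toAlg_X, ← toAlg_X, ← map_mul, ← map_mul, ← map_sub, ← sub_mul]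
  refine toAlg_eq_zero_of_eval_signs k
    (((MvPolynomial.isHomogeneous_X ℤ _).sub (MvPolynomial.isHomogeneous_X ℤ _)).mul hP)
    fun ε hε => ?_
  rw [map_mul, map_sub, MvPolynomial.eval_X, MvPolynomial.eval_X]
  by_cases h0 : MvPolynomial.eval ε P = 0
  · rw [h0, mul_zero]
  · rw [show ε (circleAt α δ (β p)) = ε (circleAt α δ p) from h ε hε h0 p, sub_self, zero_mul]

/-- The value at `1 ⊗ 1 ⊗ 1` of the composition of `α → β → γ` with `γ → δ`. -/
def leftPoly (α β γ δ : Matching n) : MvPolynomial (Circles α δ) ℤ :=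
  MvPolynomial.rename (reCircle α δ) (splitPoly α β γ) * splitPoly α γ δ

/-- The value at `1 ⊗ 1 ⊗ 1` of the composition of `α → β` with `β → γ → δ`. -/
def rightPoly (α β γ δ : Matching n) : MvPolynomial (Circles α δ) ℤ :=
  MvPolynomial.rename (reCircle α δ) (splitPoly β γ δ) * splitPoly α β δ

lemma leftPoly_isHomogeneous (α β γ δ : Matching n) : (leftPoly α β γ δ).IsHomogeneous
    (splitCount α β γ (fun _ => True) + splitCount α γ δ fun _ => True) :=
  ((splitPoly_isHomogeneous α β γ).rename_isHomogeneous).mul (splitPoly_isHomogeneous α γ δ)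

lemma rightPoly_isHomogeneous (α β γ δ : Matching n) : (rightPoly α β γ δ).IsHomogeneous
    (splitCount β γ δ (fun _ => True) + splitCount α β δ fun _ => True) :=
  ((splitPoly_isHomogeneous β γ δ).rename_isHomogeneous).mul (splitPoly_isHomogeneous α β δ)

lemma inv_of_eval_leftPoly_ne_zero {α β γ δ : Matching n} {ε : Circles α δ → ℤ}
    (hε : ∀ c, ε c = 1 ∨ ε c = -1) (h : MvPolynomial.eval ε (leftPoly α β γ δ) ≠ 0) :
    (Inv β fun p => ε (circleAt α δ p)) ∧ Inv γ fun p => ε (circleAt α δ p) := by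
  rw [leftPoly, map_mul] at h
  have hγ := inv_of_eval_splitPoly_ne_zero hε (right_ne_zero_of_mul h)
  exact ⟨(eval_splitPoly_comp hε (inv_circleAt_left ε) hγ).1 (left_ne_zero_of_mul h), hγ⟩

lemma inv_of_eval_rightPoly_ne_zero {α β γ δ : Matching n} {ε : Circles α δ → ℤ}
    (hε : ∀ c, ε c = 1 ∨ ε c = -1) (h : MvPolynomial.eval ε (rightPoly α β γ δ) ≠ 0) :
    (Inv β fun p => ε (circleAt α δ p)) ∧ Inv γ fun p => ε (circleAt α δ p) := by
  rw [rightPoly, map_mul] at h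
  have hβ := inv_of_eval_splitPoly_ne_zero hε (right_ne_zero_of_mul h)
  exact ⟨hβ, (eval_splitPoly_comp hε hβ (inv_circleAt_right ε)).1 (left_ne_zero_of_mul h)⟩

lemma toAlg_leftPoly_eq (α β γ δ : Matching n) :
    toAlg k _ (leftPoly α β γ δ) = toAlg k _ (rightPoly α β γ δ) := by
  have hd : splitCount β γ δ (fun _ => True) + splitCount α β δ (fun _ => True) =
      splitCount α β γ (fun _ => True) + splitCount α γ δ fun _ => True :=
    (splitCount_assoc α β γ δ (fun _ => rfl) (fun _ => rfl) (fun _ => rfl) fun _ => rfl).symm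
  rw [← sub_eq_zero, ← map_sub]
  refine toAlg_eq_zero_of_eval_signs k ((leftPoly_isHomogeneous α β γ δ).sub
    (hd ▸ rightPoly_isHomogeneous α β γ δ)) fun ε hε => ?_
  rw [map_sub, sub_eq_zero]
  have hα : Inv α fun p => ε (circleAt α δ p) := inv_circleAt_left ε
  have hδ : Inv δ fun p => ε (circleAt α δ p) := inv_circleAt_right ε
  by_cases h : (Inv β fun p => ε (circleAt α δ p)) ∧ Inv γ fun p => ε (circleAt α δ p)
  · obtain ⟨hβ, hγ⟩ := h
    have hQ : ∀ {ζ : Matching n} (z : ℤ), (Inv ζ fun p => ε (circleAt α δ p)) →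
        Inv ζ fun p => ε (circleAt α δ p) = z := fun z h p => congrArg (· = z) (h p)
    rw [leftPoly, rightPoly, map_mul, map_mul, (eval_splitPoly_comp hε hα hγ).2 hβ,
      (eval_splitPoly_comp hε hβ hδ).2 hγ, eval_splitPoly_of_inv hε (fun _ => rfl) hγ,
      eval_splitPoly_of_inv hε (fun _ => rfl) hβ, mul_mul_mul_comm, ← pow_add, ← pow_add,
      splitCount_assoc α β γ δ (hQ 1 hα) (hQ 1 hβ) (hQ 1 hγ) (hQ 1 hδ),
      splitCount_assoc α β γ δ (hQ (-1) hα) (hQ (-1) hβ) (hQ (-1) hγ) (hQ (-1) hδ),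
      pow_add, pow_add, mul_mul_mul_comm]
  · have h1 : MvPolynomial.eval ε (leftPoly α β γ δ) = 0 := by
      by_contra h0
      exact h (inv_of_eval_leftPoly_ne_zero hε h0)
    have h2 : MvPolynomial.eval ε (rightPoly α β γ δ) = 0 := by
      by_contra h0
      exact h (inv_of_eval_rightPoly_ne_zero hε h0)
    rw [h1, h2]

lemma assoc_aux_left {R : Type*} [CommRing R] {f f' g g' h s s' Φ : R} (hs : s * s' = Φ)
    (hf : f' * Φ = f * Φ) (hg : g' * Φ = g * Φ) : f' * g' * s * h * s' = f * g * h * Φ := by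
  calc _ = h * (g' * (f' * Φ)) := by rw [← hs]; ring
    _ = h * (f * (g' * Φ)) := by rw [hf]; ring
    _ = _ := by rw [hg]; ring

lemma assoc_aux_right {R : Type*} [CommRing R] {f g g' h h' s s' Φ : R} (hs : s * s' = Φ)
    (hg : g' * Φ = g * Φ) (hh : h' * Φ = h * Φ) : f * (g' * h' * s) * s' = f * g * h * Φ := by
  calc _ = f * (h' * (g' * Φ)) := by rw [← hs]; ring
    _ = f * (g * (h' * Φ)) := by rw [hg]; ring
    _ = _ := by rw [hh]; ring

/-- The values of both sides at `1 ⊗ 1 ⊗ 1` agree by `toAlg_leftPoly_eq`, and composition is linear over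
dots at the end-points. -/
theorem mul_assoc' (α β γ δ : Matching n) (f : Hom k α β) (g : Hom k β γ) (h : Hom k γ δ) :
    mul k α γ δ (mul k α β γ f g) h = mul k α β δ f (mul k β γ δ g h) := by
  set Φ := toAlg k _ (leftPoly α β γ δ) with hΦ
  have hL : push k (reCircle α δ) (saddleFactor k α β γ) * saddleFactor k α γ δ = Φ := by
    rw [hΦ, leftPoly, map_mul, toAlg_rename, toAlg_splitPoly, toAlg_splitPoly]
  have hR : push k (reCircle α δ) (saddleFactor k β γ δ) * saddleFactor k α β δ = Φ := by
    rw [hΦ, toAlg_leftPoly_eq, rightPoly, map_mul, toAlg_rename, toAlg_splitPoly, toAlg_splitPoly]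
  have hα : Inv α fun p => dot k (circleAt α δ p) * Φ :=
    inv_circleAt_left (β := δ) fun c => dot k c * Φ
  have hδ : Inv δ fun p => dot k (circleAt α δ p) * Φ :=
    inv_circleAt_right (α := α) fun c => dot k c * Φ
  have hβ : Inv β fun p => dot k (circleAt α δ p) * Φ :=
    inv_dot_mul_of_eval k (leftPoly_isHomogeneous α β γ δ)
      fun ε hε h0 => (inv_of_eval_leftPoly_ne_zero hε h0).1
  have hγ : Inv γ fun p => dot k (circleAt α δ p) * Φ :=
    inv_dot_mul_of_eval k (leftPoly_isHomogeneous α β γ δ)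
      fun ε hε h0 => (inv_of_eval_leftPoly_ne_zero hε h0).2
  clear_value Φ
  have key : ∀ {ζ η ζ' η' : Matching n}, (Inv ζ' fun p => dot k (circleAt α δ p) * Φ) →
      (Inv η' fun p => dot k (circleAt α δ p) * Φ) → ∀ f : Hom k ζ η,
      push k (reCircle α δ) (push k (reCircle ζ' η') f) * Φ = push k (reCircle α δ) f * Φ := by
    intro ζ η ζ' η' h h' f
    rw [push_push]
    refine push_mul_congr k (fun c => ?_) f
    exact apply_out (w := fun p => dot k (circleAt α δ p) * Φ) h h' c.out
  simp only [mul_apply, map_mul]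
  rw [assoc_aux_left hL (key hα hγ f) (key hα hγ g), assoc_aux_right hR (key hβ hδ g) (key hβ hδ h)]

lemma saddleFactor_eq_one {α β γ : Matching n} (h : splitCount α β γ (fun _ => True) = 0) :
    saddleFactor k α β γ = 1 := by
  refine Finset.prod_eq_one fun p _ => if_neg fun hp => ?_
  simp only [splitCount, Finset.card_eq_zero, Finset.filter_eq_empty_iff] at h
  exact h (Finset.mem_univ p) ⟨hp, trivial⟩

lemma push_reCircle_self {α β : Matching n} (f : Hom k α β) : push k (reCircle α β) f = f := by
  have : reCircle α β = fun c : Circles α β => c := funext circleAt_out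
  rw [this, push_id]

@[simp] lemma one_mul' (α β : Matching n) (f : Hom k α β) : mul k α α β 1 f = f := by
  have := two_mul_splitCount α α β
  rw [numCircles_self] at this
  rw [mul_apply, map_one, one_mul, saddleFactor_eq_one k (by omega), mul_one, push_reCircle_self]

@[simp] lemma mul_one' (α β : Matching n) (f : Hom k α β) : mul k α β β f 1 = f := by
  have := two_mul_splitCount α β β
  rw [numCircles_self] at this
  rw [mul_apply, map_one, mul_one, saddleFactor_eq_one k (by omega), mul_one, push_reCircle_self]

/-- The `q`-degree of a squarefree monomial. -/
def monoQ {α β : Matching n} (S : Finset (Circles α β)) : ℤ := n - numCircles α β + 2 * S.card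

lemma mono_mem_deg {α β : Matching n} (S : Finset (Circles α β)) :
    mono k S ∈ Hom.deg k α β (monoQ S) :=
  Submodule.subset_span ⟨S, rfl, rfl⟩

lemma monoDeg_le_deg (α β : Matching n) (m : ℕ) :
    monoDeg k (Circles α β) m ≤ Hom.deg k α β (n - numCircles α β + 2 * m) := by
  refine Submodule.span_mono ?_
  rintro _ ⟨S, rfl, rfl⟩
  exact ⟨S, rfl, rfl⟩

lemma mul_mem_deg {α β γ : Matching n} {d e : ℤ} {f : Hom k α β} {g : Hom k β γ}
    (hf : f ∈ Hom.deg k α β d) (hg : g ∈ Hom.deg k β γ e) :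
    mul k α β γ f g ∈ Hom.deg k α γ (d + e) := by
  classical
  induction hf, hg using Submodule.span_induction₂ with
  | mem_mem f g hf hg =>
    obtain ⟨S, rfl, rfl⟩ := hf
    obtain ⟨T, rfl, rfl⟩ := hg
    have h1 : saddleFactor k α β γ ∈ monoDeg k _ (splitCount α β γ fun _ => True) := by
      rw [splitCount, Finset.card_filter, saddleFactor]
      refine prod_mem_monoDeg k _ _ _ fun p _ => ?_
      by_cases h : SplitsAt α β γ p
      · simp only [h, and_self, if_true]
        exact Submodule.add_mem _ (dot_mem_monoDeg k _) (dot_mem_monoDeg k _)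
      · simp only [h, false_and, if_false]
        exact one_mem_monoDeg k
    have h2 := monoDeg_le_deg k α γ _ (mul_mem_monoDeg k (mul_mem_monoDeg k
      (push_mem_monoDeg k (reCircle α γ) (mono_mem_monoDeg k S))
      (push_mem_monoDeg k (reCircle α γ) (mono_mem_monoDeg k T))) h1)
    have h3 := two_mul_splitCount α β γ
    have h4 : (n - numCircles α β + 2 * S.card : ℤ) + (n - numCircles β γ + 2 * T.card) =
        n - numCircles α γ +
          2 * ((S.card + T.card + splitCount α β γ fun _ => True : ℕ) : ℤ) := by
      push_cast
      omega
    rw [h4]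
    exact h2
  | zero_left => rw [map_zero, LinearMap.zero_apply]; exact Submodule.zero_mem _
  | zero_right => rw [map_zero]; exact Submodule.zero_mem _
  | add_left _ _ _ _ _ _ h1 h2 =>
    rw [map_add, LinearMap.add_apply]; exact Submodule.add_mem _ h1 h2
  | add_right _ _ _ _ _ _ h1 h2 => rw [map_add]; exact Submodule.add_mem _ h1 h2
  | smul_left r _ _ _ _ h =>
    rw [map_smul, LinearMap.smul_apply]; exact Submodule.smul_mem _ _ h
  | smul_right r _ _ _ _ h => rw [map_smul]; exact Submodule.smul_mem _ _ h

lemma one_mem_deg (α : Matching n) : (1 : Hom k α α) ∈ Hom.deg k α α 0 := by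
  have := monoDeg_le_deg k α α 0 (one_mem_monoDeg k)
  rwa [numCircles_self, Nat.cast_zero, mul_zero, sub_self, zero_add] at this

/-- The arc algebra is non-negatively graded, and its part of degree `0` is spanned by the
idempotents. -/
lemma one_le_monoQ {α β : Matching n} {S : Finset (Circles α β)} (h : ¬ (α = β ∧ S.card = 0)) :
    1 ≤ monoQ S := by
  have h1 := numCircles_le α β
  by_cases h2 : numCircles α β = n
  · have : S.card ≠ 0 := fun h' => h ⟨eq_of_numCircles_eq h2, h'⟩
    rw [monoQ]
    omega
  · rw [monoQ]
    omega

end ArcAlgebra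

/-! ### The total arc algebra -/

section TotalAlgebra

variable {n : ℕ} (k : Type*) [CommRing k]

variable (n) in
/-- The arc algebra `H_n` as the direct sum of its components `Hom k α β`. -/
abbrev ArcAlg : Type _ := ∀ α β : Matching n, Hom k α β

/-- The product of the arc algebra. -/
def arcMul : ArcAlg n k →ₗ[k] ArcAlg n k →ₗ[k] ArcAlg n k :=
  LinearMap.mk₂ k (fun f g α γ => ∑ β, mul k α β γ (f α β) (g β γ))
    (fun f f' g => by
      funext α γ
      simp only [Pi.add_apply, map_add, LinearMap.add_apply, Finset.sum_add_distrib])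
    (fun c f g => by
      funext α γ
      simp only [Pi.smul_apply, map_smul, LinearMap.smul_apply, Finset.smul_sum])
    (fun f g g' => by
      funext α γ
      simp only [Pi.add_apply, map_add, Finset.sum_add_distrib])
    (fun c f g => by
      funext α γ
      simp only [Pi.smul_apply, map_smul, Finset.smul_sum])

lemma arcMul_apply (f g : ArcAlg n k) (α γ : Matching n) :
    arcMul k f g α γ = ∑ β, mul k α β γ (f α β) (g β γ) := rfl

lemma arcMul_assoc (f g h : ArcAlg n k) :
    arcMul k (arcMul k f g) h = arcMul k f (arcMul k g h) := by
  funext α δ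
  simp only [arcMul_apply, map_sum, LinearMap.sum_apply, mul_assoc']
  exact Finset.sum_comm

/-- The inclusion of a component of the arc algebra. -/
def single (α β : Matching n) : Hom k α β →ₗ[k] ArcAlg n k :=
  (LinearMap.single k (fun α => ∀ β, Hom k α β) α).comp (LinearMap.single k (Hom k α) β)

@[simp] lemma single_same (α β : Matching n) (f : Hom k α β) : single k α β f α β = f := by
  simp [single]

lemma single_of_ne_left {α α' : Matching n} (h : α' ≠ α) (β β' : Matching n) (f : Hom k α β) :
    single k α β f α' β' = 0 := by
  simp [single, h]

lemma single_of_ne_right {β β' : Matching n} (h : β' ≠ β) (α α' : Matching n) (f : Hom k α β) :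
    single k α β f α' β' = 0 := by
  by_cases h' : α' = α
  · subst h'
    simp [single, h]
  · exact single_of_ne_left k h' _ _ _

lemma single_arcMul_apply {α β : Matching n} (f : Hom k α β) (g : ArcAlg n k) (δ ε : Matching n) :
    arcMul k (single k α β f) g δ ε = single k α ε (mul k α β ε f (g β ε)) δ ε := by
  rw [arcMul_apply]
  by_cases h : δ = α
  · subst h
    rw [Finset.sum_eq_single β, single_same, single_same]
    · intro γ _ hγ
      rw [single_of_ne_right k hγ, map_zero, LinearMap.zero_apply]
    · exact fun h => absurd (Finset.mem_univ _) h
  · rw [single_of_ne_left k h]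
    refine Finset.sum_eq_zero fun γ _ => ?_
    rw [single_of_ne_left k h, map_zero, LinearMap.zero_apply]

/-- The idempotent of a crossingless matching. -/
def idem (β : Matching n) : ArcAlg n k := single k β β 1

lemma idem_apply (β α γ : Matching n) :
    idem k β α γ = if α = γ ∧ γ = β then 1 else 0 := by
  unfold idem
  by_cases h : γ = β
  · subst h
    by_cases h' : α = γ
    · subst h'
      simp
    · rw [single_of_ne_left k h', if_neg fun h => h' h.1]
  · rw [single_of_ne_right k h, if_neg fun h' => h h'.2]

@[simp] lemma idem_self (β : Matching n) : idem k β β β = 1 := by simp [idem_apply]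

lemma arcMul_idem_apply (f : ArcAlg n k) (β α γ : Matching n) :
    arcMul k f (idem k β) α γ = if γ = β then f α γ else 0 := by
  rw [arcMul_apply]
  by_cases h : γ = β
  · subst h
    rw [if_pos rfl, Finset.sum_eq_single γ, idem_self, mul_one']
    · intro δ _ hδ
      rw [idem_apply, if_neg fun h => hδ h.1, map_zero]
    · exact fun h => absurd (Finset.mem_univ _) h
  · rw [if_neg h]
    refine Finset.sum_eq_zero fun δ _ => ?_
    rw [idem_apply, if_neg fun h' => h h'.2, map_zero]

lemma idem_arcMul_apply (f : ArcAlg n k) (β α γ : Matching n) :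
    arcMul k (idem k β) f α γ = if α = β then f α γ else 0 := by
  rw [idem, single_arcMul_apply, one_mul']
  by_cases h : α = β
  · subst h
    simp
  · rw [single_of_ne_left k h, if_neg h]

lemma idem_arcMul_single (δ : Matching n) {α β : Matching n} (f : Hom k α β) :
    arcMul k (idem k δ) (single k α β f) = if α = δ then single k α β f else 0 := by
  funext ζ η
  rw [idem_arcMul_apply]
  by_cases h : ζ = α
  · subst h
    split_ifs <;> rfl
  · rw [single_of_ne_left k h, ite_self]
    split_ifs
    · exact (single_of_ne_left k h _ _ _).symm
    · rfl

lemma single_arcMul_idem {α β : Matching n} (f : Hom k α β) (δ : Matching n) :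
    arcMul k (single k α β f) (idem k δ) = if β = δ then single k α β f else 0 := by
  funext ζ η
  rw [arcMul_idem_apply]
  by_cases h : η = β
  · subst h
    split_ifs <;> rfl
  · rw [single_of_ne_right k h, ite_self]
    split_ifs
    · exact (single_of_ne_right k h _ _ _).symm
    · rfl

lemma sum_single_column (f : ArcAlg n k) (γ : Matching n) :
    ∑ α, single k α γ (f α γ) = arcMul k f (idem k γ) := by
  funext ζ η
  rw [arcMul_idem_apply, Finset.sum_apply, Finset.sum_apply, Finset.sum_eq_single ζ]
  · by_cases h : η = γ
    · subst h
      rw [single_same, if_pos rfl]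
    · rw [single_of_ne_right k h, if_neg h]
  · intro α _ hα
    exact single_of_ne_left k hα.symm _ _ _
  · exact fun h => absurd (Finset.mem_univ _) h

/-- All components of an element of the arc algebra have the same `q`-degree. -/
def ArcDeg (d : ℤ) (f : ArcAlg n k) : Prop := ∀ α β, f α β ∈ Hom.deg k α β d

lemma ArcDeg.mul {d e : ℤ} {f g : ArcAlg n k} (hf : ArcDeg k d f) (hg : ArcDeg k e g) :
    ArcDeg k (d + e) (arcMul k f g) := fun α γ =>
  Submodule.sum_mem _ fun β _ => mul_mem_deg k (hf α β) (hg β γ)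

lemma arcDeg_single {d : ℤ} {α β : Matching n} {f : Hom k α β} (hf : f ∈ Hom.deg k α β d) :
    ArcDeg k d (single k α β f) := by
  intro ζ η
  by_cases h : ζ = α
  · by_cases h' : η = β
    · subst h h'
      rwa [single_same]
    · rw [single_of_ne_right k h']
      exact Submodule.zero_mem _
  · rw [single_of_ne_left k h]
    exact Submodule.zero_mem _

lemma arcDeg_idem (β : Matching n) : ArcDeg k 0 (idem k β) := arcDeg_single k (one_mem_deg k β)

lemma monoCoeff_of_mem_deg {α β : Matching n} {d : ℤ} {f : Hom k α β} (hf : f ∈ Hom.deg k α β d)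
    {S : Finset (Circles α β)} (hS : monoQ S ≠ d) : monoCoeff k S f = 0 := by
  classical
  induction hf using Submodule.span_induction with
  | mem f hf =>
    obtain ⟨T, hT, rfl⟩ := hf
    refine (monoCoeff_mono k S T).trans (if_neg ?_)
    rintro rfl
    exact hS hT
  | zero => exact map_zero _
  | add _ _ _ _ h1 h2 => rw [map_add, h1, h2, add_zero]
  | smul r _ _ h => rw [map_smul, h, smul_zero]

lemma SHom.comp_tmul (β₁ α₁ β₂ α₂ β₃ α₃ : Matching n) (f : Hom k β₁ β₂) (g : Hom k α₂ α₁)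
    (f' : Hom k β₂ β₃) (g' : Hom k α₃ α₂) :
    SHom.comp k β₁ α₁ β₂ α₂ β₃ α₃ (f ⊗ₜ g) (f' ⊗ₜ g') =
      mul k β₁ β₂ β₃ f f' ⊗ₜ mul k α₃ α₂ α₁ g' g := rfl

end TotalAlgebra

/-! ### The normalised bar resolution -/

section Bar

variable (k : Type*) [CommRing k] (n : ℕ)

/-- A graded bimodule over the arc algebra which is a finite direct sum of projectives `e_α H_n`
as a right module: it has generators with left idempotent `out`, right idempotent `inn` and degree
`q`, and `act f y x` is the coefficient at the generator `y` of the left action of `f` on the generator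
`x`. -/
structure Twisted where
  size : ℕ
  out : Fin size → Matching n
  inn : Fin size → Matching n
  q : Fin size → ℤ
  act : ArcAlg n k →ₗ[k] ∀ y x, Hom k (inn y) (inn x)
  act_idem : ∀ β y x, act (idem k β) y x = if y = x ∧ out x = β then 1 else 0
  act_mul : ∀ f g y x, act (arcMul k f g) y x = ∑ z, mul k _ _ _ (act f y z) (act g z x)
  act_deg : ∀ d f, ArcDeg k d f → ∀ y x, act f y x ∈ Hom.deg k _ _ (d + q x - q y)

namespace Twisted

variable {k n} (T : Twisted k n)

lemma act_mul_idem (f : ArcAlg n k) (β : Matching n) (y x : Fin T.size) :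
    T.act (arcMul k f (idem k β)) y x = if T.out x = β then T.act f y x else 0 := by
  rw [T.act_mul, Finset.sum_eq_single x]
  · rw [T.act_idem]
    by_cases h : T.out x = β <;> simp [h]
  · intro z _ hz
    rw [T.act_idem, if_neg fun h => hz h.1, map_zero]
  · exact fun h => absurd (Finset.mem_univ _) h

lemma act_idem_mul (f : ArcAlg n k) (β : Matching n) (y x : Fin T.size) :
    T.act (arcMul k (idem k β) f) y x = if T.out y = β then T.act f y x else 0 := by
  rw [T.act_mul, Finset.sum_eq_single y]
  · rw [T.act_idem]
    by_cases h : T.out y = β <;> simp [h]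
  · intro z _ hz
    rw [T.act_idem, if_neg fun h => hz h.1.symm, map_zero, LinearMap.zero_apply]
  · exact fun h => absurd (Finset.mem_univ _) h

/-- The non-trivial squarefree monomials, i.e. a basis of the positive part of the arc algebra, with
a generator of `T` to the right of them. -/
abbrev BarIndex : Type :=
  Σ p : Matching n × Fin T.size,
    {S : Finset (Circles p.1 (T.out p.2)) // ¬ (p.1 = T.out p.2 ∧ S.card = 0)}

instance : Finite T.BarIndex := inferInstance

/-- The number of generators of the kernel of `H_n ⊗ T → T`. -/
def nextSize : ℕ := Nat.card T.BarIndex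

/-- The enumeration of the generators of the kernel of `H_n ⊗ T → T`. -/
def idx : Fin T.nextSize ≃ T.BarIndex := (Finite.equivFin _).symm

/-- The left idempotent of a non-trivial monomial. -/
def root (i : Fin T.nextSize) : Matching n := (T.idx i).1.1

/-- The generator of `T` to the right of a non-trivial monomial. -/
def base (i : Fin T.nextSize) : Fin T.size := (T.idx i).1.2

/-- The circles which carry an `x` in a non-trivial monomial. -/
def dots (i : Fin T.nextSize) : Finset (Circles (T.root i) (T.out (T.base i))) := (T.idx i).2.1

/-- A non-trivial monomial as an element of the arc algebra. -/
def elt (i : Fin T.nextSize) : ArcAlg n k := single k _ _ (mono k (T.dots i))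

/-- The coefficient of a non-trivial monomial. -/
def coef (i : Fin T.nextSize) : ArcAlg n k →ₗ[k] k where
  toFun f := monoCoeff k (T.dots i) (f (T.root i) (T.out (T.base i)))
  map_add' _ _ := map_add _ _ _
  map_smul' c _ := (monoCoeff k (T.dots i)).map_smul c _

lemma coef_apply (i : Fin T.nextSize) (f : ArcAlg n k) :
    T.coef i f = monoCoeff k (T.dots i) (f (T.root i) (T.out (T.base i))) := rfl

lemma coef_elt {i j : Fin T.nextSize} (hij : T.base i = T.base j) :
    T.coef i (T.elt j) = if i = j then 1 else 0 := by
  classical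
  have key : ∀ a b : T.BarIndex, a.1.2 = b.1.2 →
      monoCoeff k a.2.1 (single k b.1.1 (T.out b.1.2) (mono k b.2.1) a.1.1 (T.out a.1.2)) =
        if a = b then 1 else 0 := by
    rintro ⟨⟨β, x⟩, S, hS⟩ ⟨⟨γ, y⟩, U, hU⟩ h
    obtain rfl : x = y := h
    by_cases h1 : β = γ
    · subst h1
      dsimp only
      rw [single_same, monoCoeff_mono]
      by_cases h2 : S = U
      · subst h2
        simp
      · rw [if_neg h2, if_neg]
        intro h3
        rw [Sigma.mk.injEq, heq_eq_eq] at h3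
        exact h2 (congrArg Subtype.val h3.2)
    · dsimp only
      rw [single_of_ne_left k h1, map_zero, if_neg]
      intro h3
      exact h1 (congrArg (fun a => a.1.1) h3)
  by_cases h : i = j
  · rw [if_pos h]
    exact (key _ _ hij).trans (if_pos (congrArg T.idx h))
  · rw [if_neg h]
    exact (key _ _ hij).trans (if_neg fun h' => h (T.idx.injective h'))

lemma coef_idem (i : Fin T.nextSize) (β : Matching n) : T.coef i (idem k β) = 0 := by
  classical
  rw [coef_apply, idem_apply]
  split_ifs with h
  · rw [← mono_empty, monoCoeff_mono, if_neg]
    exact fun h' => (T.idx i).2.2 ⟨h.1, Finset.card_eq_zero.2 h'⟩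
  · exact map_zero _

lemma coef_mul_idem (i : Fin T.nextSize) (f : ArcAlg n k) :
    T.coef i (arcMul k f (idem k (T.out (T.base i)))) = T.coef i f := by
  rw [coef_apply, arcMul_idem_apply, if_pos rfl, coef_apply]

lemma idem_mul_elt (β : Matching n) (i : Fin T.nextSize) :
    arcMul k (idem k β) (T.elt i) = if T.root i = β then T.elt i else 0 :=
  idem_arcMul_single k _ _

lemma elt_mul_idem (i : Fin T.nextSize) (β : Matching n) :
    arcMul k (T.elt i) (idem k β) = if T.out (T.base i) = β then T.elt i else 0 :=
  single_arcMul_idem k _ _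

/-- Expansion of an element of the arc algebra in squarefree monomials, seen through functions which
vanish at the trivial monomials. -/
lemma sum_coef_smul {V : Type*} [AddCommGroup V] [Module k V]
    (φ : Fin T.size → ArcAlg n k →ₗ[k] V) (hφ : ∀ z, φ z (idem k (T.out z)) = 0) (h : ArcAlg n k) :
    ∑ i, T.coef i h • φ (T.base i) (T.elt i) =
      ∑ z, φ z (arcMul k h (idem k (T.out z))) := by
  classical
  have := fun β z => Fintype.ofFinite (Circles β (T.out z))
  have hF : ∀ p : Matching n × Fin T.size,
      Fintype {S : Finset (Circles p.1 (T.out p.2)) // ¬ (p.1 = T.out p.2 ∧ S.card = 0)} :=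
    fun p => Fintype.ofFinite _
  have h1 : ∑ i, T.coef i h • φ (T.base i) (T.elt i) = ∑ a : T.BarIndex,
      monoCoeff k a.2.1 (h a.1.1 (T.out a.1.2)) •
        φ a.1.2 (single k a.1.1 (T.out a.1.2) (mono k a.2.1)) :=
    T.idx.sum_comp fun a => monoCoeff k a.2.1 (h a.1.1 (T.out a.1.2)) •
        φ a.1.2 (single k a.1.1 (T.out a.1.2) (mono k a.2.1))
  rw [h1, Fintype.sum_sigma, Fintype.sum_prod_type, Finset.sum_comm]
  refine Finset.sum_congr rfl fun z _ => ?_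
  rw [← sum_single_column, map_sum]
  refine Finset.sum_congr rfl fun β _ => ?_
  conv_rhs => rw [← sum_monoCoeff k (h β (T.out z)), map_sum, map_sum]
  simp only [map_smul]
  -- The trivial monomial does not contribute.
  rw [← Finset.sum_filter_of_ne (p := fun S : Finset (Circles β (T.out z)) =>
    ¬ (β = T.out z ∧ S.card = 0))]
  · exact (Finset.sum_subtype _ (fun S => by rw [Finset.mem_filter_univ]) fun S =>
      monoCoeff k S (h β (T.out z)) • φ z (single k β (T.out z) (mono k S))).symm
  · rintro S - hne ⟨hβ, hS⟩
    refine hne ?_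
    clear hne
    subst hβ
    rw [Finset.card_eq_zero.1 hS, mono_empty]
    exact (congrArg _ (hφ z)).trans (smul_zero _)

end Twisted
end Bar

section BarComplex

namespace Twisted

variable {k : Type*} [CommRing k] {n : ℕ} (T : Twisted k n)

/-- The identity matrix on the generators. -/
def delta (y z : Fin T.size) : Hom k (T.inn y) (T.inn z) := if y = z then 1 else 0

@[simp] lemma delta_self (y : Fin T.size) : T.delta y y = 1 := if_pos rfl

lemma delta_of_ne {y z : Fin T.size} (h : y ≠ z) : T.delta y z = 0 := if_neg h

lemma delta_mem_deg (y z : Fin T.size) : T.delta y z ∈ Hom.deg k (T.inn y) (T.inn z) 0 := by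
  by_cases h : y = z
  · subst h
    rw [delta_self]
    exact one_mem_deg k _
  · rw [delta_of_ne T h]
    exact Submodule.zero_mem _

/-- The coefficient at the generator `i` of the kernel of `H_n ⊗ T → T` of the result of the action
of `f` on the element `a ⊗ z - 1 ⊗ a z` of the kernel. Here `b ↦ b ⊗ y - 1 ⊗ b y` vanishes at idempotents
`b`, and one has
`f (a ⊗ z - 1 ⊗ a z) = (f a ⊗ z - 1 ⊗ f a z) - (f ⊗ a z - 1 ⊗ f a z)`. -/
def pairAct (i : Fin T.nextSize) (z : Fin T.size) :
    ArcAlg n k →ₗ[k] ArcAlg n k →ₗ[k] Hom k (T.inn (T.base i)) (T.inn z) :=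
  LinearMap.mk₂ k
    (fun f a => T.coef i (arcMul k f a) • T.delta (T.base i) z - T.coef i f • T.act a (T.base i) z)
    (fun f f' a => by simp only [map_add, LinearMap.add_apply, add_smul]; abel)
    (fun c f a => by
      simp only [map_smul, LinearMap.smul_apply, smul_eq_mul, mul_smul, smul_sub])
    (fun f a a' => by simp only [map_add, Pi.add_apply, add_smul, smul_add]; abel)
    (fun c f a => by
      simp only [map_smul, Pi.smul_apply, smul_eq_mul, mul_smul, smul_sub]
      rw [smul_comm (T.coef i f) c])

lemma pairAct_apply (i : Fin T.nextSize) (z : Fin T.size) (f a : ArcAlg n k) :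
    T.pairAct i z f a =
      T.coef i (arcMul k f a) • T.delta (T.base i) z - T.coef i f • T.act a (T.base i) z := rfl

lemma pairAct_idem (i : Fin T.nextSize) (z : Fin T.size) (f : ArcAlg n k) :
    T.pairAct i z f (idem k (T.out z)) = 0 := by
  rw [pairAct_apply, T.act_idem]
  by_cases h : T.base i = z
  · subst h
    rw [coef_mul_idem]
    simp
  · simp [h, delta_of_ne]

lemma pairAct_mul_idem (i : Fin T.nextSize) (z : Fin T.size) (f a : ArcAlg n k) :
    T.pairAct i z f (arcMul k a (idem k (T.out z))) = T.pairAct i z f a := by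
  rw [pairAct_apply, pairAct_apply, T.act_mul_idem, if_pos rfl, ← arcMul_assoc]
  by_cases h : T.base i = z
  · subst h
    rw [coef_mul_idem]
  · rw [delta_of_ne T h, smul_zero, smul_zero]

lemma sum_pairAct_mul (i : Fin T.nextSize) (x : Fin T.size) (f g a : ArcAlg n k) :
    ∑ z, mul k _ _ _ (T.pairAct i z f (arcMul k g (idem k (T.out z)))) (T.act a z x) =
      T.coef i (arcMul k f g) • T.act a (T.base i) x -
        T.coef i f • T.act (arcMul k g a) (T.base i) x := by
  simp only [pairAct_mul_idem]
  simp only [pairAct_apply, map_sub, LinearMap.sub_apply, Finset.sum_sub_distrib, map_smul,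
    LinearMap.smul_apply]
  rw [Finset.sum_eq_single (T.base i), T.act_mul, Finset.smul_sum, delta_self, one_mul']
  · intro z _ hz
    rw [delta_of_ne T hz.symm, map_zero, LinearMap.zero_apply, smul_zero]
  · exact fun h => absurd (Finset.mem_univ _) h

lemma pairAct_mul (i : Fin T.nextSize) (x : Fin T.size) (f g a : ArcAlg n k)
    (ha : arcMul k a (idem k (T.out x)) = a) :
    T.pairAct i x (arcMul k f g) a =
      ∑ j, mul k _ _ _ (T.pairAct i (T.base j) f (T.elt j)) (T.pairAct j x g a) := by
  let φ₁ : Fin T.size → ArcAlg n k →ₗ[k] Hom k (T.inn (T.base i)) (T.inn x) := fun z =>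
    ((mul k (T.inn (T.base i)) (T.inn z) (T.inn x)).flip (T.delta z x)).comp (T.pairAct i z f)
  let φ₂ : Fin T.size → ArcAlg n k →ₗ[k] Hom k (T.inn (T.base i)) (T.inn x) := fun z =>
    ((mul k (T.inn (T.base i)) (T.inn z) (T.inn x)).flip (T.act a z x)).comp (T.pairAct i z f)
  have h₁ := T.sum_coef_smul φ₁ (fun z => by
    simp only [φ₁, LinearMap.comp_apply, pairAct_idem, map_zero]) (arcMul k g a)
  have h₂ := T.sum_coef_smul φ₂ (fun z => by
    simp only [φ₂, LinearMap.comp_apply, pairAct_idem, map_zero]) g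
  have h₃ : ∀ j, mul k _ _ _ (T.pairAct i (T.base j) f (T.elt j)) (T.pairAct j x g a) =
      T.coef j (arcMul k g a) • φ₁ (T.base j) (T.elt j) -
        T.coef j g • φ₂ (T.base j) (T.elt j) := fun j => by
    rw [T.pairAct_apply j, map_sub, map_smul, map_smul]
    rfl
  simp only [h₃, Finset.sum_sub_distrib, h₁, h₂]
  have h₄ : ∑ z, φ₂ z (arcMul k g (idem k (T.out z))) = _ := T.sum_pairAct_mul i x f g a
  rw [h₄, Finset.sum_eq_single x]
  · have h₅ : φ₁ x (arcMul k (arcMul k g a) (idem k (T.out x))) =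
        T.pairAct i x f (arcMul k g a) := by
      rw [arcMul_assoc, ha]
      simp only [φ₁, LinearMap.comp_apply, LinearMap.flip_apply, delta_self, mul_one']
    rw [h₅, pairAct_apply, pairAct_apply, arcMul_assoc]
    abel
  · intro z _ hz
    simp only [φ₁, LinearMap.comp_apply, delta_of_ne T hz, map_zero, LinearMap.zero_apply]
  · exact fun h => absurd (Finset.mem_univ _) h

lemma elt_mul_idem_self (i : Fin T.nextSize) :
    arcMul k (T.elt i) (idem k (T.out (T.base i))) = T.elt i := by
  rw [elt_mul_idem, if_pos rfl]

lemma elt_deg (i : Fin T.nextSize) : ArcDeg k (monoQ (T.dots i)) (T.elt i) :=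
  arcDeg_single k (mono_mem_deg k _)

/-- The kernel of the multiplication `H_n ⊗ T → T`, in which the tensor product is over the span of the
idempotents. It has the right basis `a ⊗ x - 1 ⊗ a x` for non-trivial monomials `a`. -/
@[reducible] def next : Twisted k n where
  size := T.nextSize
  out := T.root
  inn i := T.inn (T.base i)
  q i := T.q (T.base i) + monoQ (T.dots i)
  act := LinearMap.pi fun i => LinearMap.pi fun j => (T.pairAct i (T.base j)).flip (T.elt j)
  act_idem β i j := by
    change T.pairAct i (T.base j) (idem k β) (T.elt j) = _
    rw [pairAct_apply, coef_idem, zero_smul, sub_zero, idem_mul_elt]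
    by_cases h : T.base i = T.base j
    · by_cases hβ : T.root j = β
      · rw [if_pos hβ, coef_elt T h]
        by_cases hij : i = j
        · subst hij
          simp [hβ]
        · simp [hij]
      · simp [hβ]
    · have hij : i ≠ j := fun h' => h (congrArg _ h')
      simp [hij, delta_of_ne T h]
  act_mul f g i j := T.pairAct_mul i (T.base j) f g (T.elt j) (T.elt_mul_idem_self j)
  act_deg d f hf i j := by
    change T.pairAct i (T.base j) f (T.elt j) ∈ _
    rw [pairAct_apply]
    refine Submodule.sub_mem _ ?_ ?_
    · by_cases h : T.base i = T.base j
      · by_cases hd : monoQ (T.dots i) = d + monoQ (T.dots j)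
        · refine Submodule.smul_mem _ _ ?_
          have := T.delta_mem_deg (T.base i) (T.base j)
          rwa [show d + (T.q (T.base j) + monoQ (T.dots j)) -
            (T.q (T.base i) + monoQ (T.dots i)) = 0 by rw [hd, congrArg T.q h]; ring]
        · rw [coef_apply, monoCoeff_of_mem_deg k ((hf.mul k (T.elt_deg j)) _ _) hd, zero_smul]
          exact Submodule.zero_mem _
      · rw [delta_of_ne T h, smul_zero]
        exact Submodule.zero_mem _
    · by_cases hd : monoQ (T.dots i) = d
      · refine Submodule.smul_mem _ _ ?_
        have := T.act_deg _ _ (T.elt_deg j) (T.base i) (T.base j)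
        rwa [show d + (T.q (T.base j) + monoQ (T.dots j)) -
          (T.q (T.base i) + monoQ (T.dots i)) =
          monoQ (T.dots j) + T.q (T.base j) - T.q (T.base i) by rw [hd]; ring]
      · rw [coef_apply, monoCoeff_of_mem_deg k (hf _ _) hd, zero_smul]
        exact Submodule.zero_mem _

variable (k n) in
/-- The enumeration of the crossingless matchings. -/
def matchingIdx : Fin (Fintype.card (Matching n)) ≃ Matching n := (Fintype.equivFin _).symm

variable (k n) in
/-- The arc algebra as a bimodule over itself, with the idempotents as right generators. -/
@[reducible] def regular : Twisted k n where
  size := Fintype.card (Matching n)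
  out := matchingIdx n
  inn := matchingIdx n
  q _ := n
  act := LinearMap.pi fun y => LinearMap.pi fun x =>
    (LinearMap.proj (matchingIdx n x)).comp
      (LinearMap.proj (φ := fun α => ∀ β, Hom k α β) (matchingIdx n y))
  act_idem β y x := by
    change idem k β (matchingIdx n y) (matchingIdx n x) = _
    rw [idem_apply]
    simp
  act_mul f g y x := by
    change arcMul k f g (matchingIdx n y) (matchingIdx n x) = _
    rw [arcMul_apply, ← (matchingIdx n).sum_comp]
    rfl
  act_deg d f hf y x := by
    have := hf (matchingIdx n y) (matchingIdx n x)
    rwa [add_sub_cancel_right]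

/-! ### The differential and the contracting homotopy -/

/-- The component `e_β (H_n ⊗ T) e_α` of the projective bimodule with the generators of `T`. -/
abbrev Mod (β α : Matching n) : Type _ := ∀ x : Fin T.size, SHom k β α (T.out x) (T.inn x)

/-- The matrix of the inclusion of the kernel of `H_n ⊗ T → T` in `H_n ⊗ T`. -/
def dEntry (i : Fin T.nextSize) (t : Fin T.size) :
    SHom k (T.root i) (T.inn (T.base i)) (T.out t) (T.inn t) :=
  T.elt i (T.root i) (T.out t) ⊗ₜ T.delta t (T.base i) -
    idem k (T.root i) (T.root i) (T.out t) ⊗ₜ T.act (T.elt i) t (T.base i)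

lemma tmul_mem_deg {β₁ α₁ β₂ α₂ : Matching n} {d e : ℤ} {f : Hom k β₁ β₂} {g : Hom k α₂ α₁}
    (hf : f ∈ Hom.deg k β₁ β₂ d) (hg : g ∈ Hom.deg k α₂ α₁ e) :
    f ⊗ₜ g ∈ SHom.deg k β₁ α₁ β₂ α₂ (d + e) ((d + e : ℤ) : ZMod 2) :=
  Submodule.subset_span ⟨d, e, f, g, hf, hg, rfl, rfl, rfl⟩

lemma dEntry_mem_deg (i : Fin T.nextSize) (t : Fin T.size) :
    T.dEntry i t ∈ SHom.deg k (T.root i) (T.inn (T.base i)) (T.out t) (T.inn t)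
      (T.next.q i - T.q t) ((T.next.q i - T.q t : ℤ) : ZMod 2) := by
  have hq : T.next.q i = T.q (T.base i) + monoQ (T.dots i) := rfl
  refine Submodule.sub_mem _ ?_ ?_
  · by_cases h : t = T.base i
    · have h1 := tmul_mem_deg (T.elt_deg i (T.root i) (T.out t)) (T.delta_mem_deg t (T.base i))
      rwa [show monoQ (T.dots i) + 0 = T.next.q i - T.q t by rw [hq, h]; ring] at h1
    · rw [delta_of_ne T h, TensorProduct.tmul_zero]
      exact Submodule.zero_mem _
  · have h1 := tmul_mem_deg (arcDeg_idem k (T.root i) (T.root i) (T.out t))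
      (T.act_deg _ _ (T.elt_deg i) t (T.base i))
    rwa [show 0 + (monoQ (T.dots i) + T.q (T.base i) - T.q t) = T.next.q i - T.q t by
      rw [hq]; ring] at h1

/-- The map of bimodules given by `dEntry`. -/
def diff (β α : Matching n) : T.next.Mod β α →ₗ[k] T.Mod β α :=
  LinearMap.pi fun t => ∑ i : Fin T.nextSize,
    ((SHom.comp k β α _ _ _ _).flip (T.dEntry i t)).comp (LinearMap.proj i)

lemma diff_apply (β α : Matching n) (y : T.next.Mod β α) (t : Fin T.size) :
    T.diff β α y t = ∑ i : Fin T.nextSize, SHom.comp k β α _ _ _ _ (y i) (T.dEntry i t) := by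
  simp [diff]

/-- The coefficient of a non-trivial monomial, times an idempotent. -/
def coefIdem (β : Matching n) (i : Fin T.nextSize) :
    Hom k β (T.out (T.base i)) →ₗ[k] Hom k β (T.root i) :=
  ((T.coef i).comp (single k β (T.out (T.base i)))).smulRight (idem k β β (T.root i))

/-- A component of the homotopy. -/
def homotopyAt (β α : Matching n) (i : Fin T.nextSize) :
    SHom k β α (T.out (T.base i)) (T.inn (T.base i)) →ₗ[k]
      SHom k β α (T.root i) (T.inn (T.base i)) :=
  LinearMap.rTensor (Hom k (T.inn (T.base i)) α) (T.coefIdem β i)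

/-- The homotopy `f ⊗ g x ↦ 1 ⊗ [f] ⊗ g x`. -/
def homotopy (β α : Matching n) : T.Mod β α →ₗ[k] T.next.Mod β α :=
  LinearMap.pi fun i => (T.homotopyAt β α i).comp (LinearMap.proj (T.base i))

lemma homotopy_apply (β α : Matching n) (y : T.Mod β α) (i : Fin T.nextSize) :
    T.homotopy β α y i = T.homotopyAt β α i (y (T.base i)) := rfl

/-- A component of the map `f ⊗ g x ↦ 1 ⊗ f g x`. -/
def absorbAt (β α : Matching n) (t x : Fin T.size) :
    SHom k β α (T.out x) (T.inn x) →ₗ[k] SHom k β α (T.out t) (T.inn t) :=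
  TensorProduct.lift (((mul k (T.inn t) (T.inn x) α).comp
    ((LinearMap.proj x).comp ((LinearMap.proj (φ := fun y => ∀ x, Hom k (T.inn y) (T.inn x)) t).comp
      (T.act.comp (single k β (T.out x)))))).compr₂
      (TensorProduct.mk k (Hom k β (T.out t)) (Hom k (T.inn t) α) (idem k β β (T.out t))))

lemma absorbAt_tmul (β α : Matching n) (t x : Fin T.size) (f : Hom k β (T.out x))
    (g : Hom k (T.inn x) α) : T.absorbAt β α t x (f ⊗ₜ g) =
      idem k β β (T.out t) ⊗ₜ mul k _ _ _ (T.act (single k β (T.out x) f) t x) g := rfl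

/-- The map `f ⊗ g x ↦ 1 ⊗ f g x`. -/
def absorb (β α : Matching n) : T.Mod β α →ₗ[k] T.Mod β α :=
  LinearMap.pi fun t => ∑ x, (T.absorbAt β α t x).comp (LinearMap.proj x)

lemma absorb_apply (β α : Matching n) (y : T.Mod β α) (t : Fin T.size) :
    T.absorb β α y t = ∑ x, T.absorbAt β α t x (y x) := by
  simp [absorb]

/-- A generator of the chain module. -/
def pure {β α : Matching n} (x : Fin T.size) (f : Hom k β (T.out x)) (g : Hom k (T.inn x) α) :
    T.Mod β α := Pi.single x (f ⊗ₜ g)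

lemma mod_ext {V : Type*} [AddCommMonoid V] [Module k V] {β α : Matching n}
    {φ ψ : T.Mod β α →ₗ[k] V} (h : ∀ x f g, φ (T.pure x f g) = ψ (T.pure x f g)) : φ = ψ :=
  LinearMap.pi_ext' fun x => TensorProduct.ext' fun f g => h x f g

lemma pure_of_ne {β α : Matching n} {x t : Fin T.size} (h : t ≠ x) (f : Hom k β (T.out x))
    (g : Hom k (T.inn x) α) : T.pure x f g t = 0 := Pi.single_eq_of_ne h _

lemma pure_self {β α : Matching n} (x : Fin T.size) (f : Hom k β (T.out x))
    (g : Hom k (T.inn x) α) : T.pure x f g x = f ⊗ₜ g := Pi.single_eq_same _ _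

lemma homotopy_pure {β α : Matching n} (x : Fin T.size) (f : Hom k β (T.out x))
    (g : Hom k (T.inn x) α) (i : Fin T.nextSize) :
    T.homotopy β α (T.pure x f g) i =
      T.coef i (single k β (T.out x) f) • (idem k β β (T.root i) ⊗ₜ[k]
        (Pi.single x g : ∀ z, Hom k (T.inn z) α) (T.base i)) := by
  rw [homotopy_apply]
  by_cases h : T.base i = x
  · subst h
    rw [pure_self, Pi.single_eq_same]
    rfl
  · rw [pure_of_ne T h, Pi.single_eq_of_ne h, TensorProduct.tmul_zero, smul_zero, map_zero]

lemma absorb_pure {β α : Matching n} (x : Fin T.size) (f : Hom k β (T.out x))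
    (g : Hom k (T.inn x) α) (t : Fin T.size) :
    T.absorb β α (T.pure x f g) t =
      idem k β β (T.out t) ⊗ₜ mul k _ _ _ (T.act (single k β (T.out x) f) t x) g := by
  rw [absorb_apply, Finset.sum_eq_single x]
  · rw [pure_self, absorbAt_tmul]
  · intro z _ hz
    rw [pure_of_ne T hz, map_zero]
  · exact fun h => absurd (Finset.mem_univ _) h

/-- The element `a ⊗ g - 1 ⊗ a g`. -/
def expand (β : Matching n) {α : Matching n} (z t : Fin T.size) (g : Hom k (T.inn z) α) :
    ArcAlg n k →ₗ[k] SHom k β α (T.out t) (T.inn t) where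
  toFun a := a β (T.out t) ⊗ₜ mul k _ _ _ (T.delta t z) g -
    idem k β β (T.out t) ⊗ₜ mul k _ _ _ (T.act a t z) g
  map_add' a b := by
    simp only [Pi.add_apply, map_add, LinearMap.add_apply, TensorProduct.tmul_add,
      TensorProduct.add_tmul]
    abel
  map_smul' c a := by
    simp only [Pi.smul_apply, map_smul, LinearMap.smul_apply, TensorProduct.tmul_smul,
      ← TensorProduct.smul_tmul', smul_sub, RingHom.id_apply]

lemma expand_apply (β : Matching n) {α : Matching n} (z t : Fin T.size) (g : Hom k (T.inn z) α)
    (a : ArcAlg n k) : T.expand β z t g a = a β (T.out t) ⊗ₜ mul k _ _ _ (T.delta t z) g -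
    idem k β β (T.out t) ⊗ₜ mul k _ _ _ (T.act a t z) g := rfl

lemma expand_idem (β : Matching n) {α : Matching n} (z t : Fin T.size) (g : Hom k (T.inn z) α) :
    T.expand β z t g (idem k (T.out z)) = 0 := by
  rw [expand_apply, T.act_idem]
  by_cases h : t = z
  · subst h
    rw [if_pos (⟨rfl, rfl⟩ : t = t ∧ T.out t = T.out t), idem_apply, idem_apply, delta_self, sub_eq_zero]
    congr 1
    refine if_congr ?_ rfl rfl
    constructor <;> rintro ⟨h, -⟩
    exacts [⟨h, h.symm⟩, ⟨h, rfl⟩]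
  · rw [delta_of_ne T h, if_neg fun h' => h h'.1]
    simp

/-- The differential on the element `1 ⊗ [a] ⊗ g`. -/
lemma comp_dEntry (β : Matching n) {α : Matching n} (i : Fin T.nextSize) (t : Fin T.size)
    (g : Hom k (T.inn (T.base i)) α) :
    SHom.comp k β α _ _ _ _ (idem k β β (T.root i) ⊗ₜ g) (T.dEntry i t) =
      T.expand β (T.base i) t g (T.elt i) := by
  rw [dEntry, map_sub, SHom.comp_tmul, SHom.comp_tmul, expand_apply]
  by_cases h : β = T.root i
  · subst h
    simp
  · have h1 : idem k β β (T.root i) = 0 := by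
      rw [idem_apply, if_neg fun h' => h h'.1]
    have h2 : T.elt i β (T.out t) = 0 := single_of_ne_left k h _ _ _
    rw [h1, h2]
    by_cases h3 : T.out t = β
    · have h4 : T.act (T.elt i) t (T.base i) = 0 := by
        have := T.act_idem_mul (T.elt i) (T.root i) t (T.base i)
        rw [idem_mul_elt, if_pos rfl] at this
        rw [this, if_neg]
        rw [h3]
        exact h
      rw [h4]
      simp
    · have h5 : idem k β β (T.out t) = 0 := by
        rw [idem_apply, if_neg fun h' => h3 h'.2]
      rw [h5]
      simp

/-- The composition of the homotopy with the differential. -/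
lemma diff_comp_homotopy (β α : Matching n) :
    (T.diff β α).comp (T.homotopy β α) + T.absorb β α = LinearMap.id := by
  refine T.mod_ext (V := T.Mod β α) fun x f g => ?_
  funext t
  rw [LinearMap.add_apply, LinearMap.comp_apply, LinearMap.id_apply, Pi.add_apply, diff_apply,
    absorb_pure, ← eq_sub_iff_add_eq]
  let φ : Fin T.size → ArcAlg n k →ₗ[k] SHom k β α (T.out t) (T.inn t) := fun z =>
    T.expand β z t ((Pi.single x g : ∀ z, Hom k (T.inn z) α) z)
  have h := T.sum_coef_smul φ (fun z => T.expand_idem _ _ _ _) (single k β (T.out x) f)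
  have h1 : ∀ i, SHom.comp k β α _ _ _ _ (T.homotopy β α (T.pure x f g) i) (T.dEntry i t) =
      T.coef i (single k β (T.out x) f) • φ (T.base i) (T.elt i) := fun i => by
    rw [homotopy_pure, map_smul, LinearMap.smul_apply, comp_dEntry]
  rw [Finset.sum_congr rfl fun i _ => h1 i, h, Finset.sum_eq_single x]
  · simp only [φ, Pi.single_eq_same]
    rw [single_arcMul_idem, if_pos rfl, expand_apply]
    congr 1
    by_cases hx : t = x
    · subst hx
      rw [pure_self, delta_self, one_mul', single_same]
    · rw [pure_of_ne T hx, delta_of_ne T hx, map_zero, LinearMap.zero_apply, TensorProduct.tmul_zero]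
  · intro z _ hz
    simp only [φ, expand_apply, Pi.single_eq_of_ne hz, map_zero, TensorProduct.tmul_zero, sub_zero]
  · exact fun h => absurd (Finset.mem_univ _) h

lemma diff_pure {β α : Matching n} (i : Fin T.next.size) (f : Hom k β (T.next.out i))
    (g : Hom k (T.next.inn i) α) (t : Fin T.size) : T.diff β α (T.next.pure i f g) t =
      mul k β (T.root i) (T.out t) f (T.elt i (T.root i) (T.out t)) ⊗ₜ[k]
        mul k (T.inn t) (T.inn (T.base i)) α (T.delta t (T.base i)) g -
      mul k β (T.root i) (T.out t) f (idem k (T.root i) (T.root i) (T.out t)) ⊗ₜ[k]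
        mul k (T.inn t) (T.inn (T.base i)) α (T.act (T.elt i) t (T.base i)) g := by
  rw [diff_apply, Finset.sum_eq_single i]
  · rw [pure_self, dEntry, map_sub]
    rfl
  · intro z _ hz
    rw [pure_of_ne _ hz, map_zero, LinearMap.zero_apply]
  · exact fun h => absurd (Finset.mem_univ _) h

/-- The composition of the differential with the homotopy. -/
lemma homotopy_comp_diff (β α : Matching n) :
    (T.homotopy β α).comp (T.diff β α) = T.next.absorb β α := by
  refine T.next.mod_ext (V := T.next.Mod β α) fun i f g => ?_
  funext j
  rw [absorb_pure, LinearMap.comp_apply, homotopy_apply, diff_pure, map_sub]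
  let f₁ := mul k β (T.root i) (T.out (T.base j)) f (T.elt i (T.root i) (T.out (T.base j)))
  let f₂ := mul k β (T.root i) (T.out (T.base j)) f
    (idem k (T.root i) (T.root i) (T.out (T.base j)))
  change (T.coef j (single k β _ f₁) • idem k β β (T.root j)) ⊗ₜ[k]
      mul k (T.inn (T.base j)) (T.inn (T.base i)) α (T.delta (T.base j) (T.base i)) g -
    (T.coef j (single k β _ f₂) • idem k β β (T.root j)) ⊗ₜ[k]
      mul k (T.inn (T.base j)) (T.inn (T.base i)) α (T.act (T.elt i) (T.base j) (T.base i)) g =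
    idem k β β (T.root j) ⊗ₜ[k] mul k (T.inn (T.base j)) (T.inn (T.base i)) α
      (T.pairAct j (T.base i) (single k β (T.root i) f) (T.elt i)) g
  have h1 : T.coef j (arcMul k (single k β (T.root i) f) (T.elt i)) =
      T.coef j (single k β _ f₁) := by
    rw [coef_apply, single_arcMul_apply, coef_apply]
  have h2 : T.coef j (single k β (T.root i) f) = T.coef j (single k β _ f₂) := by
    rw [coef_apply, coef_apply, ← single_arcMul_apply, single_arcMul_idem, if_pos rfl]
  rw [pairAct_apply, h1, h2]
  simp only [map_sub, map_smul, LinearMap.sub_apply, LinearMap.smul_apply, TensorProduct.tmul_sub,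
    TensorProduct.tmul_smul, TensorProduct.smul_tmul']

lemma diff_homotopy_add (β α : Matching n) (y : T.next.Mod β α) :
    T.next.diff β α (T.next.homotopy β α y) + T.homotopy β α (T.diff β α y) = y := by
  have h1 := LinearMap.congr_fun (T.next.diff_comp_homotopy β α) y
  have h2 := LinearMap.congr_fun (T.homotopy_comp_diff β α) y
  rw [LinearMap.add_apply, LinearMap.comp_apply, LinearMap.id_apply] at h1
  rw [LinearMap.comp_apply] at h2
  rw [h2]
  exact h1

lemma act_single_mul {α β : Matching n} (f : Hom k α β) (a : ArcAlg n k) (t x : Fin T.size) :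
    T.act (single k α (T.out x) (mul k α β (T.out x) f (a β (T.out x)))) t x =
      T.act (arcMul k (single k α β f) a) t x := by
  have h : single k α (T.out x) (mul k α β (T.out x) f (a β (T.out x))) =
      arcMul k (arcMul k (single k α β f) a) (idem k (T.out x)) := by
    funext δ ε
    rw [arcMul_idem_apply, single_arcMul_apply]
    by_cases h : ε = T.out x
    · rw [if_pos h, h]
    · rw [if_neg h, single_of_ne_right k h]
  rw [h, act_mul_idem, if_pos rfl]

/-- `H_n ⊗ T → T` vanishes on its kernel. -/
lemma absorb_diff (β α : Matching n) (y : T.next.Mod β α) :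
    T.absorb β α (T.diff β α y) = 0 := by
  have : (T.absorb β α).comp (T.diff β α) = 0 := by
    refine T.next.mod_ext (V := T.Mod β α) fun i f g => ?_
    funext t
    rw [LinearMap.comp_apply, absorb_apply]
    simp only [diff_pure, map_sub, absorbAt_tmul, act_single_mul, single_arcMul_idem, if_true,
      Finset.sum_sub_distrib, ← TensorProduct.tmul_sum, ← mul_assoc']
    rw [Finset.sum_eq_single (T.base i), delta_self, mul_one', T.act_mul, map_sum,
      LinearMap.sum_apply]
    · exact sub_self _
    · intro z _ hz
      rw [delta_of_ne T hz, map_zero, map_zero, LinearMap.zero_apply]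
    · exact fun h => absurd (Finset.mem_univ _) h
  exact LinearMap.congr_fun this y

lemma diff_diff (β α : Matching n) (y : T.next.next.Mod β α) :
    T.diff β α (T.next.diff β α y) = 0 := by
  have h1 := LinearMap.congr_fun (T.homotopy_comp_diff β α) (T.next.diff β α y)
  rw [absorb_diff, LinearMap.comp_apply] at h1
  have h2 := LinearMap.congr_fun (T.diff_comp_homotopy β α) (T.diff β α (T.next.diff β α y))
  rw [LinearMap.add_apply, LinearMap.comp_apply, h1, absorb_diff, LinearMap.map_zero, add_zero] at h2
  exact h2.symm

/-- The augmentation `f ⊗ g ↦ f g` on one summand. -/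
def augAt (β α : Matching n) (x : Fin (regular k n).size) :
    SHom k β α ((regular k n).out x) ((regular k n).inn x) →ₗ[k] Hom k β α :=
  TensorProduct.lift (mul k β ((regular k n).out x) α)

/-- The augmentation `f ⊗ g ↦ f g`. -/
def aug (β α : Matching n) : (regular k n).Mod β α →ₗ[k] Hom k β α :=
  ∑ x, (augAt β α x).comp (LinearMap.proj x)

lemma aug_apply {β α : Matching n} (y : (regular k n).Mod β α) :
    aug β α y = ∑ x, augAt β α x (y x) := by
  rw [aug, LinearMap.sum_apply]
  rfl

lemma aug_pure {β α : Matching n} (x : Fin (regular k n).size)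
    (f : Hom k β ((regular k n).out x)) (g : Hom k ((regular k n).inn x) α) :
    aug β α ((regular k n).pure x f g) = mul k β ((regular k n).out x) α f g := by
  rw [aug_apply, Finset.sum_eq_single x]
  · rw [pure_self]
    rfl
  · intro z _ hz
    rw [pure_of_ne _ hz, map_zero]
  · exact fun h => absurd (Finset.mem_univ _) h

/-- The section `f ↦ 1 ⊗ f` of the augmentation. -/
def coaug (β α : Matching n) : Hom k β α →ₗ[k] (regular k n).Mod β α :=
  LinearMap.pi fun x => (TensorProduct.mk k _ _ (idem k β β ((regular k n).out x))).comp
    ((LinearMap.proj α).comp ((LinearMap.proj (φ := fun y => ∀ x, Hom k y x)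
      ((regular k n).inn x)).comp (single k β α)))

lemma coaug_apply (β α : Matching n) (f : Hom k β α) (x : Fin (regular k n).size) :
    coaug β α f x = idem k β β ((regular k n).out x) ⊗ₜ
      single k β α f ((regular k n).inn x) α := rfl

lemma aug_coaug (β α : Matching n) (f : Hom k β α) : aug β α (coaug β α f) = f := by
  have : aug β α (coaug β α f) = arcMul k (idem k β) (single k β α f) β α := by
    rw [aug_apply, arcMul_apply, ← (matchingIdx n).sum_comp]
    rfl
  rw [this, idem_arcMul_single, if_pos rfl, single_same]

lemma coaug_comp_aug (β α : Matching n) :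
    (coaug β α).comp (aug β α) = (regular k n).absorb β α := by
  refine (regular k n).mod_ext (V := (regular k n).Mod β α) fun x f g => ?_
  funext t
  rw [LinearMap.comp_apply, aug_pure, absorb_pure, coaug_apply]
  congr 1
  change single k β α (mul k β (matchingIdx n x) α f g) (matchingIdx n t) α =
    mul k (matchingIdx n t) (matchingIdx n x) α
      (single k β (matchingIdx n x) f (matchingIdx n t) (matchingIdx n x)) g
  by_cases h : matchingIdx n t = β
  · subst h
    rw [single_same]
    exact congrArg (fun f => mul k _ _ α f g) (single_same k _ _ _).symm
  · rw [single_of_ne_left k h]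
    have := single_of_ne_left k h (matchingIdx n x) (matchingIdx n x) f
    rw [this, map_zero, LinearMap.zero_apply]

lemma diff_homotopy_add_coaug (β α : Matching n) (y : (regular k n).Mod β α) :
    (regular k n).diff β α ((regular k n).homotopy β α y) + coaug β α (aug β α y) = y := by
  have h1 := LinearMap.congr_fun ((regular k n).diff_comp_homotopy β α) y
  rw [← coaug_comp_aug] at h1
  exact h1

lemma aug_diff (β α : Matching n) (y : (regular k n).next.Mod β α) :
    aug β α ((regular k n).diff β α y) = 0 := by
  have h := LinearMap.congr_fun (coaug_comp_aug β α) ((regular k n).diff β α y)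
  rw [absorb_diff, LinearMap.comp_apply] at h
  rw [← aug_coaug β α (aug β α ((regular k n).diff β α y)), h, map_zero]

end Twisted
end BarComplex

/-! ### The complex of split tangles of the bar resolution -/

section BarResolution

variable (k : Type*) [CommRing k] (n : ℕ)

open Twisted

/-- The iterated kernels of the normalised bar resolution. -/
def bar : ℕ → Twisted k n
  | 0 => regular k n
  | m + 1 => (bar m).next

/-- The bimodule without generators. -/
def noGenerators : Twisted k n where
  size := 0
  out x := x.elim0
  inn x := x.elim0
  q x := x.elim0
  act := 0
  act_idem _ _ x := x.elim0
  act_mul _ _ _ x := x.elim0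
  act_deg _ _ _ _ x := x.elim0

/-- The bimodule whose generators give the chain bimodule in a homological degree. -/
def chain : ℤ → Twisted k n
  | Int.ofNat 0 => regular k n
  | Int.ofNat (_ + 1) => noGenerators k n
  | Int.negSucc m => bar k n (m + 1)

lemma chain_of_pos {i : ℤ} (hi : 0 < i) : chain k n i = noGenerators k n := by
  obtain ⟨m, rfl⟩ : ∃ m : ℕ, i = Int.ofNat (m + 1) :=
    ⟨(i - 1).toNat, by simp only [Int.ofNat_eq_natCast]; omega⟩
  rfl

lemma chain_pred {i j : ℤ} (h : i + 1 = j) (hj : j ≤ 0) : chain k n i = (chain k n j).next := by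
  obtain ⟨m, rfl⟩ : ∃ m : ℕ, i = Int.negSucc m := ⟨(-i - 1).toNat, by omega⟩
  cases m with
  | zero =>
    obtain rfl : j = Int.ofNat 0 := by simp only [Int.ofNat_eq_natCast]; omega
    rfl
  | succ m =>
    obtain rfl : j = Int.negSucc m := by omega
    rfl

lemma le_bar_q (m : ℕ) (s : Fin (bar k n m).size) : (m : ℤ) ≤ (bar k n m).q s := by
  induction m with
  | zero => exact Int.natCast_nonneg n
  | succ m ih =>
    have h1 := ih ((bar k n m).base s)
    have h2 : 1 ≤ monoQ ((bar k n m).dots s) := one_le_monoQ ((bar k n m).idx s).2.2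
    have h3 : (bar k n (m + 1)).q s = (bar k n m).q ((bar k n m).base s) +
      monoQ ((bar k n m).dots s) := rfl
    rw [h3]
    push_cast
    omega

variable {k n}

open Classical in
/-- The matrix of the differential between two bimodules, the first of which is the kernel of the
second. -/
def matrixOf (S T : Twisted k n) : ∀ (s : Fin S.size) (t : Fin T.size),
    SHom k (S.out s) (S.inn s) (T.out t) (T.inn t) :=
  if h : S = T.next then by subst h; exact T.dEntry else 0

lemma matrixOf_next (T : Twisted k n) : matrixOf T.next T = T.dEntry := dif_pos rfl

/-- The map of bimodules with the matrix `matrixOf`. -/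
def mapOf (S T : Twisted k n) (β α : Matching n) : S.Mod β α →ₗ[k] T.Mod β α :=
  LinearMap.pi fun t => ∑ s : Fin S.size,
    ((SHom.comp k β α _ _ _ _).flip (matrixOf S T s t)).comp (LinearMap.proj s)

lemma mapOf_next (T : Twisted k n) (β α : Matching n) : mapOf T.next T β α = T.diff β α := by
  rw [mapOf, matrixOf_next]
  rfl

lemma matrixOf_mem_deg {S T : Twisted k n} (h : S = T.next) (s : Fin S.size) (t : Fin T.size) :
    matrixOf S T s t ∈ SHom.deg k (S.out s) (S.inn s) (T.out t) (T.inn t)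
      (S.q s - T.q t) ((S.q s : ZMod 2) - (T.q t : ZMod 2)) := by
  subst h
  rw [matrixOf_next, ← Int.cast_sub]
  exact T.dEntry_mem_deg s t

lemma SHom.one_comp (β α β' α' : Matching n) (h : SHom k β α β' α') :
    SHom.comp k β α β α β' α' ((1 : Hom k β β) ⊗ₜ[k] (1 : Hom k α α)) h = h := by
  induction h using TensorProduct.induction_on with
  | zero => exact map_zero _
  | tmul f g => rw [SHom.comp_tmul, one_mul', mul_one']
  | add x y hx hy => rw [map_add, hx, hy]

lemma matrixOf_comp {S T U : Twisted k n} (h : S = T.next) (h' : T = U.next) (s : Fin S.size)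
    (u : Fin U.size) :
    ∑ t, SHom.comp k _ _ _ _ _ _ (matrixOf S T s t) (matrixOf T U t u) = 0 := by
  subst h'
  subst h
  rw [matrixOf_next, matrixOf_next]
  -- The sum is the image of the generator `s` under the square of the differential.
  let y := U.next.next.pure (β := U.next.next.out s) (α := U.next.next.inn s) s 1 1
  have h1 := congrFun (U.diff_diff _ _ y) u
  have h2 : ∀ t, U.next.diff _ _ y t = U.next.dEntry s t := fun t => by
    rw [diff_apply, Finset.sum_eq_single s]
    · simp only [y, pure_self]
      exact SHom.one_comp _ _ _ _ _
    · intro z _ hz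
      simp only [y, pure_of_ne _ hz, map_zero, LinearMap.zero_apply]
    · exact fun h => absurd (Finset.mem_univ _) h
  rw [diff_apply] at h1
  simp only [h2] at h1
  exact h1

lemma exact_mapOf {S T U : Twisted k n} (h : S = T.next) (h' : T = U.next) (β α : Matching n) :
    Function.Exact (mapOf S T β α) (mapOf T U β α) := by
  subst h'
  subst h
  rw [mapOf_next, mapOf_next]
  intro y
  constructor
  · intro hy
    have := U.diff_homotopy_add β α y
    rw [hy, LinearMap.map_zero, add_zero] at this
    exact ⟨_, this⟩
  · rintro ⟨z, rfl⟩
    exact U.diff_diff β α z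

variable (k n)

/-- The complex of split tangles which gives the normalised bar resolution of the arc algebra. -/
def barComplex : SplitComplex k n where
  size i := (chain k n i).size
  obj i s := ⟨(chain k n i).out s, (chain k n i).inn s, (chain k n i).q s, (chain k n i).q s⟩
  d i j := matrixOf (chain k n i) (chain k n j)
  d_mem i j h s t := by
    by_cases hj : j ≤ 0
    · exact matrixOf_mem_deg (chain_pred k n h hj) s t
    · have := chain_of_pos k n (not_le.1 hj)
      exact Fin.elim0 (Fin.cast (congrArg Twisted.size this) t)
  d_comp_d i j l h h' s u := by
    by_cases hl : l ≤ 0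
    · exact matrixOf_comp (chain_pred k n h (by omega)) (chain_pred k n h' hl) s u
    · have := chain_of_pos k n (not_le.1 hl)
      exact Fin.elim0 (Fin.cast (congrArg Twisted.size this) u)
  bounded_above := ⟨0, fun i hi => congrArg Twisted.size (chain_of_pos k n hi)⟩
  q_bounded J := by
    refine ⟨-|J|, fun i hi s => ?_⟩
    have h0 := abs_nonneg J
    have h1 := le_abs_self J
    obtain ⟨m, rfl⟩ : ∃ m : ℕ, i = Int.negSucc m := ⟨(-i - 1).toNat, by omega⟩
    have h2 : ((m + 1 : ℕ) : ℤ) ≤ (bar k n (m + 1)).q s := le_bar_q k n (m + 1) s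
    change J ≤ (bar k n (m + 1)).q s
    omega

variable {k n}

lemma augAt_lact {β' β α : Matching n} (x : Fin (regular k n).size) (f : Hom k β' β)
    (z : SHom k β α ((regular k n).out x) ((regular k n).inn x)) :
    augAt β' α x (LinearMap.rTensor _ (mul k β' β _ f) z) = mul k β' β α f (augAt β α x z) := by
  induction z using TensorProduct.induction_on with
  | zero => simp only [map_zero]
  | tmul g h => exact mul_assoc' k _ _ _ _ f g h
  | add x y hx hy => simp only [map_add, hx, hy]

lemma augAt_ract {β α α' : Matching n} (x : Fin (regular k n).size) (g : Hom k α α')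
    (z : SHom k β α ((regular k n).out x) ((regular k n).inn x)) :
    augAt β α' x (LinearMap.lTensor _ ((mul k _ α α').flip g) z) =
      mul k β α α' (augAt β α x z) g := by
  induction z using TensorProduct.induction_on with
  | zero => simp only [map_zero, LinearMap.zero_apply]
  | tmul f h => exact (mul_assoc' k _ _ _ _ f h g).symm
  | add x y hx hy => simp only [map_add, LinearMap.add_apply, hx, hy]

lemma SHom.eq_zero_of_mem_deg {β₁ α₁ β₂ α₂ : Matching n} {d : ℤ} {e : ZMod 2}
    {z : SHom k β₁ α₁ β₂ α₂} (hz : z ∈ SHom.deg k β₁ α₁ β₂ α₂ d e) (h : (d : ZMod 2) ≠ e) :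
    z = 0 := by
  induction hz using Submodule.span_induction with
  | mem z hz =>
    obtain ⟨d₁, d₂, f, g, -, -, -, h', -⟩ := hz
    exact absurd h' h
  | zero => rfl
  | add _ _ _ _ h1 h2 => rw [h1, h2, add_zero]
  | smul r _ _ h => rw [h, smul_zero]

lemma augAt_mem_deg {β α : Matching n} (x : Fin (regular k n).size) {d : ℤ} {e : ZMod 2}
    {z : SHom k β α ((regular k n).out x) ((regular k n).inn x)}
    (hz : z ∈ SHom.deg k β α ((regular k n).out x) ((regular k n).inn x) d e) :
    augAt β α x z ∈ Hom.deg k β α d := by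
  induction hz using Submodule.span_induction with
  | mem z hz =>
    obtain ⟨d₁, d₂, f, g, hf, hg, rfl, -, rfl⟩ := hz
    exact mul_mem_deg k hf hg
  | zero => rw [map_zero]; exact Submodule.zero_mem _
  | add _ _ _ _ h1 h2 => rw [map_add]; exact Submodule.add_mem _ h1 h2
  | smul r _ _ h => rw [map_smul]; exact Submodule.smul_mem _ _ h

variable (k n)

/-- The augmentation of the normalised bar resolution. -/
def barAugmentation : (barComplex k n).Augmentation where
  map := aug
  map_lact β' β α f y := by
    refine (aug_apply _).trans ((Finset.sum_congr rfl fun x _ => augAt_lact x f (y x)).trans ?_)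
    rw [← map_sum]
    exact congrArg _ (aug_apply _).symm
  map_ract β α α' g y := by
    refine (aug_apply _).trans ((Finset.sum_congr rfl fun x _ => augAt_ract x g (y x)).trans ?_)
    rw [← LinearMap.sum_apply, ← map_sum]
    exact congrArg (fun f => mul k β α α' f g) (aug_apply _).symm
  map_deg β α d e y hy := by
    have h : ∀ x : Fin (regular k n).size, y x ∈ SHom.deg k β α ((regular k n).out x)
        ((regular k n).inn x) d e := fun x => by
      have h1 := (Submodule.mem_pi.1 hy) x (Set.mem_univ x)
      have h2 : d - ((barComplex k n).obj 0 x).q + n = d := sub_add_cancel d (n : ℤ)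
      have h3 : e - ((barComplex k n).obj 0 x).par + n = e := by
        have : ((barComplex k n).obj 0 x).par = (n : ZMod 2) := Int.cast_natCast n
        rw [this, sub_add_cancel]
      rw [h2, h3] at h1
      exact h1
    refine ⟨?_, fun hde => ?_⟩
    · refine (aug_apply (k := k) y).symm ▸ Submodule.sum_mem _ fun x _ => augAt_mem_deg x (h x)
    · refine (aug_apply (k := k) y).trans (Finset.sum_eq_zero fun x _ => ?_)
      rw [SHom.eq_zero_of_mem_deg (h x) hde, map_zero]
  map_boundary β α y := by
    have h : (barComplex k n).FKd (-1) 0 β α = (regular k n).diff β α := mapOf_next (regular k n) β α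
    rw [h]
    exact aug_diff β α y

theorem barComplex_isUniversalResolution : (barComplex k n).IsUniversalResolution := by
  refine ⟨barAugmentation k n, fun β α => ⟨fun i j l h h' hj => ?_, fun y _ hy => ?_, fun f => ?_⟩⟩
  · by_cases hl : l ≤ 0
    · exact exact_mapOf (chain_pred k n h (by omega)) (chain_pred k n h' hl) β α
    · have h1 : IsEmpty (Fin (chain k n j).size) := by
        rw [chain_of_pos k n (by omega : 0 < j)]
        exact Fin.isEmpty'
      have h2 : Subsingleton ((barComplex k n).FK j β α) := ⟨fun a b => funext fun s => h1.elim s⟩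
      exact fun y => ⟨fun _ => ⟨0, Subsingleton.elim _ _⟩, fun _ =>
        (congrArg _ (Subsingleton.elim y 0)).trans (LinearMap.map_zero _)⟩
  · have h : (barComplex k n).FKd (-1) 0 β α = (regular k n).diff β α := mapOf_next (regular k n) β α
    have h1 := diff_homotopy_add_coaug β α y
    have hy : aug β α y = 0 := hy
    rw [hy, map_zero, add_zero] at h1
    rw [h]
    exact ⟨_, h1⟩
  · exact ⟨coaug β α f, funext fun s => s.elim0, aug_coaug β α f⟩

end BarResolution

/-! ### The projector -/

section Projector

variable {n : ℕ}

/-- The matrix of the pairing `⟨α, γ⟩ ↦ (-q - q⁻¹) ^ c(α, γ)`. -/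
def gramMatrix (n : ℕ) : Matrix (Matching n) (Matching n) (RatFunc ℚ) :=
  Matrix.of fun α γ => loopValue ^ numCircles α γ

/-- The Gram matrix multiplied by `(-q) ^ n`, which has polynomial entries. -/
def polyGram (n : ℕ) : Matrix (Matching n) (Matching n) (Polynomial ℚ) :=
  Matrix.of fun α γ =>
    (-Polynomial.X) ^ (n - numCircles α γ) * (1 + Polynomial.X ^ 2) ^ numCircles α γ

lemma polyGram_eval_zero : (Polynomial.evalRingHom 0).mapMatrix (polyGram n) = 1 := by
  ext α γ
  rcases eq_or_ne α γ with rfl | h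
  · simp [polyGram, numCircles_self]
  · have h1 : n - numCircles α γ ≠ 0 := fun h2 =>
      h (eq_of_numCircles_eq (le_antisymm (numCircles_le α γ) (Nat.sub_eq_zero_iff_le.mp h2)))
    simp [polyGram, Matrix.one_apply_ne h, h1]

/-- Multiplied by `(-q) ^ n`, the Gram matrix specialises to the identity at `q = 0`. -/
lemma gramMatrix_det_ne_zero : (gramMatrix n).det ≠ 0 := by
  have h1 : (polyGram n).det ≠ 0 := by
    intro h
    have h2 := RingHom.map_det (Polynomial.evalRingHom (0 : ℚ)) (polyGram n)
    rw [polyGram_eval_zero, h] at h2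
    simp at h2
  have h2 : (algebraMap (Polynomial ℚ) (RatFunc ℚ)).mapMatrix (polyGram n) =
      (-RatFunc.X : RatFunc ℚ) ^ n • gramMatrix n := by
    ext α γ
    have h3 : (1 + RatFunc.X ^ 2 : RatFunc ℚ) = -RatFunc.X * loopValue := by
      rw [loopValue, neg_mul_neg, mul_add, mul_inv_cancel₀ RatFunc.X_ne_zero]
      ring
    have h4 : n = (n - numCircles α γ) + numCircles α γ :=
      (Nat.sub_add_cancel (numCircles_le α γ)).symm
    rw [Matrix.smul_apply, RingHom.mapMatrix_apply, Matrix.map_apply]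
    simp only [polyGram, gramMatrix, Matrix.of_apply, map_mul, map_pow, map_neg, map_add, map_one,
      RatFunc.algebraMap_X, smul_eq_mul]
    rw [h3, mul_pow, ← mul_assoc, ← pow_add, ← h4]
  intro h
  have h3 := RingHom.map_det (algebraMap (Polynomial ℚ) (RatFunc ℚ)) (polyGram n)
  rw [h2, Matrix.det_smul, h, mul_zero] at h3
  exact h1 ((map_eq_zero_iff _ (RatFunc.algebraMap_injective ℚ)).mp h3)

lemma isProjector_iff (p : SplitTL n (RatFunc ℚ)) :
    IsProjector p ↔ Matrix.of p * gramMatrix n = 1 := by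
  have h (γ β : Matching n) : p.act (Pi.single γ 1) β = (Matrix.of p * gramMatrix n) β γ := by
    simp [SplitTL.act, Matrix.mul_apply, gramMatrix, Pi.single_apply]
  constructor
  · intro hp
    ext β γ
    rw [← h, hp γ, Matrix.one_apply, Pi.single_apply]
  · intro hp γ
    funext β
    rw [h, hp, Matrix.one_apply, Pi.single_apply]

theorem existsUnique_isProjector : ∃! p : SplitTL n (RatFunc ℚ), IsProjector p := by
  have hu : IsUnit (gramMatrix n).det := gramMatrix_det_ne_zero.isUnit
  refine ⟨fun β α => (gramMatrix n)⁻¹ β α,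
    (isProjector_iff _).mpr (Matrix.nonsing_inv_mul _ hu), fun p hp => ?_⟩
  have h := (isProjector_iff p).mp hp
  have h1 : Matrix.of p = (gramMatrix n)⁻¹ := (Matrix.inv_eq_left_inv h).symm
  funext β α
  exact congrFun (congrFun h1 β) α

end Projector

/-! ### Graded pieces of modules with homogeneous bases -/

section GradedPiece

variable {k : Type*} [CommRing k] {D ι κ M N : Type*} [AddCommGroup M] [Module k M]
  [AddCommGroup N] [Module k N]

/-- The homogeneous part of degree `d` of a module, for the grading in which the basis vector `b i`
has degree `deg i`. -/
def gradedPiece (b : Module.Basis ι k M) (deg : ι → D) (d : D) : Submodule k M :=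
  Submodule.span k (b '' {i | deg i = d})

lemma mem_gradedPiece {b : Module.Basis ι k M} {deg : ι → D} {d : D} {x : M} :
    x ∈ gradedPiece b deg d ↔ ∀ i, b.repr x i ≠ 0 → deg i = d := by
  rw [gradedPiece, b.mem_span_image]
  constructor
  · intro h i hi
    exact h (Finsupp.mem_support_iff.mpr hi)
  · intro h i hi
    exact h i (Finsupp.mem_support_iff.mp hi)

open Classical in
/-- The projection onto a homogeneous part. -/
def gradedProj (b : Module.Basis ι k M) (deg : ι → D) (d : D) : M →ₗ[k] M :=
  b.constr ℕ fun i => if deg i = d then b i else 0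

lemma gradedProj_basis_of_eq (b : Module.Basis ι k M) {deg : ι → D} {d : D} {i : ι}
    (h : deg i = d) : gradedProj b deg d (b i) = b i := by
  rw [gradedProj, b.constr_basis, if_pos h]

lemma gradedProj_basis_of_ne (b : Module.Basis ι k M) {deg : ι → D} {d : D} {i : ι}
    (h : deg i ≠ d) : gradedProj b deg d (b i) = 0 := by
  rw [gradedProj, b.constr_basis, if_neg h]

lemma gradedProj_of_mem {b : Module.Basis ι k M} {deg : ι → D} {d : D} {x : M}
    (hx : x ∈ gradedPiece b deg d) : gradedProj b deg d x = x := by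
  induction hx using Submodule.span_induction with
  | mem x hx =>
    obtain ⟨i, hi, rfl⟩ := hx
    exact gradedProj_basis_of_eq b hi
  | zero => exact LinearMap.map_zero _
  | add x y _ _ hx hy => rw [map_add, hx, hy]
  | smul a x _ hx => rw [map_smul, hx]

lemma gradedProj_of_mem_of_ne {b : Module.Basis ι k M} {deg : ι → D} {d d' : D} (h : d' ≠ d) {x : M}
    (hx : x ∈ gradedPiece b deg d') : gradedProj b deg d x = 0 := by
  induction hx using Submodule.span_induction with
  | mem x hx =>
    obtain ⟨i, hi, rfl⟩ := hx
    exact gradedProj_basis_of_ne b (by rwa [show deg i = d' from hi])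
  | zero => exact LinearMap.map_zero _
  | add x y _ _ hx hy => rw [map_add, hx, hy, add_zero]
  | smul a x _ hx => rw [map_smul, hx, smul_zero]

lemma gradedProj_mem (b : Module.Basis ι k M) (deg : ι → D) (d : D) (x : M) :
    gradedProj b deg d x ∈ gradedPiece b deg d := by
  have hx := b.mem_span x
  induction hx using Submodule.span_induction with
  | mem x hx =>
    obtain ⟨i, rfl⟩ := hx
    by_cases h : deg i = d
    · rw [gradedProj_basis_of_eq b h]
      exact Submodule.subset_span ⟨i, h, rfl⟩
    · rw [gradedProj_basis_of_ne b h]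
      exact zero_mem _
  | zero => rw [LinearMap.map_zero]; exact zero_mem _
  | add x y _ _ hx hy => rw [map_add]; exact add_mem hx hy
  | smul a x _ hx => rw [map_smul]; exact Submodule.smul_mem _ _ hx

lemma gradedProj_comm {b : Module.Basis ι k M} {c : Module.Basis κ k N} {deg : ι → D} {deg' : κ → D}
    {f : M →ₗ[k] N} (hf : ∀ d, ∀ x ∈ gradedPiece b deg d, f x ∈ gradedPiece c deg' d) (d : D)
    (x : M) : f (gradedProj b deg d x) = gradedProj c deg' d (f x) := by
  have h : f ∘ₗ gradedProj b deg d = gradedProj c deg' d ∘ₗ f := by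
    refine b.ext fun i => ?_
    have hi : f (b i) ∈ gradedPiece c deg' (deg i) := hf _ _ (Submodule.subset_span ⟨i, rfl, rfl⟩)
    by_cases h : deg i = d
    · subst h
      rw [LinearMap.comp_apply, LinearMap.comp_apply, gradedProj_basis_of_eq b rfl,
        gradedProj_of_mem hi]
    · rw [LinearMap.comp_apply, LinearMap.comp_apply, gradedProj_basis_of_ne b h,
        gradedProj_of_mem_of_ne h hi, LinearMap.map_zero]
  exact LinearMap.congr_fun h x

/-- A homogeneous element in the image of a homogeneous map has a homogeneous preimage. -/
lemma exists_homogeneous_preimage {b : Module.Basis ι k M} {c : Module.Basis κ k N} {deg : ι → D}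
    {deg' : κ → D} {f : M →ₗ[k] N}
    (hf : ∀ d, ∀ x ∈ gradedPiece b deg d, f x ∈ gradedPiece c deg' d) {d : D} {x : M}
    (hx : f x ∈ gradedPiece c deg' d) : ∃ z ∈ gradedPiece b deg d, f z = f x :=
  ⟨_, gradedProj_mem b deg d x, (gradedProj_comm hf d x).trans (gradedProj_of_mem hx)⟩

lemma rank_gradedPiece [Nontrivial k] [Finite ι] (b : Module.Basis ι k M) (deg : ι → D) (d : D) :
    Module.rank k (gradedPiece b deg d) = Nat.card {i // deg i = d} := by
  have h : LinearIndependent k fun i : {i // deg i = d} => b i :=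
    b.linearIndependent.comp _ Subtype.val_injective
  have h1 : b '' {i | deg i = d} = Set.range fun i : {i // deg i = d} => b i := by
    ext x
    simp
  have h2 := rank_span h
  rw [gradedPiece, h1, h2, ← Nat.cast_card, Nat.card_range_of_injective h.injective]

lemma finrank_gradedPiece [Nontrivial k] [Finite ι] (b : Module.Basis ι k M) (deg : ι → D) (d : D) :
    Module.finrank k (gradedPiece b deg d) = Nat.card {i // deg i = d} := by
  rw [Module.finrank, rank_gradedPiece, Cardinal.toNat_natCast]

lemma rank_gradedPiece_lt [Nontrivial k] [Finite ι] (b : Module.Basis ι k M) (deg : ι → D) (d : D) :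
    Module.rank k (gradedPiece b deg d) < Cardinal.aleph0 := by
  rw [rank_gradedPiece]
  exact Cardinal.natCast_lt_aleph0

end GradedPiece

/-! ### Euler characteristics over domains -/

section Euler

universe u

variable {k : Type*} [CommRing k] [IsDomain k] {M N : Type u} [AddCommGroup M] [Module k M]
  [AddCommGroup N] [Module k N]

lemma finrank_map_add_finrank_inf_ker (f : M →ₗ[k] N) {W : Submodule k M}
    (hW : Module.rank k W < Cardinal.aleph0) :
    Module.finrank k W = Module.finrank k (W.map f) +
      Module.finrank k (W ⊓ LinearMap.ker f : Submodule k M) := by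
  have h := (f.domRestrict W).rank_range_add_rank_ker
  have h1 : Module.finrank k (LinearMap.ker (f.domRestrict W)) =
      Module.finrank k (W ⊓ LinearMap.ker f : Submodule k M) := by
    rw [← Submodule.map_comap_subtype, ← LinearMap.ker_comp]
    exact (Submodule.equivSubtypeMap W _).finrank_eq
  rw [← h1, ← LinearMap.range_domRestrict, Module.finrank, Module.finrank, Module.finrank, ← h,
    Cardinal.toNat_add]
  · exact (self_le_add_right _ _).trans_lt (h ▸ hW)
  · exact (self_le_add_left _ _).trans_lt (h ▸ hW)

lemma sum_Icc_sub_telescope (g : ℤ → ℚ) {A B : ℤ} (h : A - 1 ≤ B) :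
    ∑ i ∈ Finset.Icc A B, (g i - g (i - 1)) = g B - g (A - 1) := by
  induction B, h using Int.leInduction with
  | base => simp
  | succ B hB ih =>
    have h1 : Finset.Icc A (B + 1) = insert (B + 1) (Finset.Icc A B) := by
      ext i
      simp only [Finset.mem_insert, Finset.mem_Icc]
      omega
    rw [h1, Finset.sum_insert (by simp), ih, add_sub_cancel_right]
    ring

/-- The Euler characteristic of the subcomplex `W` of a complex, where `W` is exact except in degree `0` and
its homology in degree `0` is detected by `ε`. -/
theorem euler_characteristic_eq {M : ℤ → Type u} [∀ i, AddCommGroup (M i)] [∀ i, Module k (M i)]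
    (d : ∀ i j, M i →ₗ[k] M j) (ε : M 0 →ₗ[k] N) (W : ∀ i, Submodule k (M i))
    (hW : ∀ i, Module.rank k (W i) < Cardinal.aleph0)
    (hd : ∀ i j l, i + 1 = j → j + 1 = l → j ≠ 0 → W j ⊓ LinearMap.ker (d j l) = (W i).map (d i j))
    (h0 : W 0 ⊓ LinearMap.ker (d 0 1) ⊓ LinearMap.ker ε = (W (-1)).map (d (-1) 0))
    {A B : ℤ} (hA : A ≤ 0) (hB : 0 ≤ B) (hAB : ∀ i, i ∉ Finset.Icc A B → W i = ⊥) :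
    ∑ i ∈ Finset.Icc A B, (-1 : ℚ) ^ i * Module.finrank k (W i) =
      Module.finrank k ((W 0 ⊓ LinearMap.ker (d 0 1)).map ε) := by
  set h : ℚ := ((Module.finrank k ((W 0 ⊓ LinearMap.ker (d 0 1)).map ε) : ℕ) : ℚ) with hh
  set r : ℤ → ℚ := fun i => ((Module.finrank k ((W i).map (d i (i + 1))) : ℕ) : ℚ) with hr
  have hr0 (i : ℤ) (hi : i ∉ Finset.Icc A B) : r i = 0 := by
    change ((Module.finrank k ((W i).map (d i (i + 1))) : ℕ) : ℚ) = 0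
    rw [hAB i hi, Submodule.map_bot, finrank_bot, Nat.cast_zero]
  have hv (i j : ℤ) (hij : i + 1 = j) :
      (Module.finrank k (W j) : ℚ) = r j + r i + if j = 0 then h else 0 := by
    rw [finrank_map_add_finrank_inf_ker (d j (j + 1)) (hW j)]
    by_cases hj : j = 0
    · obtain rfl : i = -1 := by omega
      subst hj
      have h1 : Module.rank k (W 0 ⊓ LinearMap.ker (d 0 1) : Submodule k (M 0)) <
          Cardinal.aleph0 :=
        (Submodule.rank_mono inf_le_left).trans_lt (hW 0)
      have h2 := finrank_map_add_finrank_inf_ker ε h1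
      rw [h0] at h2
      simp only [hr, hh, if_true]
      rw [show (0 : ℤ) + 1 = 1 from rfl, show (-1 : ℤ) + 1 = 0 from rfl, h2]
      push_cast
      ring
    · subst hij
      rw [hd i (i + 1) (i + 1 + 1) rfl rfl hj, if_neg hj]
      push_cast
      ring
  have hs (i : ℤ) : (-1 : ℚ) ^ i * Module.finrank k (W i) =
      ((-1 : ℚ) ^ i * r i - (-1 : ℚ) ^ (i - 1) * r (i - 1)) + if i = 0 then h else 0 := by
    rw [hv (i - 1) i (by ring), zpow_sub_one₀ (by norm_num)]
    split_ifs with hi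
    · subst hi
      norm_num
    · norm_num
      ring
  rw [Finset.sum_congr rfl fun i _ => hs i, Finset.sum_add_distrib,
    sum_Icc_sub_telescope (fun i => (-1 : ℚ) ^ i * r i) (by omega), hr0 (A - 1) (by simp),
    Finset.sum_ite_eq', if_pos (Finset.mem_Icc.mpr ⟨hA, hB⟩)]
  -- the top boundary term vanishes since the next chain module does
  have hB1 : r B = 0 := by
    have h1 := hv B (B + 1) rfl
    rw [hAB (B + 1) (by simp), hr0 (B + 1) (by simp), if_neg (by omega)] at h1
    simpa using h1.symm
  rw [hB1]
  ring

end Euler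

/-! ### Homogeneous bases of the bimodules of a complex -/

section Bases

universe u

variable {k : Type u} [CommRing k] {n : ℕ}

lemma Hom.deg_eq_gradedPiece (α β : Matching n) (d : ℤ) :
    Hom.deg k α β d = gradedPiece (monoBasis k (Circles α β)) monoQ d := by
  rw [Hom.deg, gradedPiece]
  congr 1
  ext f
  constructor
  · rintro ⟨S, hS, rfl⟩
    exact ⟨S, hS, monoBasis_apply k S⟩
  · rintro ⟨S, hS, rfl⟩
    exact ⟨S, hS, monoBasis_apply k S⟩

/-- The basis of the space of morphisms of split tangles which consists of the reduced planar
cobordisms. -/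
def sHomBasis (k : Type u) [CommRing k] (β₁ α₁ β₂ α₂ : Matching n) :
    Module.Basis (Finset (Circles β₁ β₂) × Finset (Circles α₂ α₁)) k (SHom k β₁ α₁ β₂ α₂) :=
  (monoBasis k (Circles β₁ β₂)).tensorProduct (monoBasis k (Circles α₂ α₁))

/-- The `q`-degree of a basis vector. -/
def pairQ {β₁ α₁ β₂ α₂ : Matching n} (x : Finset (Circles β₁ β₂) × Finset (Circles α₂ α₁)) : ℤ :=
  monoQ x.1 + monoQ x.2

lemma SHom.deg_eq_gradedPiece (β₁ α₁ β₂ α₂ : Matching n) (d : ℤ) (e : ZMod 2) :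
    SHom.deg k β₁ α₁ β₂ α₂ d e =
      gradedPiece (sHomBasis k β₁ α₁ β₂ α₂) (fun x => (pairQ x, (pairQ x : ZMod 2))) (d, e) := by
  apply le_antisymm
  · refine Submodule.span_le.mpr ?_
    rintro _ ⟨d₁, d₂, f, g, hf, hg, rfl, rfl, rfl⟩
    rw [Hom.deg_eq_gradedPiece, mem_gradedPiece] at hf hg
    refine mem_gradedPiece.mpr fun x hx => ?_
    rw [sHomBasis, Module.Basis.tensorProduct_repr_tmul_apply, smul_eq_mul] at hx
    rw [pairQ, hf _ (right_ne_zero_of_mul hx), hg _ (left_ne_zero_of_mul hx)]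
  · refine Submodule.span_le.mpr ?_
    rintro _ ⟨x, hx, rfl⟩
    obtain ⟨h1, h2⟩ := Prod.ext_iff.mp (show (pairQ x, (pairQ x : ZMod 2)) = (d, e) from hx)
    refine Submodule.subset_span ⟨monoQ x.1, monoQ x.2, mono k x.1, mono k x.2,
      mono_mem_deg k _, mono_mem_deg k _, h1, ?_, ?_⟩
    · exact (congrArg Int.cast h1.symm).trans h2
    · rw [sHomBasis, Module.Basis.tensorProduct_apply, monoBasis_apply, monoBasis_apply]

lemma SHom.comp_mem_deg {β₁ α₁ β₂ α₂ β₃ α₃ : Matching n} {d d' : ℤ} {e e' : ZMod 2}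
    {h : SHom k β₁ α₁ β₂ α₂} {h' : SHom k β₂ α₂ β₃ α₃} (hh : h ∈ SHom.deg k β₁ α₁ β₂ α₂ d e)
    (hh' : h' ∈ SHom.deg k β₂ α₂ β₃ α₃ d' e') :
    SHom.comp k β₁ α₁ β₂ α₂ β₃ α₃ h h' ∈ SHom.deg k β₁ α₁ β₃ α₃ (d + d') (e + e') := by
  induction hh, hh' using Submodule.span_induction₂ with
  | mem_mem h h' hh hh' =>
    obtain ⟨d₁, d₂, f, g, hf, hg, rfl, rfl, rfl⟩ := hh
    obtain ⟨d₁', d₂', f', g', hf', hg', rfl, rfl, rfl⟩ := hh'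
    rw [SHom.comp_tmul]
    refine Submodule.subset_span ⟨_, _, _, _, mul_mem_deg k hf hf', mul_mem_deg k hg' hg, by ring,
      by push_cast; ring, rfl⟩
  | zero_left => rw [LinearMap.map_zero, LinearMap.zero_apply]; exact zero_mem _
  | zero_right => rw [LinearMap.map_zero]; exact zero_mem _
  | add_left x y z _ _ _ h1 h2 =>
    rw [LinearMap.map_add, LinearMap.add_apply]; exact add_mem h1 h2
  | add_right x y z _ _ _ h1 h2 => rw [LinearMap.map_add]; exact add_mem h1 h2
  | smul_left r x y _ _ h1 =>
    rw [LinearMap.map_smul, LinearMap.smul_apply]; exact Submodule.smul_mem _ _ h1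
  | smul_right r x y _ _ h1 => rw [LinearMap.map_smul]; exact Submodule.smul_mem _ _ h1

namespace SplitComplex

variable (P : SplitComplex k n)

/-- The index set of the homogeneous basis of a component of a chain bimodule. -/
abbrev FKIndex (i : ℤ) (β α : Matching n) : Type :=
  Σ s : Fin (P.size i), Finset (Circles β (P.obj i s).out) × Finset (Circles (P.obj i s).inn α)

/-- The homogeneous basis of a component of a chain bimodule. -/
def fkBasis (i : ℤ) (β α : Matching n) : Module.Basis (P.FKIndex i β α) k (P.FK i β α) :=
  Pi.basis fun s => sHomBasis k β α (P.obj i s).out (P.obj i s).inn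

/-- The two degrees of a basis vector of a chain bimodule. -/
def fkBidegree (i : ℤ) (β α : Matching n) (x : P.FKIndex i β α) : ℤ × ZMod 2 :=
  (pairQ x.2 + (P.obj i x.1).q - n, (pairQ x.2 : ZMod 2) + (P.obj i x.1).par - n)

lemma fkDeg_eq_gradedPiece (i : ℤ) (β α : Matching n) (d : ℤ) (e : ZMod 2) :
    P.FKdeg i β α d e =
      gradedPiece (M := P.FK i β α) (P.fkBasis i β α) (P.fkBidegree i β α) (d, e) := by
  ext y
  simp only [FKdeg, Submodule.mem_pi, Set.mem_univ, true_imp_iff, SHom.deg_eq_gradedPiece,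
    mem_gradedPiece]
  have h (s : Fin (P.size i)) (x) : (P.fkBasis i β α).repr y ⟨s, x⟩ =
      (sHomBasis k β α (P.obj i s).out (P.obj i s).inn).repr (y s) x := Pi.basis_repr _ _ _
  constructor
  · rintro h1 ⟨s, x⟩ hx
    rw [h] at hx
    obtain ⟨h2, h3⟩ := Prod.ext_iff.mp (h1 s x hx)
    refine Prod.ext ?_ ?_
    · change pairQ x = _ at h2
      change pairQ x + _ - _ = d
      rw [h2]
      ring
    · change (pairQ x : ZMod 2) = _ at h3
      change (pairQ x : ZMod 2) + _ - _ = e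
      rw [h3]
      ring
  · intro h1 s x hx
    rw [← h] at hx
    obtain ⟨h2, h3⟩ := Prod.ext_iff.mp (h1 ⟨s, x⟩ hx)
    refine Prod.ext ?_ ?_
    · change pairQ x + _ - _ = d at h2
      change pairQ x = _
      rw [← h2]
      ring
    · change (pairQ x : ZMod 2) + _ - _ = e at h3
      change (pairQ x : ZMod 2) = _
      rw [← h3]
      ring

lemma FKd_mem {i j : ℤ} (hij : i + 1 = j) {β α : Matching n} {d : ℤ} {e : ZMod 2}
    {y : P.FK i β α} (hy : y ∈ P.FKdeg i β α d e) : P.FKd i j β α y ∈ P.FKdeg j β α d e := by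
  intro t _
  have h : P.FKd i j β α y t =
      ∑ s, SHom.comp k β α _ _ _ _ (y s) (P.d i j s t) := by
    simp [FKd]
  rw [h]
  refine Submodule.sum_mem _ fun s _ => ?_
  have h1 := SHom.comp_mem_deg (hy s trivial) (P.d_mem i j hij s t)
  convert h1 using 2 <;> ring

end SplitComplex

end Bases

/-! ### The graded Euler characteristic of a resolution -/

instance {n : ℕ} (α β : Matching n) : Fintype (Circles α β) := Fintype.ofFinite _

section GradedEuler

universe u

variable {k : Type u} [CommRing k] {n : ℕ}

lemma SHom.comp_assoc (β₁ α₁ β₂ α₂ β₃ α₃ β₄ α₄ : Matching n) (f : SHom k β₁ α₁ β₂ α₂)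
    (g : SHom k β₂ α₂ β₃ α₃) (h : SHom k β₃ α₃ β₄ α₄) :
    SHom.comp k β₁ α₁ β₃ α₃ β₄ α₄ (SHom.comp k β₁ α₁ β₂ α₂ β₃ α₃ f g) h =
      SHom.comp k β₁ α₁ β₂ α₂ β₄ α₄ f (SHom.comp k β₂ α₂ β₃ α₃ β₄ α₄ g h) := by
  induction f using TensorProduct.induction_on with
  | zero => simp only [LinearMap.map_zero, LinearMap.zero_apply]
  | add f f' hf hf' => simp only [LinearMap.map_add, LinearMap.add_apply, hf, hf']
  | tmul f f' =>
    induction g using TensorProduct.induction_on with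
    | zero => simp only [LinearMap.map_zero, LinearMap.zero_apply]
    | add g g' hg hg' => simp only [LinearMap.map_add, LinearMap.add_apply, hg, hg']
    | tmul g g' =>
      induction h using TensorProduct.induction_on with
      | zero => simp only [LinearMap.map_zero]
      | add h h' hh hh' => simp only [LinearMap.map_add, hh, hh']
      | tmul h h' =>
        rw [SHom.comp_tmul, SHom.comp_tmul, SHom.comp_tmul, SHom.comp_tmul, mul_assoc',
          mul_assoc']

namespace SplitComplex

variable (P : SplitComplex k n)

lemma FKd_apply (i j : ℤ) (β α : Matching n) (y : P.FK i β α) (t : Fin (P.size j)) :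
    P.FKd i j β α y t = ∑ s, SHom.comp k β α _ _ _ _ (y s) (P.d i j s t) := by
  simp [FKd]

lemma FKd_FKd {i j l : ℤ} (hij : i + 1 = j) (hjl : j + 1 = l) (β α : Matching n)
    (y : P.FK i β α) : P.FKd j l β α (P.FKd i j β α y) = 0 := by
  funext u
  have h (s : Fin (P.size i)) : ∑ t, SHom.comp k β α _ _ _ _
      (SHom.comp k β α _ _ _ _ (y s) (P.d i j s t)) (P.d j l t u) = 0 := by
    simp only [SHom.comp_assoc]
    rw [← map_sum, P.d_comp_d i j l hij hjl, LinearMap.map_zero]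
  simp only [FKd_apply, map_sum, LinearMap.sum_apply]
  rw [Finset.sum_comm]
  exact Finset.sum_eq_zero fun s _ => h s

/-- The two degrees of a reduced cobordism. -/
def monoBidegree {α β : Matching n} (S : Finset (Circles α β)) : ℤ × ZMod 2 :=
  (monoQ S, (monoQ S : ZMod 2))

variable {P} in
lemma Augmentation.map_mem (ε : P.Augmentation) (β α : Matching n) (x : ℤ × ZMod 2)
    {y : P.FK 0 β α} (hy : y ∈ gradedPiece (M := P.FK 0 β α) (P.fkBasis 0 β α)
      (P.fkBidegree 0 β α) x) :
    ε.map β α y ∈ gradedPiece (monoBasis k (Circles β α)) monoBidegree x := by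
  obtain ⟨d, e⟩ := x
  rw [← fkDeg_eq_gradedPiece] at hy
  obtain ⟨h1, h2⟩ := ε.map_deg β α d e y hy
  by_cases h : (d : ZMod 2) = e
  · rw [Hom.deg_eq_gradedPiece, mem_gradedPiece] at h1
    refine mem_gradedPiece.mpr fun S hS => ?_
    have h3 := h1 S hS
    exact Prod.ext h3 ((congrArg Int.cast h3).trans h)
  · rw [h2 h]
    exact zero_mem _

/-- In each bidegree, the alternating sum of the ranks of the chain bimodules of a resolution is the
rank of the arc algebra. -/
theorem sum_card_bidegree [IsDomain k] {ε : P.Augmentation} {β α : Matching n}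
    (h1 : ∀ i j l : ℤ, i + 1 = j → j + 1 = l → j ≠ 0 →
      Function.Exact (P.FKd i j β α) (P.FKd j l β α))
    (h2 : ∀ y : P.FK 0 β α, P.FKd 0 1 β α y = 0 → ε.map β α y = 0 →
      ∃ z : P.FK (-1) β α, P.FKd (-1) 0 β α z = y)
    (h3 : ∀ h : Hom k β α, ∃ y : P.FK 0 β α, P.FKd 0 1 β α y = 0 ∧ ε.map β α y = h)
    (x : ℤ × ZMod 2) {A B : ℤ} (hA : A ≤ 0) (hB : 0 ≤ B)
    (hAB : ∀ i, i ∉ Finset.Icc A B → ∀ y, P.fkBidegree i β α y ≠ x) :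
    ∑ i ∈ Finset.Icc A B, (-1 : ℚ) ^ i * Nat.card {y // P.fkBidegree i β α y = x} =
      Nat.card {S : Finset (Circles β α) // monoBidegree S = x} := by
  set W : ∀ i, Submodule k (P.FK i β α) := fun i =>
    gradedPiece (M := P.FK i β α) (P.fkBasis i β α) (P.fkBidegree i β α) x with hW
  have hd {i j : ℤ} (hij : i + 1 = j) (x' : ℤ × ZMod 2) (y : P.FK i β α)
      (hy : y ∈ gradedPiece (M := P.FK i β α) (P.fkBasis i β α) (P.fkBidegree i β α) x') :
      P.FKd i j β α y ∈
        gradedPiece (M := P.FK j β α) (P.fkBasis j β α) (P.fkBidegree j β α) x' := by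
    obtain ⟨d, e⟩ := x'
    rw [← fkDeg_eq_gradedPiece] at hy ⊢
    exact P.FKd_mem hij hy
  have hm : (W 0 ⊓ LinearMap.ker (P.FKd 0 1 β α)).map (ε.map β α) =
      gradedPiece (monoBasis k (Circles β α)) monoBidegree x := by
    apply le_antisymm
    · rintro _ ⟨y, hy, rfl⟩
      exact ε.map_mem β α x hy.1
    · intro f hf
      obtain ⟨y, hy, rfl⟩ := h3 f
      refine ⟨gradedProj (M := P.FK 0 β α) (P.fkBasis 0 β α) (P.fkBidegree 0 β α) x y,
        ⟨gradedProj_mem _ _ _ _, ?_⟩, ?_⟩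
      · rw [SetLike.mem_coe, LinearMap.mem_ker, gradedProj_comm (hd (by norm_num)), hy,
          LinearMap.map_zero]
      · rw [gradedProj_comm (ε.map_mem β α), gradedProj_of_mem hf]
  have key := euler_characteristic_eq (M := fun i => P.FK i β α) (fun i j => P.FKd i j β α)
    (ε.map β α) W (fun i => rank_gradedPiece_lt _ _ _) ?_ ?_ hA hB ?_
  · refine (Finset.sum_congr rfl fun i _ => ?_).trans (key.trans ?_)
    · rw [← finrank_gradedPiece (M := P.FK i β α) (P.fkBasis i β α)]
    · rw [hm, finrank_gradedPiece]
  · intro i j l hij hjl hj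
    apply le_antisymm
    · rintro y ⟨hy, hy'⟩
      obtain ⟨z, rfl⟩ := (h1 i j l hij hjl hj y).mp hy'
      obtain ⟨z', hz', h⟩ := exists_homogeneous_preimage (hd hij) hy
      exact ⟨z', hz', h⟩
    · rintro _ ⟨z, hz, rfl⟩
      exact ⟨hd hij x z hz, P.FKd_FKd hij hjl β α z⟩
  · apply le_antisymm
    · rintro y ⟨⟨hy, hy'⟩, hy''⟩
      obtain ⟨z, rfl⟩ := h2 y hy' hy''
      obtain ⟨z', hz', h⟩ := exists_homogeneous_preimage (hd (by norm_num)) hy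
      exact ⟨z', hz', h⟩
    · rintro _ ⟨z, hz, rfl⟩
      exact ⟨⟨hd (by norm_num) x z hz, P.FKd_FKd (by norm_num) (by norm_num) β α z⟩,
        ε.map_boundary β α z⟩
  · intro i hi
    rw [eq_bot_iff]
    intro y hy
    have h := mem_gradedPiece.mp hy
    rw [Submodule.mem_bot, ← (P.fkBasis i β α).repr.map_eq_zero_iff]
    ext z
    by_contra hz
    exact hAB i hi z (h z hz)

end SplitComplex

end GradedEuler

/-! ### The class of a resolution -/

section Signs

/-- The sign `(-1) ^ μ` of a `ℤ/2`-degree. -/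
def paritySign (μ : ZMod 2) : ℚ := (-1) ^ μ.val

lemma paritySign_add (μ ν : ZMod 2) : paritySign (μ + ν) = paritySign μ * paritySign ν := by
  fin_cases μ <;> fin_cases ν <;> norm_num [paritySign, ZMod.val] <;> rfl

lemma paritySign_mul_self (μ : ZMod 2) : paritySign μ * paritySign μ = 1 := by
  rw [← paritySign_add, CharTwo.add_self_eq_zero]
  rfl

lemma paritySign_natCast (m : ℕ) : paritySign m = (-1) ^ m := by
  induction m with
  | zero => rfl
  | succ m ih =>
    rw [Nat.cast_succ, paritySign_add, ih, pow_succ]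
    rfl

lemma sum_paritySign_mul_card {ι : Type*} [Fintype ι] (f : ι → ℤ × ZMod 2) (d : ℤ) :
    ∑ e, paritySign e * Nat.card {x // f x = (d, e)} =
      ∑ x, if (f x).1 = d then paritySign (f x).2 else 0 := by
  have h (e : ZMod 2) : paritySign e * (Nat.card {x // f x = (d, e)} : ℚ) =
      ∑ x, if (f x).1 = d ∧ (f x).2 = e then paritySign e else 0 := by
    classical
    rw [Nat.card_eq_fintype_card, Fintype.card_subtype, ← Finset.sum_filter, Finset.sum_const,
      nsmul_eq_mul, mul_comm]
    simp only [Prod.ext_iff]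
  simp only [h]
  rw [Finset.sum_comm]
  refine Finset.sum_congr rfl fun x _ => ?_
  by_cases hx : (f x).1 = d <;> simp [hx]

end Signs

section Class

universe u

variable {k : Type u} [CommRing k] {n : ℕ}

/-- The `q`-degree of a choice of `1` or `x` on every circle, where `1` and `x` have the
degrees `-1` and `1`. -/
def circleQ {α β : Matching n} (S : Finset (Circles α β)) : ℤ := 2 * S.card - numCircles α β

lemma monoQ_eq_circleQ_add {α β : Matching n} (S : Finset (Circles α β)) :
    monoQ S = circleQ S + n := by
  rw [monoQ, circleQ]
  ring

lemma paritySign_circleQ {α β : Matching n} (S : Finset (Circles α β)) :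
    paritySign (circleQ S) = (-1) ^ numCircles α β := by
  have h : ((circleQ S : ℤ) : ZMod 2) = numCircles α β := by
    have h1 : (2 : ZMod 2) = 0 := rfl
    rw [circleQ]
    push_cast
    rw [h1, zero_mul, zero_sub, ZMod.neg_eq_self_mod_two]
  rw [h, paritySign_natCast]

lemma neg_circleQ_le {α β : Matching n} (S : Finset (Circles α β)) : -(n : ℤ) ≤ circleQ S := by
  have := numCircles_le α β
  rw [circleQ]
  omega

/-- The coefficient of `q ^ (d - j)` in `(-q - q⁻¹) ^ (c(β, β') + c(α', α))`. -/
def pairWeight (β β' α' α : Matching n) (d j : ℤ) : ℚ :=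
  ∑ x : Finset (Circles β β') × Finset (Circles α' α),
    if circleQ x.1 + circleQ x.2 + j = d then (-1) ^ (numCircles β β' + numCircles α' α) else 0

namespace SplitComplex

variable (P : SplitComplex k n)

lemma exists_degree_range (J : ℤ) :
    ∃ A B : ℤ, A ≤ 0 ∧ 0 ≤ B ∧ ∀ i, i ∉ Finset.Icc A B → ∀ s, J ≤ (P.obj i s).q := by
  obtain ⟨B, hB⟩ := P.bounded_above
  obtain ⟨A, hA⟩ := P.q_bounded J
  refine ⟨min A 0, max B 0, min_le_right _ _, le_max_right _ _, fun i hi s => ?_⟩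
  by_cases h : i < A
  · exact hA i h s
  · have h1 := s.2
    have h2 := hB i (by rw [Finset.mem_Icc] at hi; omega)
    omega

/-- The graded Euler characteristic of a resolution is the graded rank of the arc algebra. -/
theorem sum_pairWeight [IsDomain k] (hP : P.IsUniversalResolution) (β α : Matching n) (d : ℤ)
    {A B : ℤ} (hA : A ≤ 0) (hB : 0 ≤ B)
    (hAB : ∀ i, i ∉ Finset.Icc A B → ∀ s, d + 2 * n + 1 ≤ (P.obj i s).q) :
    ∑ i ∈ Finset.Icc A B, ∑ s, (-1 : ℚ) ^ i * paritySign (P.obj i s).par *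
        pairWeight β (P.obj i s).out (P.obj i s).inn α d (P.obj i s).q =
      ∑ S : Finset (Circles β α), if circleQ S = d then (-1 : ℚ) ^ numCircles β α else 0 := by
  obtain ⟨ε, hε⟩ := hP
  obtain ⟨h1, h2, h3⟩ := hε β α
  have h4 (e : ZMod 2) := P.sum_card_bidegree h1 h2 h3 (d + n, e) hA hB (by
    rintro i hi ⟨s, x⟩ hx
    have h5 := hAB i hi s
    have h6 := neg_circleQ_le x.1
    have h7 := neg_circleQ_le x.2
    have h8 : pairQ x + (P.obj i s).q - n = d + n := congrArg Prod.fst hx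
    rw [pairQ, monoQ_eq_circleQ_add, monoQ_eq_circleQ_add] at h8
    omega)
  have h5 := Finset.sum_congr (rfl : (Finset.univ : Finset (ZMod 2)) = Finset.univ)
    fun e _ => congrArg (paritySign e * ·) (h4 e)
  simp only [Finset.mul_sum] at h5
  rw [Finset.sum_comm, sum_paritySign_mul_card] at h5
  have h6 (i : ℤ) : ∑ e, paritySign e * ((-1 : ℚ) ^ i * Nat.card {y // P.fkBidegree i β α y = (d + n, e)}) =
      paritySign n * ∑ s, (-1 : ℚ) ^ i * paritySign (P.obj i s).par *
        pairWeight β (P.obj i s).out (P.obj i s).inn α d (P.obj i s).q := by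
    simp only [mul_left_comm (paritySign _) ((-1 : ℚ) ^ i)]
    rw [← Finset.mul_sum, sum_paritySign_mul_card, Fintype.sum_sigma, Finset.mul_sum,
      Finset.mul_sum]
    refine Finset.sum_congr rfl fun s _ => ?_
    rw [pairWeight, Finset.mul_sum, Finset.mul_sum, Finset.mul_sum]
    refine Finset.sum_congr rfl fun x _ => ?_
    have h7 : (P.fkBidegree i β α ⟨s, x⟩).1 = d + n ↔
        circleQ x.1 + circleQ x.2 + (P.obj i s).q = d := by
      change pairQ x + (P.obj i s).q - n = d + n ↔ _
      rw [pairQ, monoQ_eq_circleQ_add, monoQ_eq_circleQ_add]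
      omega
    have h8 : paritySign (P.fkBidegree i β α ⟨s, x⟩).2 = paritySign n *
        (paritySign (P.obj i s).par *
          (-1) ^ (numCircles β (P.obj i s).out + numCircles (P.obj i s).inn α)) := by
      have h9 : (P.fkBidegree i β α ⟨s, x⟩).2 =
          n + ((P.obj i s).par + ((circleQ x.1 : ZMod 2) + circleQ x.2)) := by
        change (pairQ x : ZMod 2) + (P.obj i s).par - n = _
        rw [pairQ, monoQ_eq_circleQ_add, monoQ_eq_circleQ_add]
        push_cast
        ring
      rw [h9, paritySign_add, paritySign_add, paritySign_add, paritySign_circleQ,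
        paritySign_circleQ, pow_add]
    rw [h8]
    simp only [h7]
    split_ifs
    · ring
    · ring
  have h7 (S : Finset (Circles β α)) : (if (monoBidegree S).1 = d + n
      then paritySign (monoBidegree S).2 else 0) =
      paritySign n * if circleQ S = d then (-1 : ℚ) ^ numCircles β α else 0 := by
    have h8 : (monoBidegree S).1 = d + n ↔ circleQ S = d := by
      rw [monoBidegree, monoQ_eq_circleQ_add]
      omega
    have h9 : paritySign (monoBidegree S).2 = paritySign n * (-1 : ℚ) ^ numCircles β α := by
      rw [monoBidegree, monoQ_eq_circleQ_add]
      push_cast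
      rw [add_comm, paritySign_add, paritySign_circleQ]
    rw [h9]
    simp only [h8]
    split_ifs
    · rfl
    · ring
  simp only [h6, h7] at h5
  rw [← Finset.mul_sum, ← Finset.mul_sum] at h5
  refine mul_left_cancel₀ (fun h => ?_) h5
  have h10 := paritySign_mul_self (n : ZMod 2)
  rw [h, mul_zero] at h10
  exact zero_ne_one h10

end SplitComplex

lemma laurentExpansion_loopValue : laurentExpansion ℚ loopValue =
    -(HahnSeries.single (1 : ℤ) (1 : ℚ) + HahnSeries.single (-1 : ℤ) (1 : ℚ)) := by
  have h : laurentExpansion ℚ RatFunc.X = HahnSeries.single (1 : ℤ) (1 : ℚ) := RatFunc.coe_X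
  rw [loopValue, map_neg, map_add, map_inv₀, h, HahnSeries.inv_single, inv_one]

lemma laurentExpansion_loopValue_pow (α β : Matching n) :
    laurentExpansion ℚ (loopValue ^ numCircles α β) =
      ∑ S : Finset (Circles α β), HahnSeries.single (circleQ S) ((-1 : ℚ) ^ numCircles α β) := by
  have hc : Fintype.card (Circles α β) = numCircles α β := by
    rw [numCircles, Nat.card_eq_fintype_card]
  rw [map_pow, laurentExpansion_loopValue, neg_pow, ← hc, ← Fintype.sum_pow_mul_eq_add_pow, hc,
    Finset.mul_sum]
  refine Finset.sum_congr rfl fun S _ => ?_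
  have h1 : ((-1 : LaurentSeries ℚ)) ^ numCircles α β =
      HahnSeries.single (0 : ℤ) ((-1 : ℚ) ^ numCircles α β) := by
    change _ = HahnSeries.C _
    rw [map_pow, map_neg, map_one]
  have h2 : S.card ≤ numCircles α β := hc ▸ Finset.card_le_univ S
  rw [h1, HahnSeries.single_pow, HahnSeries.single_pow, HahnSeries.single_mul_single,
    HahnSeries.single_mul_single, one_pow, one_pow, mul_one, mul_one]
  have h3 : (0 : ℤ) + (S.card • 1 + (numCircles α β - S.card) • (-1)) = circleQ S := by
    rw [circleQ, nsmul_eq_mul, nsmul_eq_mul]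
    push_cast [h2]
    ring
  rw [h3]

lemma coeff_single_mul' (a d : ℤ) (r : ℚ) (K : LaurentSeries ℚ) :
    (HahnSeries.single a r * K).coeff d = r * K.coeff (d - a) := by
  have h := HahnSeries.coeff_single_mul_add (r := r) (x := K) (a := d - a) (b := a)
  rwa [sub_add_cancel] at h

namespace SplitComplex

variable (P : SplitComplex k n)

lemma K0plus_coeff (β α : Matching n) (j : ℤ) {A B : ℤ}
    (hAB : ∀ i, i ∉ Finset.Icc A B → ∀ s, j < (P.obj i s).q) :
    (P.K0plus β α).coeff j = ∑ i ∈ Finset.Icc A B, P.chainCoeff β α j i := by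
  change ∑ᶠ i, P.chainCoeff β α j i = _
  refine finsum_eq_sum_of_support_subset _ fun i hi => ?_
  by_contra h
  apply hi
  refine Finset.sum_eq_zero fun s _ => if_neg ?_
  rintro ⟨-, -, hq⟩
  exact (hAB i h s).ne' hq

lemma coeff_mul_K0plus (β β' α' α : Matching n) (d : ℤ) {A B : ℤ}
    (hAB : ∀ i, i ∉ Finset.Icc A B → ∀ s, d + 2 * n + 1 ≤ (P.obj i s).q) :
    (laurentExpansion ℚ (loopValue ^ numCircles β β') * P.K0plus β' α' *
      laurentExpansion ℚ (loopValue ^ numCircles α' α)).coeff d =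
    ∑ i ∈ Finset.Icc A B, ∑ s, if (P.obj i s).out = β' ∧ (P.obj i s).inn = α' then
      (-1 : ℚ) ^ i * paritySign (P.obj i s).par * pairWeight β β' α' α d (P.obj i s).q else 0 := by
  have h1 : laurentExpansion ℚ (loopValue ^ numCircles β β') * P.K0plus β' α' *
      laurentExpansion ℚ (loopValue ^ numCircles α' α) =
      ∑ x : Finset (Circles β β') × Finset (Circles α' α),
        HahnSeries.single (circleQ x.1 + circleQ x.2)
          ((-1 : ℚ) ^ (numCircles β β' + numCircles α' α)) * P.K0plus β' α' := by
    rw [mul_right_comm, laurentExpansion_loopValue_pow, laurentExpansion_loopValue_pow,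
      Finset.sum_mul_sum, ← Finset.sum_mul, Fintype.sum_prod_type]
    simp only [HahnSeries.single_mul_single, pow_add]
  rw [h1, HahnSeries.coeff_sum]
  have h2 (x : Finset (Circles β β') × Finset (Circles α' α)) :
      (HahnSeries.single (circleQ x.1 + circleQ x.2)
          ((-1 : ℚ) ^ (numCircles β β' + numCircles α' α)) * P.K0plus β' α').coeff d =
      ∑ i ∈ Finset.Icc A B, ∑ s, if (P.obj i s).out = β' ∧ (P.obj i s).inn = α' then
        (-1 : ℚ) ^ i * paritySign (P.obj i s).par *
          (if circleQ x.1 + circleQ x.2 + (P.obj i s).q = d then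
            (-1) ^ (numCircles β β' + numCircles α' α) else 0) else 0 := by
    have h3 := neg_circleQ_le x.1
    have h4 := neg_circleQ_le x.2
    rw [coeff_single_mul', P.K0plus_coeff (A := A) (B := B) β' α' _ fun i hi s => by
      have := hAB i hi s
      omega, Finset.mul_sum]
    refine Finset.sum_congr rfl fun i _ => ?_
    rw [chainCoeff, Finset.mul_sum]
    refine Finset.sum_congr rfl fun s _ => ?_
    have h5 : (P.obj i s).q = d - (circleQ x.1 + circleQ x.2) ↔
        circleQ x.1 + circleQ x.2 + (P.obj i s).q = d := by omega
    simp only [h5]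
    by_cases h6 : (P.obj i s).out = β' ∧ (P.obj i s).inn = α'
    · by_cases h7 : circleQ x.1 + circleQ x.2 + (P.obj i s).q = d
      · rw [if_pos ⟨h6.1, h6.2, h7⟩, if_pos h6, if_pos h7, paritySign]
        ring
      · rw [if_neg fun h => h7 h.2.2, if_pos h6, if_neg h7, mul_zero, mul_zero]
    · rw [if_neg fun h => h6 ⟨h.1, h.2.1⟩, if_neg h6, mul_zero]
  simp only [h2]
  rw [Finset.sum_comm]
  refine Finset.sum_congr rfl fun i _ => ?_
  rw [Finset.sum_comm]
  refine Finset.sum_congr rfl fun s _ => ?_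
  split_ifs
  · rw [pairWeight, Finset.mul_sum]
  · exact Finset.sum_const_zero

/-- The class of a resolution is a generalised inverse of the Gram matrix: `G K G = G`. -/
theorem gram_mul_K0plus_mul_gram [IsDomain k] (hP : P.IsUniversalResolution) :
    (laurentExpansion ℚ).mapMatrix (gramMatrix n) * Matrix.of P.K0plus *
      (laurentExpansion ℚ).mapMatrix (gramMatrix n) =
    (laurentExpansion ℚ).mapMatrix (gramMatrix n) := by
  ext β α : 1
  ext d
  obtain ⟨A, B, hA, hB, hAB⟩ := P.exists_degree_range (d + 2 * n + 1)
  have h := P.sum_pairWeight hP β α d hA hB hAB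
  have h1 : ((laurentExpansion ℚ).mapMatrix (gramMatrix n) β α).coeff d =
      ∑ S : Finset (Circles β α), if circleQ S = d then (-1 : ℚ) ^ numCircles β α else 0 := by
    change (laurentExpansion ℚ (loopValue ^ numCircles β α)).coeff d = _
    rw [laurentExpansion_loopValue_pow, HahnSeries.coeff_sum]
    refine Finset.sum_congr rfl fun S _ => ?_
    by_cases hS : circleQ S = d
    · rw [hS, HahnSeries.coeff_single_same, if_pos rfl]
    · rw [HahnSeries.coeff_single_of_ne (Ne.symm hS), if_neg hS]
  rw [h1, ← h, Matrix.mul_apply, HahnSeries.coeff_sum]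
  simp only [Matrix.mul_apply, Finset.sum_mul, HahnSeries.coeff_sum, RingHom.mapMatrix_apply,
    Matrix.map_apply, gramMatrix, Matrix.of_apply, P.coeff_mul_K0plus _ _ _ _ d hAB]
  have h2 (α' β' : Matching n) (i : ℤ) (s : Fin (P.size i)) :
      (if (P.obj i s).out = β' ∧ (P.obj i s).inn = α' then
        (-1 : ℚ) ^ i * paritySign (P.obj i s).par * pairWeight β β' α' α d (P.obj i s).q else 0) =
      if (P.obj i s).inn = α' then if (P.obj i s).out = β' then
        (-1 : ℚ) ^ i * paritySign (P.obj i s).par * pairWeight β β' α' α d (P.obj i s).q else 0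
          else 0 := by
    by_cases h3 : (P.obj i s).out = β' <;> simp [h3]
  rw [Finset.sum_congr rfl fun α' _ => Finset.sum_comm, Finset.sum_comm]
  refine Finset.sum_congr rfl fun i _ => ?_
  rw [Finset.sum_congr rfl fun α' _ => Finset.sum_comm, Finset.sum_comm]
  refine Finset.sum_congr rfl fun s _ => ?_
  simp [h2]

theorem K0plus_eq_expand [IsDomain k] (hP : P.IsUniversalResolution)
    {p : SplitTL n (RatFunc ℚ)} (hp : IsProjector p) : P.K0plus = p.expand := by
  have h1 := P.gram_mul_K0plus_mul_gram hP
  have h2 := congrArg (laurentExpansion ℚ).mapMatrix ((isProjector_iff p).mp hp)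
  rw [map_mul, map_one] at h2
  have h3 := mul_eq_one_comm.mp h2
  set G := (laurentExpansion ℚ).mapMatrix (gramMatrix n)
  set Q := (laurentExpansion ℚ).mapMatrix (Matrix.of p)
  have h4 : Matrix.of P.K0plus = Q :=
    calc Matrix.of P.K0plus = (Q * G) * Matrix.of P.K0plus * (G * Q) := by
          rw [h2, h3, one_mul, mul_one]
      _ = Q * (G * Matrix.of P.K0plus * G) * Q := by simp only [mul_assoc]
      _ = Q := by rw [h1, h2, one_mul]
  funext β α
  exact congrFun (congrFun h4 β) α

end SplitComplex

end Class

end ArcTL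

end

theorem theorem7p8 (k : Type*) [CommRing k] [IsDomain k] (n : ℕ) :
    (∃! p : ArcTL.SplitTL n (RatFunc ℚ), ArcTL.IsProjector p) ∧
    (∃ P : ArcTL.SplitComplex k n, P.IsUniversalResolution) ∧
    ∀ (P : ArcTL.SplitComplex k n) (p : ArcTL.SplitTL n (RatFunc ℚ)),
      P.IsUniversalResolution → ArcTL.IsProjector p →
      P.K0plus = p.expand :=
  ⟨ArcTL.existsUnique_isProjector,
    ⟨ArcTL.barComplex k n, ArcTL.barComplex_isUniversalResolution k n⟩,
    fun P _ hP hp => P.K0plus_eq_expand hP hp⟩
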